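/- For a fixed window $0\neq g\in\mathcal S(\mathbb R^d)$ and $u\in\mathcal S'(\mathbb R^d)$ let $V_gu(x,y)=\int u(t)\,\overline{g(t-x)}\,e^{-2\pi i y\cdot t}\,dt$ (understood as a duality pairing) be the short-time Fourier transform, and let $M^{p,p}(\mathbb R^d)$ be the space of all $u\in\mathcal S'(\mathbb R^d)$ with $\|u\|_{M^{p,p}}=\big(\int\int |V_gu(x,y)|^p\,dx\,dy\big)^{1/p}<\infty$. Let $1<p<\infty$, and let $\mathbb R^d=\bigcup_{k=1}^N Q_k$, where the $Q_k$ are finitely many boxes (products of $d$ bounded or unbounded intervals; in particular, possibly infinite cubes with sides parallel to the coordinate axes) with pairwise disjoint interiors. Let $\varphi:\mathbb R^d\to\mathbb R^d$ be continuous and such that, for each $k$, $\varphi(x)=A_kx+b_k$ for all $x\in Q_k$, where $A_k$ is an invertible real $d\times d$ matrix and $b_k\in\mathbb R^d$. Then the change of variables $\varphi^*(u)=u\circ\varphi$ maps $M^{p,p}(\mathbb R^d)$ into itself: there is a unique bounded linear operator $\varphi^*:M^{p,p}(\mathbb R^d)\to M^{p,p}(\mathbb R^d)$ with $\varphi^*(f)=f\circ\varphi$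 for all $f\in\mathcal S(\mathbb R^d)$, and $\varphi^*(u)=f\circ\varphi$ holds for every $u\in M^{p,p}(\mathbb R^d)$ that is given by a locally integrable function $f$. (A distribution $u$ is given by a locally integrable $f$ if $u(\psi)=\int f\psi$ for all $\psi\in C_c^\infty(\mathbb R^d)$.) -/

import Mathlib

open MeasureTheory SchwartzMap
open scoped ENNReal NNReal FourierTransform

namespace ModulationSpaces

noncomputable section

/-- Euclidean space `ℝ^d`. -/
abbrev Eucl (d : ℕ) : Type := EuclideanSpace ℝ (Fin d)

/-- The character `t ↦ e^{-2 π i y · t}` of `ℝ^d`. -/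
def character {d : ℕ} (y : Eucl d) (t : Eucl d) : ℂ :=
  Complex.exp (-(2 * Real.pi * Complex.I) * (inner ℝ y t : ℝ))

theorem hasTemperateGrowth_character {d : ℕ} (y : Eucl d) :
    (character y).HasTemperateGrowth := by
  set c : ℂ := -(2 * Real.pi * Complex.I) with hc
  have hexp : (fun s : ℝ => Complex.exp (c * s)).HasTemperateGrowth := by
    have hder : ∀ n : ℕ, iteratedDeriv n (fun s : ℝ => Complex.exp (c * s)) =
        fun s : ℝ => c ^ n * Complex.exp (c * s) := by
      intro n
      induction n with
      | zero => simp
      | succ n ih =>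
        rw [iteratedDeriv_succ, ih]
        funext s
        have h1 : HasDerivAt (fun s : ℝ => c * (s : ℂ)) (c * 1) s :=
          (Complex.ofRealCLM.hasDerivAt (x := s)).const_mul c
        have h2 := (h1.cexp).const_mul (c ^ n)
        rw [h2.deriv]
        ring
    refine ⟨(contDiff_const.mul Complex.ofRealCLM.contDiff).cexp, fun n => ⟨0, ‖c‖ ^ n, fun s => ?_⟩⟩
    rw [norm_iteratedFDeriv_eq_norm_iteratedDeriv, hder]
    have : ‖Complex.exp (c * s)‖ = 1 := by
      rw [Complex.norm_exp]
      simp [hc]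
    simp [this]
  exact hexp.comp (f := fun t : Eucl d => (inner ℝ y t : ℝ))
    (Function.hasTemperateGrowth_inner_right y)

/-- The Schwartz function `t ↦ conj (g (t - x)) * e^{-2 π i y · t}`
(see `stftAtom_apply`). -/
def stftAtom {d : ℕ} (g : 𝓢(Eucl d, ℂ)) (x y : Eucl d) : 𝓢(Eucl d, ℂ) :=
  smulLeftCLM ℂ (character y)
    (compSubConstCLM ℂ x (postcompCLM (𝕜 := ℝ) (Complex.conjCLE : ℂ →L[ℝ] ℂ) g))

theorem stftAtom_apply {d : ℕ} (g : 𝓢(Eucl d, ℂ)) (x y t : Eucl d) :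
    stftAtom g x y t =
      (starRingEnd ℂ) (g (t - x)) * Complex.exp (-(2 * Real.pi * Complex.I) * (inner ℝ y t : ℝ)) := by
  rw [stftAtom, smulLeftCLM_apply_apply (hasTemperateGrowth_character y)]
  simp [character, mul_comm]

/-- The short-time Fourier transform `V_g u (x, y)` of a tempered distribution `u` with respect
to the window `g`, i.e. `∫ u(t) conj (g (t - x)) e^{-2 π i y · t} dt` when `u` is a function. -/
def stft {d : ℕ} (g : 𝓢(Eucl d, ℂ)) (u : 𝓢'(Eucl d, ℂ)) (x y : Eucl d) : ℂ :=
  u (stftAtom g x y)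

/-- The modulation space norm
`‖u‖_{M^{p,q}} = (∫ (∫ |V_g u (x, y)|^p dx)^{q/p} dy)^{1/q}`,
with essential suprema for infinite exponents; the value `∞` is allowed. -/
def modulationNorm {d : ℕ} (g : 𝓢(Eucl d, ℂ)) (p q : ℝ≥0∞) (u : 𝓢'(Eucl d, ℂ)) : ℝ≥0∞ :=
  eLpNorm (fun y : Eucl d => eLpNorm (fun x : Eucl d => stft g u x y) p volume) q volume

/-! ### Measurability of the short-time Fourier transform -/

/-- Translations act continuously on a Schwartz function. -/
theorem continuous_translate {d : ℕ} (h : 𝓢(Eucl d, ℂ)) :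
    Continuous (fun a : Eucl d => compSubConstCLM ℂ a h) := by
  have key : Filter.Tendsto (fun a : Eucl d => compSubConstCLM ℂ a h) (nhds 0) (nhds h) := by
    rw [(schwartz_withSeminorms ℝ (Eucl d) ℂ).tendsto_nhds]
    rintro ⟨k, n⟩ ε hε
    obtain ⟨M, hM⟩ : ∃ M : ℝ, ∀ z : Eucl d, (1 + ‖z‖) ^ k * ‖iteratedFDeriv ℝ (n + 1) h z‖ ≤ M :=
      ⟨_, fun z => one_add_le_sup_seminorm_apply (𝕜 := ℝ) (m := (k, n + 1)) le_rfl le_rfl h z⟩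
    have hM0 : 0 ≤ M := le_trans (by positivity) (hM 0)
    have hδ : 0 < min 1 (ε / (2 ^ k * M + 1)) := by positivity
    filter_upwards [Metric.ball_mem_nhds (0 : Eucl d) hδ] with a ha
    rw [mem_ball_zero_iff, lt_min_iff] at ha
    obtain ⟨ha1, ha2⟩ := ha
    refine lt_of_le_of_lt (SchwartzMap.seminorm_le_bound ℝ k n _ (M := 2 ^ k * M * ‖a‖)
      (by positivity) fun x => ?_) ?_
    · have hsub : iteratedFDeriv ℝ n (⇑(compSubConstCLM ℂ a h - h)) x =
          iteratedFDeriv ℝ n h (x - a) - iteratedFDeriv ℝ n h x := by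
        have e : (⇑(compSubConstCLM ℂ a h - h)) = (fun z => h (z - a)) - ⇑h := rfl
        rw [e, iteratedFDeriv_sub_apply, iteratedFDeriv_comp_sub]
        · exact ((h.smooth n).comp (contDiff_id.sub contDiff_const)).contDiffAt
        · exact (h.smooth n).contDiffAt
      have hmv : ‖x‖ ^ k * ‖iteratedFDeriv ℝ n h (x - a) - iteratedFDeriv ℝ n h x‖ ≤
          2 ^ k * M * ‖a‖ := by
        have hb : ∀ z ∈ segment ℝ x (x - a), ‖x‖ ^ k * ‖fderiv ℝ (iteratedFDeriv ℝ n h) z‖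
            ≤ 2 ^ k * M := by
          intro z hz
          have hzx : ‖x - z‖ ≤ 1 := by
            rw [segment_eq_image'] at hz
            obtain ⟨θ, ⟨h0, h1⟩, rfl⟩ := hz
            have : x - (x + θ • (x - a - x)) = θ • a := by
              rw [sub_sub_cancel_left, smul_neg]; abel
            rw [this, norm_smul, Real.norm_of_nonneg h0]
            nlinarith [norm_nonneg a]
          have hx : ‖x‖ ≤ 2 * (1 + ‖z‖) := by
            have := norm_sub_norm_le x z
            nlinarith [norm_nonneg z]
          rw [norm_fderiv_iteratedFDeriv]
          calc ‖x‖ ^ k * ‖iteratedFDeriv ℝ (n + 1) h z‖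
              ≤ (2 * (1 + ‖z‖)) ^ k * ‖iteratedFDeriv ℝ (n + 1) h z‖ := by gcongr
            _ = 2 ^ k * ((1 + ‖z‖) ^ k * ‖iteratedFDeriv ℝ (n + 1) h z‖) := by
              rw [mul_pow]; ring
            _ ≤ 2 ^ k * M := by gcongr; exact hM z
        have hdiff : ∀ z, DifferentiableAt ℝ (iteratedFDeriv ℝ n h) z := fun z =>
          ((h.smooth (n + 1)).differentiable_iteratedFDeriv (by norm_cast; omega)) z
        rcases (pow_nonneg (norm_nonneg x) k).eq_or_lt with h0 | h0
        · rw [← h0, zero_mul]; positivity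
        · have := (convex_segment x (x - a)).norm_image_sub_le_of_norm_fderiv_le
            (C := 2 ^ k * M / ‖x‖ ^ k) (fun z _ => hdiff z)
            (fun z hz => by rw [le_div_iff₀ h0, mul_comm]; exact hb z hz)
            (left_mem_segment ℝ x (x - a)) (right_mem_segment ℝ x (x - a))
          rw [sub_sub_cancel_left, norm_neg] at this
          calc _ ≤ ‖x‖ ^ k * (2 ^ k * M / ‖x‖ ^ k * ‖a‖) := by gcongr
            _ = _ := by field_simp
      rw [hsub]; exact hmv
    · rw [lt_div_iff₀ (by positivity)] at ha2
      nlinarith [norm_nonneg a]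
  rw [continuous_iff_continuousAt]
  intro a₀
  have h1 : Filter.Tendsto (fun a : Eucl d => a - a₀) (nhds a₀) (nhds 0) := by
    have : Continuous (fun a : Eucl d => a - a₀) := by fun_prop
    simpa using this.tendsto a₀
  have h2 := ((compSubConstCLM ℂ a₀ : 𝓢(Eucl d, ℂ) →L[ℂ] 𝓢(Eucl d, ℂ)).continuous.tendsto h).comp
    (key.comp h1)
  refine h2.congr fun a => ?_
  simp

/-- Modulations act continuously on a Schwartz function. -/
theorem continuous_modulate {d : ℕ} (h : 𝓢(Eucl d, ℂ)) :
    Continuous (fun y : Eucl d => smulLeftCLM ℂ (character y) h) := by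
  have hF : ∀ y : Eucl d, smulLeftCLM ℂ (character y) h =
      𝓕⁻ (compSubConstCLM ℂ (-y) (𝓕 h)) := by
    intro y
    have hinv : 𝓕⁻ (𝓕 (smulLeftCLM ℂ (character y) h)) = smulLeftCLM ℂ (character y) h :=
      FourierTransform.fourierInv_fourier_eq _
    rw [← hinv]
    congr 1
    ext ξ
    rw [compSubConstCLM_apply, SchwartzMap.fourier_coe, SchwartzMap.fourier_coe, Real.fourier_eq',
      Real.fourier_eq']
    congr 1
    funext t
    rw [smulLeftCLM_apply_apply (hasTemperateGrowth_character y), smul_eq_mul, smul_eq_mul,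
      smul_eq_mul, ← mul_assoc, character, ← Complex.exp_add]
    congr 2
    rw [sub_neg_eq_add, inner_add_right, real_inner_comm y t]
    push_cast
    ring
  simp_rw [hF]
  have := continuous_translate (𝓕 h)
  have hc : Continuous (fun f : 𝓢(Eucl d, ℂ) => 𝓕⁻ f) :=
    ContinuousFourierInv.continuous_fourierInv
  exact hc.comp (this.comp continuous_neg)

theorem continuous_stft_left {d : ℕ} (g : 𝓢(Eucl d, ℂ)) (u : 𝓢'(Eucl d, ℂ)) (y : Eucl d) :
    Continuous (fun x => stft g u x y) := by
  have h1 := continuous_translate (postcompCLM (𝕜 := ℝ) (Complex.conjCLE : ℂ →L[ℝ] ℂ) g)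
  have h2 := (SchwartzMap.smulLeftCLM ℂ (character y) : 𝓢(Eucl d, ℂ) →L[ℂ] 𝓢(Eucl d, ℂ)).continuous
  exact u.continuous.comp (h2.comp h1)

theorem continuous_stft_right {d : ℕ} (g : 𝓢(Eucl d, ℂ)) (u : 𝓢'(Eucl d, ℂ)) (x : Eucl d) :
    Continuous (fun y => stft g u x y) :=
  u.continuous.comp (continuous_modulate _)

theorem measurable_stft {d : ℕ} (g : 𝓢(Eucl d, ℂ)) (u : 𝓢'(Eucl d, ℂ)) :
    Measurable (fun z : Eucl d × Eucl d => stft g u z.1 z.2) :=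
  measurable_uncurry_of_continuous_of_measurable (u := fun x y => stft g u x y)
    (fun y => continuous_stft_left g u y) (fun x => (continuous_stft_right g u x).measurable)

theorem measurable_eLpNorm_stft {d : ℕ} (g : 𝓢(Eucl d, ℂ)) (p : ℝ≥0∞) (u : 𝓢'(Eucl d, ℂ)) :
    Measurable (fun y => eLpNorm (fun x : Eucl d => stft g u x y) p volume) := by
  rcases eq_or_ne p 0 with rfl | hp0
  · simp
  rcases eq_or_ne p ∞ with rfl | hpt
  · obtain ⟨s, hs, hsd⟩ := TopologicalSpace.exists_countable_dense (Eucl d)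
    have : ∀ y, eLpNorm (fun x : Eucl d => stft g u x y) ∞ volume = ⨆ x ∈ s, ‖stft g u x y‖ₑ := by
      intro y
      have hc : Continuous (fun x => ‖stft g u x y‖ₑ) := (continuous_stft_left g u y).enorm
      rw [eLpNorm_exponent_top, eLpNormEssSup_eq_essSup_enorm]
      apply le_antisymm
      · refine essSup_le_of_ae_le _ (Filter.Eventually.of_forall fun x => ?_)
        have hcl : IsClosed {x | ‖stft g u x y‖ₑ ≤ ⨆ x ∈ s, ‖stft g u x y‖ₑ} :=
          isClosed_le hc continuous_const
        have hsub : s ⊆ {x | ‖stft g u x y‖ₑ ≤ ⨆ x ∈ s, ‖stft g u x y‖ₑ} := fun x hx =>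
          le_iSup₂ (f := fun x (_ : x ∈ s) => ‖stft g u x y‖ₑ) x hx
        exact (hcl.closure_subset_iff.2 hsub) (hsd x)
      · refine iSup₂_le fun x _ => ?_
        by_contra! hlt
        have hop : IsOpen {z | essSup (fun x => ‖stft g u x y‖ₑ) volume < ‖stft g u z y‖ₑ} :=
          isOpen_lt continuous_const hc
        have h0 := hop.measure_pos volume ⟨x, hlt⟩
        exact h0.ne' (meas_essSup_lt)
    simp_rw [this]
    exact Measurable.biSup s hs fun x _ => (continuous_stft_right g u x).measurable.enorm
  · simp_rw [eLpNorm_eq_lintegral_rpow_enorm_toReal hp0 hpt]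
    refine Measurable.pow_const ?_ _
    exact Measurable.lintegral_prod_left' (f := fun z : Eucl d × Eucl d =>
      ‖stft g u z.1 z.2‖ₑ ^ p.toReal) ((measurable_stft g u).enorm.pow_const _)

theorem modulationNorm_zero {d : ℕ} (g : 𝓢(Eucl d, ℂ)) (p q : ℝ≥0∞) :
    modulationNorm g p q 0 = 0 := by
  have : ∀ x y, stft g 0 x y = 0 := fun x y => rfl
  simp [modulationNorm, this]

theorem modulationNorm_add_lt_top {d : ℕ} (g : 𝓢(Eucl d, ℂ)) (p q : ℝ≥0∞)
    {u v : 𝓢'(Eucl d, ℂ)} (hu : modulationNorm g p q u < ∞) (hv : modulationNorm g p q v < ∞) :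
    modulationNorm g p q (u + v) < ∞ := by
  set U := fun y => eLpNorm (fun x : Eucl d => stft g u x y) p volume with hU
  set V := fun y => eLpNorm (fun x : Eucl d => stft g v x y) p volume with hV
  have h1 : ∀ y, eLpNorm (fun x : Eucl d => stft g (u + v) x y) p volume ≤
      ENNReal.LpAddConst p * (U y + V y) := by
    intro y
    exact eLpNorm_add_le' (continuous_stft_left g u y).aestronglyMeasurable
      (continuous_stft_left g v y).aestronglyMeasurable p
  have hUm : Measurable U := measurable_eLpNorm_stft g p u
  have hVm : Measurable V := measurable_eLpNorm_stft g p v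
  have h2 : eLpNorm (U + V) q volume < ∞ := by
    exact eLpNorm_add_lt_top ⟨hUm.aestronglyMeasurable, hu⟩ ⟨hVm.aestronglyMeasurable, hv⟩
  have hC : ENNReal.LpAddConst p ≠ ∞ := (ENNReal.LpAddConst_lt_top p).ne
  refine lt_of_le_of_lt (eLpNorm_le_nnreal_smul_eLpNorm_of_ae_le_mul'
    (c := (ENNReal.LpAddConst p).toNNReal) (g := U + V) (Filter.Eventually.of_forall fun y => ?_) q) ?_
  · rw [enorm_eq_self, enorm_eq_self, ENNReal.coe_toNNReal hC]
    exact h1 y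
  · exact ENNReal.mul_lt_top ENNReal.coe_lt_top h2

theorem modulationNorm_smul_lt_top {d : ℕ} (g : 𝓢(Eucl d, ℂ)) (p q : ℝ≥0∞) (c : ℂ)
    {u : 𝓢'(Eucl d, ℂ)} (hu : modulationNorm g p q u < ∞) :
    modulationNorm g p q (c • u) < ∞ := by
  refine lt_of_le_of_lt (eLpNorm_le_nnreal_smul_eLpNorm_of_ae_le_mul'
    (c := ‖c‖₊) (g := fun y => eLpNorm (fun x : Eucl d => stft g u x y) p volume)
    (Filter.Eventually.of_forall fun y => ?_) q) (ENNReal.mul_lt_top ENNReal.coe_lt_top hu)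
  rw [enorm_eq_self, enorm_eq_self]
  exact (eLpNorm_const_smul c (fun x : Eucl d => stft g u x y) p volume).le

/-- The modulation space `M^{p,q}(ℝ^d)`, defined with the window `g`: the tempered distributions
of finite modulation space norm. -/
def modulationSpace {d : ℕ} (g : 𝓢(Eucl d, ℂ)) (p q : ℝ≥0∞) : Submodule ℂ 𝓢'(Eucl d, ℂ) where
  carrier := {u | modulationNorm g p q u < ∞}
  zero_mem' := by simp [modulationNorm_zero]
  add_mem' := modulationNorm_add_lt_top g p q
  smul_mem' c _ := modulationNorm_smul_lt_top g p q c

/-- The tempered distribution `u` is (given by) the locally integrable function `f`: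
`u(ψ) = ∫ f ψ` for all test functions `ψ ∈ C_c^∞(ℝ^d)`. -/
def IsGivenBy {d : ℕ} (u : 𝓢'(Eucl d, ℂ)) (f : Eucl d → ℂ) : Prop :=
  LocallyIntegrable f volume ∧
    ∀ ψ : 𝓢(Eucl d, ℂ), HasCompactSupport ψ → u ψ = ∫ t, f t * ψ t

/-- `T` is a bounded linear operator on `M^{p,q}(ℝ^d)` which extends the change of variables
`f ↦ f ∘ φ` on Schwartz functions `f`. -/
structure IsChangeOfVariables {d : ℕ} (g : 𝓢(Eucl d, ℂ)) (p q : ℝ≥0∞) (φ : Eucl d → Eucl d)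
    (T : modulationSpace g p q →ₗ[ℂ] modulationSpace g p q) : Prop where
  bounded : ∃ C : ℝ≥0, ∀ u : modulationSpace g p q,
    modulationNorm g p q (T u : 𝓢'(Eucl d, ℂ)) ≤ C * modulationNorm g p q (u : 𝓢'(Eucl d, ℂ))
  comp_schwartz : ∀ (u : modulationSpace g p q) (f : 𝓢(Eucl d, ℂ)),
    IsGivenBy (u : 𝓢'(Eucl d, ℂ)) f → IsGivenBy (T u : 𝓢'(Eucl d, ℂ)) (fun x => f (φ x))

/-- A box with sides parallel to the coordinate axes: a product of `d` intervals, each of which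
may be bounded or unbounded, and may or may not contain its end points. -/
def IsAxisParallelBox {d : ℕ} (Q : Set (Eucl d)) : Prop :=
  ∃ I : Fin d → Set ℝ, (∀ i, (I i).OrdConnected) ∧ Q = {x | ∀ i, x i ∈ I i}

end

end ModulationSpaces

/-! Off the null boundaries of the boxes, `f ∘ φ` is the sum over `k` of the indicator of `Q k`
times `f (A_k x + b_k)`. Hence the operator is a finite sum of affine pullbacks followed by
truncations to boxes, and each factor has to be bounded on `M^{p,p}` and to act on locally
integrable functions as expected.

An affine pullback carries a time-frequency atom to an atom with another window, up to a phase,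
while phase space undergoes an affine change of variables (`stftLpPow_affinePullback`). Changing the
window costs only a constant, by the inversion formula and Young's inequality
(`exists_stftLpPow_le`).

Truncation is the real point. For fixed `x`, the coefficients of `1_Q f` are the Fourier transform
of `1_Q` times a Schwartz function, so a bound for `1_Q` as an `L^q` Fourier multiplier, integrated
over `x`, bounds the coefficients of `1_Q f` in `L^q` of phase space
(`IsMultiplierSet.exists_lintegral_dualStft_indicator_le`). Equality of the two exponents allows the
slices to be integrated in this order. Duality between the conjugate exponents then truncates every
element of `M^{p,p}` (`exists_truncation_operator`), and a regularised Parseval identity identifies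
the result for locally integrable functions (`truncatedPairing_of_isGivenBy`).

A box is an intersection of half-spaces, so only half-spaces need to be multipliers. For the
exponent `2m` this is an argument in the spirit of M. Riesz: if `w` and `conj z` are the transforms
of the parts of `h` inside and outside `H`, then `w z` is the transform of a function supported in a
half-space with `0` on its boundary, so the integral of `(w z) ^ m` vanishes, and an algebraic
inequality bounds `|w|^(2m)` by `|w + conj z|^(2m)` modulo the real part of `(-w z)^m`.
Interpolation with `L²` gives all exponents above `2`, self-adjointness those below.

Uniqueness follows from the density of Schwartz functions (`exists_schwartz_stftLpPow_sub_le`). -/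

namespace ModulationSpaces

/-! ### Half-space multipliers at even exponents. -/

section FourierL2

variable {V : Type*} [NormedAddCommGroup V] [InnerProductSpace ℝ V] [FiniteDimensional ℝ V]
  [MeasurableSpace V] [BorelSpace V]

open scoped ComplexConjugate Convolution

theorem continuous_fourier_of_integrable {h : V → ℂ} (h1 : Integrable h) : Continuous (𝓕 h) :=
  VectorFourier.fourierIntegral_continuous Real.continuous_fourierChar continuous_inner h1

theorem norm_fourier_le_integral (h : V → ℂ) (y : V) : ‖𝓕 h y‖ ≤ ∫ t, ‖h t‖ :=
  VectorFourier.norm_fourierIntegral_le_integral_norm _ _ _ _ _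

theorem integral_fourier_mul_eq_of_integrable {f g : V → ℂ} (hf : Integrable f)
    (hg : Integrable g) : ∫ y, 𝓕 f y * g y = ∫ t, f t * 𝓕 g t := by
  simpa using! VectorFourier.integral_bilin_fourierIntegral_eq_flip (ContinuousLinearMap.mul ℂ ℂ)
    (L := innerₗ V) Real.continuous_fourierChar continuous_inner hf hg

/-- On `L¹ ∩ L²` the Fourier transform of `L²` is given by the Fourier integral. -/
theorem fourier_toLp_ae_eq {h : V → ℂ} (h1 : Integrable h) (h2 : MemLp h 2) :
    (𝓕 (h2.toLp h) : Lp ℂ 2 (volume : Measure V)) =ᵐ[volume] 𝓕 h := by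
  have hL : LocallyIntegrable (𝓕 (h2.toLp h) : Lp ℂ 2 (volume : Measure V)) volume :=
    (Lp.memLp _).locallyIntegrable (by norm_num)
  have hc : LocallyIntegrable (𝓕 h) volume :=
    (continuous_fourier_of_integrable h1).locallyIntegrable
  refine ae_eq_of_integral_contDiff_smul_eq hL hc fun g hg hgc => ?_
  have hg1 : HasCompactSupport (Complex.ofRealCLM ∘ g) := hgc.comp_left rfl
  have hg2 : ContDiff ℝ (⊤ : ℕ∞) (Complex.ofRealCLM ∘ g) := by fun_prop
  set ψ : 𝓢(V, ℂ) := hg1.toSchwartzMap hg2 with hψ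
  have hψg : ∀ x, ψ x = (g x : ℂ) := fun x => rfl
  have e1 := congrArg (fun T : 𝓢'(V, ℂ) => T ψ)
    (Lp.fourier_toTemperedDistribution_eq (h2.toLp h))
  simp only [TemperedDistribution.fourier_apply, Lp.toTemperedDistribution_apply] at e1
  calc ∫ x, g x • (𝓕 (h2.toLp h) : Lp ℂ 2 (volume : Measure V)) x
      = ∫ x, ψ x • (𝓕 (h2.toLp h) : Lp ℂ 2 (volume : Measure V)) x := by simp [hψg]
    _ = ∫ x, 𝓕 ψ x • (h2.toLp h) x := e1.symm
    _ = ∫ x, h x * 𝓕 (ψ : V → ℂ) x := by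
      refine integral_congr_ae ?_
      filter_upwards [h2.coeFn_toLp] with x hx
      rw [hx, smul_eq_mul, mul_comm, SchwartzMap.fourier_coe]
    _ = ∫ x, 𝓕 h x * ψ x := (integral_fourier_mul_eq_of_integrable h1 ψ.integrable).symm
    _ = ∫ x, g x • 𝓕 h x := by
      refine integral_congr_ae (Filter.Eventually.of_forall fun x => ?_)
      simp [hψg, mul_comm]

theorem memLp_two_fourier {h : V → ℂ} (h1 : Integrable h) (h2 : MemLp h 2) : MemLp (𝓕 h) 2 :=
  (memLp_congr_ae (fourier_toLp_ae_eq h1 h2)).1 (Lp.memLp _)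

/-- The integral is the value at `0` of the inverse transform of `𝓕 q`. That function is continuous
and agrees with `q = 0` on the open half-space, which has `0` on its boundary; the limit is taken
along `s • v` as `s` increases to `0`. -/
theorem integral_fourier_eq_zero {q : V → ℂ} {v : V} (hv : v ≠ 0) (hq : Integrable q)
    (hq0 : ∀ x, inner ℝ v x < 0 → q x = 0) (hF : Integrable (𝓕 q)) : ∫ y, 𝓕 q y = 0 := by
  have hcont : Continuous (𝓕⁻ (𝓕 q)) := by
    rw [Real.fourierInv_eq_fourier_comp_neg]
    exact continuous_fourier_of_integrable hF.comp_neg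
  have hvv : 0 < inner ℝ v v := real_inner_self_pos.2 hv
  have hz : ∀ s : ℝ, s < 0 → 𝓕⁻ (𝓕 q) (s • v) = 0 := by
    intro s hs
    have hlt : inner ℝ v (s • v) < 0 := by
      rw [inner_smul_right]; exact mul_neg_of_neg_of_pos hs hvv
    have hopen : IsOpen {x : V | inner ℝ v x < 0} :=
      isOpen_lt (by fun_prop) continuous_const
    have hev : q =ᶠ[nhds (s • v)] fun _ => 0 :=
      Filter.eventually_of_mem (hopen.mem_nhds hlt) fun x hx => hq0 x hx
    rw [hq.fourierInv_fourier_eq hF (continuousAt_const.congr hev.symm), hq0 _ hlt]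
  have h0 : 𝓕⁻ (𝓕 q) 0 = 0 := by
    have ht : Filter.Tendsto (fun s : ℝ => 𝓕⁻ (𝓕 q) (s • v)) (nhdsWithin 0 (Set.Iio 0))
        (nhds (𝓕⁻ (𝓕 q) ((0 : ℝ) • v))) :=
      ((hcont.comp (continuous_id.smul continuous_const)).tendsto (0 : ℝ)).mono_left
        nhdsWithin_le_nhds
    rw [zero_smul] at ht
    refine tendsto_nhds_unique ht (tendsto_const_nhds.congr' ?_)
    filter_upwards [self_mem_nhdsWithin] with s hs
    exact (hz s hs).symm
  rw [Real.fourierInv_eq'] at h0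
  simpa using h0

/-- The witness is the convolution power of `q`; the half-space carrying the support is closed under
addition. -/
theorem exists_fourier_eq_pow {q : V → ℂ} {v : V} (hq : Integrable q)
    (hq0 : ∀ x, inner ℝ v x < 0 → q x = 0) (m : ℕ) :
    ∃ r : V → ℂ, Integrable r ∧ (∀ x, inner ℝ v x < 0 → r x = 0) ∧
      ∀ y, 𝓕 r y = (𝓕 q y) ^ (m + 1) := by
  induction m with
  | zero => exact ⟨q, hq, hq0, fun y => by simp⟩
  | succ m ih =>
    obtain ⟨r, hr, hr0, hrF⟩ := ih
    refine ⟨r ⋆[ContinuousLinearMap.mul ℂ ℂ] q, hr.integrable_convolution _ hq, fun x hx => ?_,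
      fun y => ?_⟩
    · refine integral_eq_zero_of_ae (Filter.Eventually.of_forall fun t => ?_)
      rcases lt_or_ge (inner ℝ v t) 0 with ht | ht
      · simp [hr0 t ht]
      · have : inner ℝ v (x - t) < 0 := by rw [inner_sub_right]; linarith
        simp [hq0 _ this]
    · rw [Real.fourier_mul_convolution_eq hr hq, hrF, pow_succ (𝓕 q y) (m + 1)]

/-- If `w + conj z` is small relative to `w`, then `-(w z)` is close to `|w|²`, and the real part of
its `m`-th power is at least `|w|^(2m) / 2`. Otherwise `w` and the real part are both controlled by
`w + conj z`. -/
theorem exists_norm_pow_le (m : ℕ) (hm : m ≠ 0) : ∃ C : ℝ, 0 ≤ C ∧ ∀ w z : ℂ,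
    ‖w‖ ^ (2 * m) ≤ C * ‖w + conj z‖ ^ (2 * m) + 2 * ((-(w * z)) ^ m).re := by
  obtain ⟨c, hc0, hc⟩ : ∃ c : ℝ, 0 < c ∧ ∀ η : ℂ, ‖η - 1‖ ≤ c → 1 / 2 ≤ (η ^ m).re := by
    have hcont : Continuous fun η : ℂ => (η ^ m).re := by fun_prop
    have hmem : {η : ℂ | 1 / 2 < (η ^ m).re} ∈ nhds (1 : ℂ) :=
      (isOpen_lt continuous_const hcont).mem_nhds (by norm_num)
    obtain ⟨ε, hε, hball⟩ := Metric.nhds_basis_closedBall.mem_iff.1 hmem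
    exact ⟨ε, hε, fun η hη => (hball (by simpa [dist_eq_norm] using hη)).le⟩
  -- Both terms come from the case `‖w‖ < e / c`: the first bounds `‖w‖ ^ (2 * m)`, the second
  -- absorbs a possibly negative real part through `‖w z‖ ≤ ‖w‖ ^ 2 + ‖w‖ e`.
  refine ⟨(1 / c) ^ (2 * m) + 2 * ((1 / c) ^ 2 + 1 / c) ^ m, by positivity, fun w z => ?_⟩
  set e := ‖w + conj z‖ with he
  have hζ : -(w * z) = (‖w‖ : ℂ) ^ 2 - w * conj (w + conj z) := by
    rw [← Complex.mul_conj' w]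
    simp only [map_add, Complex.conj_conj]
    ring
  rcases le_or_gt e (c * ‖w‖) with h | h
  · rcases eq_or_ne w 0 with rfl | hw
    · have : 0 ≤ e := norm_nonneg _
      simp only [norm_zero, zero_mul, neg_zero]
      rw [zero_pow (by omega), zero_pow hm]
      simp only [Complex.zero_re, mul_zero, add_zero]
      positivity
    · have hw' : (‖w‖ : ℂ) ≠ 0 := by simpa using hw
      set η : ℂ := 1 - w * conj (w + conj z) / (‖w‖ : ℂ) ^ 2 with hη
      have h1 : ‖η - 1‖ ≤ c := by
        rw [hη, sub_sub_cancel_left, norm_neg, norm_div, norm_mul, Complex.norm_conj, norm_pow,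
          Complex.norm_real, norm_norm, div_le_iff₀ (by positivity)]
        nlinarith [norm_nonneg w]
      have h2 : -(w * z) = (‖w‖ : ℂ) ^ 2 * η := by
        rw [hζ, hη]; field_simp
      have h3 := hc η h1
      have h4 : ((-(w * z)) ^ m).re = ‖w‖ ^ (2 * m) * (η ^ m).re := by
        rw [h2, mul_pow, ← pow_mul, ← Complex.ofReal_pow, Complex.re_ofReal_mul]
      rw [h4]
      have h5 : 0 ≤ ((1 / c) ^ (2 * m) + 2 * ((1 / c) ^ 2 + 1 / c) ^ m) * e ^ (2 * m) := by
        have : 0 ≤ e := norm_nonneg _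
        positivity
      have h6 : 0 ≤ ‖w‖ ^ (2 * m) := by positivity
      nlinarith
  · have hx : ‖w‖ ≤ 1 / c * e := by
      rw [one_div, inv_mul_eq_div, le_div_iff₀ hc0]; linarith
    have he0 : 0 ≤ e := norm_nonneg _
    have h1 : ‖w‖ ^ (2 * m) ≤ (1 / c) ^ (2 * m) * e ^ (2 * m) := by
      rw [← mul_pow]; gcongr
    have h2 : ‖-(w * z)‖ ≤ ((1 / c) ^ 2 + 1 / c) * e ^ 2 := by
      rw [hζ]
      calc _ ≤ ‖(‖w‖ : ℂ) ^ 2‖ + ‖w * conj (w + conj z)‖ := norm_sub_le _ _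
        _ = ‖w‖ ^ 2 + ‖w‖ * e := by
          rw [norm_mul, Complex.norm_conj, norm_pow, Complex.norm_real, norm_norm]
        _ ≤ (1 / c * e) ^ 2 + (1 / c * e) * e := by gcongr
        _ = _ := by ring
    have h3 : -(((1 / c) ^ 2 + 1 / c) ^ m * e ^ (2 * m)) ≤ ((-(w * z)) ^ m).re := by
      have h4 := Complex.abs_re_le_norm ((-(w * z)) ^ m)
      rw [norm_pow] at h4
      have h5 : ‖-(w * z)‖ ^ m ≤ (((1 / c) ^ 2 + 1 / c) * e ^ 2) ^ m := by gcongr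
      rw [mul_pow, ← pow_mul] at h5
      have := neg_abs_le ((-(w * z)) ^ m).re
      linarith
    nlinarith

theorem integrable_norm_pow_of_bounded {f : V → ℂ} (h2 : MemLp f 2) {B : ℝ} (hB : ∀ x, ‖f x‖ ≤ B)
    {n : ℕ} (hn : 2 ≤ n) : Integrable fun x => ‖f x‖ ^ n := by
  obtain ⟨k, rfl⟩ := Nat.exists_eq_add_of_le hn
  have h := h2.integrable_norm_pow (by norm_num)
  have h' : Integrable fun x => ‖f x‖ ^ k * ‖f x‖ ^ 2 := by
    refine Integrable.bdd_mul (c := B ^ k) (by simpa using h)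
      ((h2.1.norm).pow k) (Filter.Eventually.of_forall fun x => ?_)
    rw [norm_pow, norm_norm]
    exact pow_le_pow_left₀ (norm_nonneg _) (hB x) k
  refine h'.congr (Filter.Eventually.of_forall fun x => ?_)
  simp only
  ring

/-- `H` is a measurable half-space with normal vector `v`; parts of the boundary hyperplane may or
may not belong to it. -/
structure IsHalfSpace (v : V) (H : Set V) : Prop where
  ne_zero : v ≠ 0
  measurableSet : MeasurableSet H
  inner_le : ∀ x ∈ H, ∀ y ∉ H, inner ℝ v y ≤ inner ℝ v x

theorem fourier_conj_neg (k : V → ℂ) (y : V) :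
    𝓕 (fun t => conj (k (-t))) y = conj (𝓕 k y) := by
  rw [Real.fourier_eq', Real.fourier_eq', ← integral_conj,
    ← integral_neg_eq_self (fun t => _)]
  refine integral_congr_ae (Filter.Eventually.of_forall fun t => ?_)
  simp [← Complex.exp_conj, Complex.conj_ofNat]

/-- The pointwise inequality `exists_norm_pow_le` is applied to the transforms of the two parts of
`h` and integrated; the real part contributes nothing by `integral_fourier_eq_zero`. The constant
depends on `m` alone. -/
theorem exists_integral_fourier_indicator_le (m : ℕ) (hm : m ≠ 0) : ∃ C : ℝ, 0 ≤ C ∧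
    ∀ (v : V) (H : Set V), IsHalfSpace v H → ∀ h : V → ℂ, Integrable h → MemLp h 2 →
      ∫ y, ‖𝓕 (H.indicator h) y‖ ^ (2 * m) ≤ C * ∫ y, ‖𝓕 h y‖ ^ (2 * m) := by
  obtain ⟨C, hC0, hC⟩ := exists_norm_pow_le m hm
  refine ⟨C, hC0, fun v H hH h h1 h2 => ?_⟩
  set a := H.indicator h with ha
  set k := Hᶜ.indicator h with hk
  have ha1 : Integrable a := h1.indicator hH.measurableSet
  have hk1 : Integrable k := h1.indicator hH.measurableSet.compl
  have ha2 : MemLp a 2 := h2.indicator hH.measurableSet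
  have hk2 : MemLp k 2 := h2.indicator hH.measurableSet.compl
  -- The reflection makes `𝓕 b` the conjugate of `𝓕 k`, so that `𝓕 a + conj (𝓕 b) = 𝓕 h`, and it
  -- turns differences of points of `H` and its complement into the support of `a ⋆ b`.
  set b : V → ℂ := fun t => conj (k (-t)) with hb
  have hb1 : Integrable b := by
    have := hk1.comp_neg
    exact (Complex.conjCLE : ℂ →L[ℝ] ℂ).integrable_comp this
  have hbF : ∀ y, 𝓕 b y = conj (𝓕 k y) := fourier_conj_neg k
  have hsum : ∀ y, 𝓕 a y + conj (𝓕 b y) = 𝓕 h y := by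
    intro y
    rw [hbF, Complex.conj_conj]
    have : h = a + k := by rw [ha, hk, Set.indicator_self_add_compl]
    conv_rhs => rw [this]
    exact (congrFun (VectorFourier.fourierIntegral_add Real.continuous_fourierChar
      (L := innerₗ V) continuous_inner ha1 hk1) y).symm
  set q := a ⋆[ContinuousLinearMap.mul ℂ ℂ] b with hq
  have hq1 : Integrable q := ha1.integrable_convolution _ hb1
  have hqF : ∀ y, 𝓕 q y = 𝓕 a y * 𝓕 b y := Real.fourier_mul_convolution_eq ha1 hb1
  have hq0 : ∀ x, inner ℝ v x < 0 → q x = 0 := by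
    intro x hx
    refine integral_eq_zero_of_ae (Filter.Eventually.of_forall fun t => ?_)
    simp only [ContinuousLinearMap.mul_apply', Pi.zero_apply, ha, hb, hk]
    by_cases ht : t ∈ H
    · by_cases hs : -(x - t) ∈ H
      · have h0 : Hᶜ.indicator h (-(x - t)) = 0 := Set.indicator_of_notMem (not_not.2 hs) _
        rw [h0, map_zero, mul_zero]
      · have := hH.inner_le t ht _ hs
        rw [neg_sub, inner_sub_right] at this
        linarith
    · simp [Set.indicator, ht]
  -- The lemma produces the power `m' + 1`, hence the shift; it is harmless because `m ≠ 0`.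
  obtain ⟨r, hr1, hr0, hrF⟩ := exists_fourier_eq_pow hq1 hq0 (m - 1)
  rw [show m - 1 + 1 = m by omega] at hrF
  have hA := norm_fourier_le_integral a
  have hB := norm_fourier_le_integral k
  have hFa2 := memLp_two_fourier ha1 ha2
  have hFk2 := memLp_two_fourier hk1 hk2
  have hFb2 : MemLp (𝓕 b) 2 := by
    refine hFk2.of_le (continuous_fourier_of_integrable hb1).aestronglyMeasurable
      (Filter.Eventually.of_forall fun y => ?_)
    rw [hbF, Complex.norm_conj]
  have hIa := integrable_norm_pow_of_bounded hFa2 hA (n := 2 * m) (by omega)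
  have hIh := integrable_norm_pow_of_bounded (memLp_two_fourier h1 h2)
    (norm_fourier_le_integral h) (n := 2 * m) (by omega)
  -- One factor `𝓕 a * 𝓕 b` is a product of two `L²` functions, hence integrable; the remaining `m -
  -- 1` factors are bounded.
  have hIr : Integrable (𝓕 r) := by
    have h12 : Integrable fun y => 𝓕 a y * 𝓕 b y := hFa2.integrable_mul hFb2
    have h13 : Integrable fun y => (𝓕 a y * 𝓕 b y) ^ (m - 1) * (𝓕 a y * 𝓕 b y) := by
      refine h12.bdd_mul (c := ((∫ t, ‖a t‖) * ∫ t, ‖k t‖) ^ (m - 1))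
        (h12.1.pow _) (Filter.Eventually.of_forall fun y => ?_)
      rw [norm_pow, norm_mul]
      have hb' : ‖𝓕 b y‖ ≤ ∫ t, ‖k t‖ := by rw [hbF, Complex.norm_conj]; exact hB y
      have ha' := hA y
      gcongr
    refine h13.congr (Filter.Eventually.of_forall fun y => ?_)
    simp only
    rw [hrF, hqF, ← pow_succ, show m - 1 + 1 = m by omega]
  have hzero := integral_fourier_eq_zero hH.ne_zero hr1 hr0 hIr
  have hIr' : Integrable fun y => (-1 : ℂ) ^ m * 𝓕 r y := hIr.const_mul _
  have hpt : ∀ y, ‖𝓕 a y‖ ^ (2 * m) ≤ C * ‖𝓕 h y‖ ^ (2 * m) +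
      2 * ((-1 : ℂ) ^ m * 𝓕 r y).re := by
    intro y
    have := hC (𝓕 a y) (𝓕 b y)
    rw [hsum] at this
    rw [hrF, hqF, ← neg_pow]
    exact this
  calc ∫ y, ‖𝓕 a y‖ ^ (2 * m)
      ≤ ∫ y, (C * ‖𝓕 h y‖ ^ (2 * m) + 2 * ((-1 : ℂ) ^ m * 𝓕 r y).re) :=
        integral_mono hIa ((hIh.const_mul C).add (hIr'.re.const_mul 2)) hpt
    _ = C * ∫ y, ‖𝓕 h y‖ ^ (2 * m) := by
        have hre : ∫ y, ((-1 : ℂ) ^ m * 𝓕 r y).re = 0 := by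
          have := integral_re hIr'
          simp only [RCLike.re_to_complex] at this
          rw [this, integral_const_mul, hzero]
          simp
        have hre' : Integrable fun y => 2 * ((-1 : ℂ) ^ m * 𝓕 r y).re := hIr'.re.const_mul 2
        rw [integral_add (hIh.const_mul C) hre', integral_const_mul, integral_const_mul, hre,
          mul_zero, add_zero]

end FourierL2

/-! ### Marcinkiewicz interpolation. -/

section Interpolation

open Set

theorem setLIntegral_Ioo_rpow {a c : ℝ} (ha : 0 ≤ a) (hc : 0 < c) :
    ∫⁻ s in Ioo 0 a, ENNReal.ofReal (s ^ (c - 1)) = ENNReal.ofReal (a ^ c / c) := by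
  have hint : IntegrableOn (fun s : ℝ => s ^ (c - 1)) (Ioo 0 a) := by
    have := (intervalIntegral.intervalIntegrable_rpow' (a := 0) (b := a)
      (by linarith : -1 < c - 1)).1
    exact this.mono_set Ioo_subset_Ioc_self
  rw [← ofReal_integral_eq_lintegral_ofReal hint, ← integral_Ioc_eq_integral_Ioo,
    ← intervalIntegral.integral_of_le ha, integral_rpow (Or.inl (by linarith))]
  · simp [Real.zero_rpow hc.ne']
  · refine (ae_restrict_iff' measurableSet_Ioo).2 (Filter.Eventually.of_forall fun s hs => ?_)
    exact Real.rpow_nonneg hs.1.le _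

theorem setLIntegral_Ioi_rpow {a c : ℝ} (ha : 0 < a) (hc : 0 < c) :
    ∫⁻ s in Ioi a, ENNReal.ofReal (s ^ (-c - 1)) = ENNReal.ofReal (a ^ (-c) / c) := by
  have hint : IntegrableOn (fun s : ℝ => s ^ (-c - 1)) (Ioi a) :=
    integrableOn_Ioi_rpow_of_lt (by linarith) ha
  rw [← ofReal_integral_eq_lintegral_ofReal hint, integral_Ioi_rpow_of_lt (by linarith) ha]
  · congr 1
    rw [show -c - 1 + 1 = -c by ring, neg_div_neg_eq]
  · refine (ae_restrict_iff' measurableSet_Ioi).2 (Filter.Eventually.of_forall fun s hs => ?_)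
    exact Real.rpow_nonneg (ha.trans hs).le _

variable {α : Type*} [MeasurableSpace α] {μ : Measure α}

theorem ofReal_rpow_eq_enorm_rpow (z : ℂ) {p : ℝ} (hp : 0 ≤ p) :
    ENNReal.ofReal (‖z‖ ^ p) = ‖z‖ₑ ^ p := by
  rw [← ENNReal.ofReal_rpow_of_nonneg (norm_nonneg _) hp, ofReal_norm]

theorem meas_lt_norm_le {f : α → ℂ} (hf : AEStronglyMeasurable f μ) {s q : ℝ} (hs : 0 < s)
    (hq : 0 < q) : μ {x | s < ‖f x‖} ≤ ENNReal.ofReal (s ^ (-q)) * ∫⁻ x, ‖f x‖ₑ ^ q ∂μ := by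
  have h1 := mul_meas_ge_le_lintegral₀ (hf.enorm.pow_const q) (ENNReal.ofReal (s ^ q))
  have hpos : 0 < s ^ q := Real.rpow_pos_of_pos hs q
  calc μ {x | s < ‖f x‖} ≤ μ {x | ENNReal.ofReal (s ^ q) ≤ ‖f x‖ₑ ^ q} := by
        refine measure_mono fun x hx => ?_
        simp only [mem_ofPred_eq] at hx ⊢
        rw [← ofReal_rpow_eq_enorm_rpow _ hq.le]
        exact ENNReal.ofReal_le_ofReal (Real.rpow_le_rpow hs.le hx.le hq.le)
    _ = ENNReal.ofReal (s ^ (-q)) * (ENNReal.ofReal (s ^ q) *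
          μ {x | ENNReal.ofReal (s ^ q) ≤ ‖f x‖ₑ ^ q}) := by
        rw [← mul_assoc, ← ENNReal.ofReal_mul (by positivity), Real.rpow_neg hs.le,
          inv_mul_cancel₀ hpos.ne', ENNReal.ofReal_one, one_mul]
    _ ≤ _ := by gcongr

/-- The Marcinkiewicz interpolation theorem between `L²` and `L^r`, for an additive operator
on `L²`. -/
theorem lintegral_rpow_le_of_interpolation [SFinite μ] (T : Lp ℂ 2 μ → Lp ℂ 2 μ)
    (hT : ∀ f g, T (f + g) = T f + T g) {p r : ℝ} (hp : 2 < p) (hpr : p < r) {A B : ℝ≥0}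
    (hA : ∀ f, ∫⁻ x, ‖T f x‖ₑ ^ (2 : ℝ) ∂μ ≤ A * ∫⁻ x, ‖f x‖ₑ ^ (2 : ℝ) ∂μ)
    (hB : ∀ f, ∫⁻ x, ‖T f x‖ₑ ^ r ∂μ ≤ B * ∫⁻ x, ‖f x‖ₑ ^ r ∂μ) :
    ∃ C : ℝ≥0, ∀ f, ∫⁻ x, ‖T f x‖ₑ ^ p ∂μ ≤ C * ∫⁻ x, ‖f x‖ₑ ^ p ∂μ := by
  -- The factor `2 ^ p` comes from halving the threshold between the two pieces, `p` from the
  -- layer-cake formula, and `1 / (p - 2)` and `1 / (r - p)` from the integrals over the level `s`.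
  refine ⟨2 ^ p * p.toNNReal * (A * (1 / (p - 2)).toNNReal + B * (1 / (r - p)).toNNReal),
    fun f => ?_⟩
  have hp0 : 0 < p := by linarith
  have hfm : Measurable fun x => ‖f x‖ := (Lp.stronglyMeasurable f).norm.measurable
  set F : α → ℝ := fun x => ‖f x‖ with hF
  have hF0 : ∀ x, 0 ≤ F x := fun x => norm_nonneg _
  have hmlt : ∀ s, MeasurableSet {x | s < F x} := fun s => measurableSet_lt measurable_const hfm
  -- At level `s` the function is cut into `f 1_{|f| > s}`, estimated in `L²`, and `f 1_{|f| ≤ s}`,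
  -- estimated in `L^r`. `k₁` and `k₂` are the resulting integrands, already weighted by `s ^ (p -
  -- 1)` and by the Chebyshev factor.
  set k₁ : ℝ → α → ℝ≥0∞ := fun s x =>
    indicator {z : ℝ × α | z.1 < F z.2} (fun z => ENNReal.ofReal (z.1 ^ (p - 2 - 1) * F z.2 ^ (2 : ℝ)))
      (s, x) with hk₁
  set k₂ : ℝ → α → ℝ≥0∞ := fun s x =>
    indicator {z : ℝ × α | z.1 < F z.2}ᶜ
      (fun z => ENNReal.ofReal (z.1 ^ (-(r - p) - 1) * F z.2 ^ r)) (s, x) with hk₂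
  have hset : MeasurableSet {z : ℝ × α | z.1 < F z.2} :=
    measurableSet_lt measurable_fst (hfm.comp measurable_snd)
  have hm₁ : Measurable (Function.uncurry k₁) := by
    refine Measurable.indicator ?_ hset
    exact ((measurable_fst.pow_const _).mul ((hfm.comp measurable_snd).pow_const _)).ennreal_ofReal
  have hm₂ : Measurable (Function.uncurry k₂) := by
    refine Measurable.indicator ?_ hset.compl
    exact ((measurable_fst.pow_const _).mul ((hfm.comp measurable_snd).pow_const _)).ennreal_ofReal
  -- the distribution function of `T f`
  have hdist : ∀ s, 0 < s → μ {x | s < ‖T f x‖ / 2} * ENNReal.ofReal (s ^ (p - 1)) ≤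
      A * ∫⁻ x, k₁ s x ∂μ + B * ∫⁻ x, k₂ s x ∂μ := by
    intro s hs
    set S := {x | s < F x} with hS
    have hg : MemLp (S.indicator f) 2 μ := (Lp.memLp f).indicator (hmlt s)
    have hb : MemLp (Sᶜ.indicator f) 2 μ := (Lp.memLp f).indicator (hmlt s).compl
    have hsum : f = hg.toLp _ + hb.toLp _ := by
      rw [← MemLp.toLp_add hg hb]
      conv_lhs => rw [← Lp.toLp_coeFn f (Lp.memLp f)]
      refine (MemLp.toLp_eq_toLp_iff _ _).2 (Filter.Eventually.of_forall fun x => ?_)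
      rw [Set.indicator_self_add_compl]
    have hle : μ {x | s < ‖T f x‖ / 2} ≤ μ {x | s < ‖T (hg.toLp _) x‖} +
        μ {x | s < ‖T (hb.toLp _) x‖} := by
      refine le_trans (measure_mono_ae ?_) (measure_union_le _ _)
      have hTs : T f = T (hg.toLp _) + T (hb.toLp _) := by rw [← hT, ← hsum]
      have := Lp.coeFn_add (T (hg.toLp _)) (T (hb.toLp _))
      rw [← hTs] at this
      filter_upwards [this] with x hx
      intro (hx2 : s < ‖T f x‖ / 2)
      by_contra hcon
      have hcon' : ¬ (s < ‖T (hg.toLp _) x‖ ∨ s < ‖T (hb.toLp _) x‖) := hcon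
      push Not at hcon'
      rw [hx, Pi.add_apply] at hx2
      have := norm_add_le (T (hg.toLp _) x) (T (hb.toLp _) x)
      linarith [hcon'.1, hcon'.2]
    have h1 : μ {x | s < ‖T (hg.toLp _) x‖} * ENNReal.ofReal (s ^ (p - 1)) ≤
        A * ∫⁻ x, k₁ s x ∂μ := by
      calc _ ≤ (ENNReal.ofReal (s ^ (-(2 : ℝ))) * (A * ∫⁻ x, ‖hg.toLp _ x‖ₑ ^ (2 : ℝ) ∂μ)) *
            ENNReal.ofReal (s ^ (p - 1)) := by
            gcongr
            exact (meas_lt_norm_le (Lp.aestronglyMeasurable _) hs two_pos).trans (by gcongr; exact hA _)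
        _ = A * (ENNReal.ofReal (s ^ (p - 2 - 1)) * ∫⁻ x, ‖hg.toLp _ x‖ₑ ^ (2 : ℝ) ∂μ) := by
            have : s ^ (p - 2 - 1) = s ^ (-(2 : ℝ)) * s ^ (p - 1) := by
              rw [← Real.rpow_add hs]; ring_nf
            rw [this, ENNReal.ofReal_mul (by positivity)]
            ring
        _ = A * ∫⁻ x, k₁ s x ∂μ := by
            rw [← lintegral_const_mul' _ _ ENNReal.ofReal_ne_top]
            congr 1
            refine lintegral_congr_ae ?_
            filter_upwards [hg.coeFn_toLp] with x hx
            rw [hx]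
            by_cases hxs : s < F x
            · have e1 : S.indicator f x = f x := indicator_of_mem (show x ∈ S from hxs) _
              have e2 : k₁ s x = ENNReal.ofReal (s ^ (p - 2 - 1) * F x ^ (2 : ℝ)) :=
                indicator_of_mem (show (s, x) ∈ {z : ℝ × α | z.1 < F z.2} from hxs) _
              rw [e1, e2, ENNReal.ofReal_mul (by positivity), ofReal_rpow_eq_enorm_rpow _ two_pos.le]
            · have e1 : S.indicator f x = 0 := indicator_of_notMem (show x ∉ S from hxs) _
              have e2 : k₁ s x = 0 :=
                indicator_of_notMem (show (s, x) ∉ {z : ℝ × α | z.1 < F z.2} from hxs) _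
              rw [e1, e2]
              simp
    have h2 : μ {x | s < ‖T (hb.toLp _) x‖} * ENNReal.ofReal (s ^ (p - 1)) ≤
        B * ∫⁻ x, k₂ s x ∂μ := by
      have hr0 : 0 < r := by linarith
      calc _ ≤ (ENNReal.ofReal (s ^ (-r)) * (B * ∫⁻ x, ‖hb.toLp _ x‖ₑ ^ r ∂μ)) *
            ENNReal.ofReal (s ^ (p - 1)) := by
            gcongr
            exact (meas_lt_norm_le (Lp.aestronglyMeasurable _) hs hr0).trans (by gcongr; exact hB _)
        _ = B * (ENNReal.ofReal (s ^ (-(r - p) - 1)) * ∫⁻ x, ‖hb.toLp _ x‖ₑ ^ r ∂μ) := by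
            have : s ^ (-(r - p) - 1) = s ^ (-r) * s ^ (p - 1) := by
              rw [← Real.rpow_add hs]; ring_nf
            rw [this, ENNReal.ofReal_mul (by positivity)]
            ring
        _ = B * ∫⁻ x, k₂ s x ∂μ := by
            rw [← lintegral_const_mul' _ _ ENNReal.ofReal_ne_top]
            congr 1
            refine lintegral_congr_ae ?_
            filter_upwards [hb.coeFn_toLp] with x hx
            rw [hx]
            by_cases hxs : s < F x
            · have e1 : Sᶜ.indicator f x = 0 :=
                indicator_of_notMem (show x ∉ Sᶜ from not_not.2 hxs) _
              have e2 : k₂ s x = 0 :=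
                indicator_of_notMem (show (s, x) ∉ {z : ℝ × α | z.1 < F z.2}ᶜ from not_not.2 hxs) _
              rw [e1, e2]
              simp [hr0]
            · have e1 : Sᶜ.indicator f x = f x := indicator_of_mem (show x ∈ Sᶜ from hxs) _
              have e2 : k₂ s x = ENNReal.ofReal (s ^ (-(r - p) - 1) * F x ^ r) :=
                indicator_of_mem (show (s, x) ∈ {z : ℝ × α | z.1 < F z.2}ᶜ from hxs) _
              rw [e1, e2, ENNReal.ofReal_mul (by positivity), ofReal_rpow_eq_enorm_rpow _ hr0.le]
    calc _ ≤ (μ {x | s < ‖T (hg.toLp _) x‖} + μ {x | s < ‖T (hb.toLp _) x‖}) *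
          ENNReal.ofReal (s ^ (p - 1)) := by gcongr
      _ ≤ _ := by rw [add_mul]; exact add_le_add h1 h2
  have hi₁ : ∀ x, ∫⁻ s in Ioi 0, k₁ s x ≤ ENNReal.ofReal (1 / (p - 2)) * ‖f x‖ₑ ^ p := by
    intro x
    calc ∫⁻ s in Ioi 0, k₁ s x
        = ∫⁻ s in Ioi 0, (Iio (F x)).indicator
          (fun s => ENNReal.ofReal (s ^ (p - 2 - 1)) * ENNReal.ofReal (F x ^ (2 : ℝ))) s := by
          refine setLIntegral_congr_fun measurableSet_Ioi fun s (hs : 0 < s) => ?_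
          simp only [hk₁, indicator, mem_ofPred_eq, mem_Iio]
          rw [ENNReal.ofReal_mul (by positivity)]
      _ = (∫⁻ s in Ioo 0 (F x), ENNReal.ofReal (s ^ (p - 2 - 1))) *
          ENNReal.ofReal (F x ^ (2 : ℝ)) := by
          rw [setLIntegral_indicator measurableSet_Iio, inter_comm, Ioi_inter_Iio,
            lintegral_mul_const' _ _ ENNReal.ofReal_ne_top]
      _ = ENNReal.ofReal (1 / (p - 2)) * ‖f x‖ₑ ^ p := by
          rw [setLIntegral_Ioo_rpow (hF0 x) (by linarith : 0 < p - 2), ← ENNReal.ofReal_mul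
            (div_nonneg (Real.rpow_nonneg (hF0 x) _) (by linarith)), ← ofReal_rpow_eq_enorm_rpow _ hp0.le,
            ← ENNReal.ofReal_mul (div_nonneg zero_le_one (by linarith))]
          congr 1
          have : ‖f x‖ ^ p = F x ^ (p - 2) * F x ^ (2 : ℝ) := by
            rw [← Real.rpow_add' (hF0 x) (by simp; linarith)]; simp [hF]
          rw [this]
          ring
      _ ≤ _ := le_rfl
  have hi₂ : ∀ x, ∫⁻ s in Ioi 0, k₂ s x ≤ ENNReal.ofReal (1 / (r - p)) * ‖f x‖ₑ ^ p := by
    intro x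
    have hr0 : 0 < r := by linarith
    rcases (hF0 x).eq_or_lt with h0 | h0
    · have : ∀ s, k₂ s x = 0 := by
        intro s
        simp only [hk₂, indicator, ← h0, Real.zero_rpow hr0.ne', mul_zero, ENNReal.ofReal_zero, ite_self]
      simp [this]
    calc ∫⁻ s in Ioi 0, k₂ s x
        = ∫⁻ s in Ioi 0, (Ici (F x)).indicator
          (fun s => ENNReal.ofReal (s ^ (-(r - p) - 1)) * ENNReal.ofReal (F x ^ r)) s := by
          refine setLIntegral_congr_fun measurableSet_Ioi fun s (hs : 0 < s) => ?_
          simp only [hk₂, indicator, mem_ofPred_eq, mem_Ici, mem_compl_iff, not_lt]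
          rw [ENNReal.ofReal_mul (by positivity)]
      _ = (∫⁻ s in Ioi (F x), ENNReal.ofReal (s ^ (-(r - p) - 1))) *
          ENNReal.ofReal (F x ^ r) := by
          rw [setLIntegral_indicator measurableSet_Ici,
            inter_eq_left.2 (Ici_subset_Ioi.2 h0),
            lintegral_mul_const' _ _ ENNReal.ofReal_ne_top, setLIntegral_congr Ioi_ae_eq_Ici]
      _ = ENNReal.ofReal (1 / (r - p)) * ‖f x‖ₑ ^ p := by
          rw [setLIntegral_Ioi_rpow h0 (by linarith : 0 < r - p), ← ENNReal.ofReal_mul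
            (div_nonneg (Real.rpow_nonneg (hF0 x) _) (by linarith)), ← ofReal_rpow_eq_enorm_rpow _ hp0.le,
            ← ENNReal.ofReal_mul (div_nonneg zero_le_one (by linarith))]
          congr 1
          have : ‖f x‖ ^ p = F x ^ (-(r - p)) * F x ^ r := by
            rw [← Real.rpow_add h0]; simp [hF]
          rw [this]
          ring
      _ ≤ _ := le_rfl
  have hlayer := lintegral_rpow_eq_lintegral_meas_lt_mul μ (f := fun x => ‖T f x‖ / 2)
    (Filter.Eventually.of_forall fun x => by positivity)
    ((Lp.stronglyMeasurable (T f)).norm.measurable.div_const 2).aemeasurable hp0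
  have hL : ∫⁻ x, ‖T f x‖ₑ ^ p ∂μ = 2 ^ p * ∫⁻ x, ENNReal.ofReal ((‖T f x‖ / 2) ^ p) ∂μ := by
    rw [← lintegral_const_mul' _ _ (by simp)]
    refine lintegral_congr fun x => ?_
    rw [Real.div_rpow (norm_nonneg _) two_pos.le, ENNReal.ofReal_div_of_pos (by positivity),
      ofReal_rpow_eq_enorm_rpow _ hp0.le, ← ENNReal.ofReal_rpow_of_pos two_pos, ENNReal.ofReal_ofNat,
      ENNReal.mul_div_cancel (by simp) (by simp)]
  have hswap : ∀ k : ℝ → α → ℝ≥0∞, Measurable (Function.uncurry k) →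
      ∫⁻ s in Ioi (0 : ℝ), ∫⁻ x, k s x ∂μ = ∫⁻ x, (∫⁻ s in Ioi (0 : ℝ), k s x) ∂μ := fun k hk =>
    lintegral_lintegral_swap hk.aemeasurable
  have hmain : ∫⁻ s in Ioi 0, μ {x | s < ‖T f x‖ / 2} * ENNReal.ofReal (s ^ (p - 1)) ≤
      (A * ENNReal.ofReal (1 / (p - 2)) + B * ENNReal.ofReal (1 / (r - p))) *
        ∫⁻ x, ‖f x‖ₑ ^ p ∂μ := by
    have hmk₁ : Measurable fun s => ∫⁻ x, k₁ s x ∂μ := hm₁.lintegral_prod_right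
    calc _ ≤ ∫⁻ s in Ioi 0, (A * ∫⁻ x, k₁ s x ∂μ + B * ∫⁻ x, k₂ s x ∂μ) :=
          setLIntegral_mono' measurableSet_Ioi hdist
      _ = A * ∫⁻ x, (∫⁻ s in Ioi (0 : ℝ), k₁ s x) ∂μ +
          B * ∫⁻ x, (∫⁻ s in Ioi (0 : ℝ), k₂ s x) ∂μ := by
          rw [lintegral_add_left (hmk₁.const_mul _), lintegral_const_mul' _ _ ENNReal.coe_ne_top,
            lintegral_const_mul' _ _ ENNReal.coe_ne_top, hswap k₁ hm₁, hswap k₂ hm₂]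
      _ ≤ A * ∫⁻ x, ENNReal.ofReal (1 / (p - 2)) * ‖f x‖ₑ ^ p ∂μ +
          B * ∫⁻ x, ENNReal.ofReal (1 / (r - p)) * ‖f x‖ₑ ^ p ∂μ := by
          gcongr with x x
          · exact hi₁ x
          · exact hi₂ x
      _ = _ := by
          rw [lintegral_const_mul' _ _ ENNReal.ofReal_ne_top,
            lintegral_const_mul' _ _ ENNReal.ofReal_ne_top]
          ring
  rw [hL, hlayer]
  calc _ ≤ 2 ^ p * (ENNReal.ofReal p * ((A * ENNReal.ofReal (1 / (p - 2)) +
        B * ENNReal.ofReal (1 / (r - p))) * ∫⁻ x, ‖f x‖ₑ ^ p ∂μ)) := by gcongr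
    _ = _ := by
      push_cast
      rw [ENNReal.coe_rpow_of_nonneg _ hp0.le]
      simp only [ENNReal.ofReal, ENNReal.coe_ofNat]
      ring

end Interpolation

/-! ### Young's inequality. -/

section Young

variable {G : Type*} [AddCommGroup G] [MeasurableSpace G] [MeasurableAdd₂ G] [MeasurableNeg G]
  {μ : Measure G} [SFinite μ] [μ.IsAddLeftInvariant] [μ.IsNegInvariant]

/-- Young's inequality for the convolution of a function in `L^p` with a function in `L¹`. -/
theorem lintegral_conv_rpow_le {f κ : G → ℝ≥0∞} (hf : Measurable f) (hκ : Measurable κ)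
    {p : ℝ} (hp : 1 < p) :
    ∫⁻ y, (∫⁻ z, f z * κ (y - z) ∂μ) ^ p ∂μ ≤ (∫⁻ z, κ z ∂μ) ^ p * ∫⁻ z, f z ^ p ∂μ := by
  obtain ⟨q, hpq⟩ : ∃ q, p.HolderConjugate q := ⟨_, Real.HolderConjugate.conjExponent hp⟩
  have hp0 : 0 < p := by linarith
  have hq0 : 0 < q := hpq.symm.pos
  set K := ∫⁻ z, κ z ∂μ with hK
  have hKy : ∀ y, ∫⁻ z, κ (y - z) ∂μ = K := fun y => lintegral_sub_left_eq_self κ y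
  have hm : Measurable fun w : G × G => κ (w.1 - w.2) := hκ.comp measurable_sub
  have hpt : ∀ y, (∫⁻ z, f z * κ (y - z) ∂μ) ^ p ≤
      (∫⁻ z, f z ^ p * κ (y - z) ∂μ) * K ^ (p - 1) := by
    intro y
    have hκy : Measurable fun z => κ (y - z) := hκ.comp (measurable_id.const_sub y)
    -- Hölder after the splitting `f κ = (f κ^(1/p)) κ^(1/q)`, which keeps the mass of `κ` in both
    -- factors.
    have h1 := ENNReal.lintegral_mul_le_Lp_mul_Lq μ hpq
      (f := fun z => f z * κ (y - z) ^ (1 / p)) (g := fun z => κ (y - z) ^ (1 / q))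
      ((hf.mul (hκy.pow_const _)).aemeasurable) (hκy.pow_const _).aemeasurable
    have e1 : ∀ z, ((fun z => f z * κ (y - z) ^ (1 / p)) * fun z => κ (y - z) ^ (1 / q)) z =
        f z * κ (y - z) := by
      intro z
      simp only [Pi.mul_apply]
      rw [mul_assoc, ← ENNReal.rpow_add_of_nonneg _ _ (by positivity) (by positivity)]
      have : 1 / p + 1 / q = 1 := by simpa using hpq.inv_add_inv_eq_one
      rw [this, ENNReal.rpow_one]
    have e2 : ∀ z, (f z * κ (y - z) ^ (1 / p)) ^ p = f z ^ p * κ (y - z) := by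
      intro z
      rw [ENNReal.mul_rpow_of_nonneg _ _ hp0.le, ← ENNReal.rpow_mul, one_div_mul_cancel hp0.ne',
        ENNReal.rpow_one]
    have e3 : ∀ z, (κ (y - z) ^ (1 / q)) ^ q = κ (y - z) := by
      intro z
      rw [← ENNReal.rpow_mul, one_div_mul_cancel hq0.ne', ENNReal.rpow_one]
    simp only [e1, e2, e3, hKy] at h1
    calc _ ≤ ((∫⁻ z, f z ^ p * κ (y - z) ∂μ) ^ (1 / p) * K ^ (1 / q)) ^ p := by gcongr
      _ = _ := by
        rw [ENNReal.mul_rpow_of_nonneg _ _ hp0.le, ← ENNReal.rpow_mul, one_div_mul_cancel hp0.ne',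
          ENNReal.rpow_one, ← ENNReal.rpow_mul]
        congr 2
        rw [one_div_mul_eq_div, hpq.div_conj_eq_sub_one]
  have hm2 : Measurable fun w : G × G => f w.2 ^ p * κ (w.1 - w.2) :=
    ((hf.comp measurable_snd).pow_const _).mul hm
  calc _ ≤ ∫⁻ y, (∫⁻ z, f z ^ p * κ (y - z) ∂μ) * K ^ (p - 1) ∂μ := lintegral_mono hpt
    _ = (∫⁻ y, ∫⁻ z, f z ^ p * κ (y - z) ∂μ ∂μ) * K ^ (p - 1) :=
      lintegral_mul_const _ hm2.lintegral_prod_right'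
    _ = (∫⁻ z, f z ^ p * K ∂μ) * K ^ (p - 1) := by
      rw [lintegral_lintegral_swap hm2.aemeasurable]
      congr 1
      refine lintegral_congr fun z => ?_
      have hz : Measurable fun x => κ (x - z) := hκ.comp (measurable_id.sub_const z)
      rw [lintegral_const_mul _ hz, lintegral_sub_right_eq_self κ z]
    _ = _ := by
      rw [lintegral_mul_const _ (hf.pow_const _)]
      have : K ^ p = K * K ^ (p - 1) := by
        conv_rhs => rw [← ENNReal.rpow_one K, ← ENNReal.rpow_mul, one_mul]
        rw [← ENNReal.rpow_add_of_nonneg _ _ zero_le_one (by linarith)]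
        congr 1; ring
      rw [this]
      ring

end Young

/-! ### From an exponent to its conjugate. -/

section Duality

variable {α : Type*} [MeasurableSpace α] {μ : Measure α}

/-- With `u = T f`, the test function `g = |u|^(p-2) u`, cut to a set of finite measure, satisfies
`|g|^q = |u|^p`. Moving `T` onto `g` and using Hölder gives `X ≤ (B X)^(1/q) J^(1/p)` for the
truncated integral `X`; being finite, `X ^ (1 / q)` can be cancelled. -/
theorem lintegral_rpow_le_of_selfAdjoint (T : Lp ℂ 2 μ → Lp ℂ 2 μ)
    (hT : ∀ f g, inner ℂ (T f) g = inner ℂ f (T g)) {p q : ℝ} (hpq : p.HolderConjugate q) {B : ℝ≥0}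
    (hB : ∀ f, ∫⁻ x, ‖T f x‖ₑ ^ q ∂μ ≤ B * ∫⁻ x, ‖f x‖ₑ ^ q ∂μ) (f : Lp ℂ 2 μ) :
    ∫⁻ x, ‖T f x‖ₑ ^ p ∂μ ≤ (B ^ (p / q) : ℝ≥0) * ∫⁻ x, ‖f x‖ₑ ^ p ∂μ := by
  have hp0 : 0 < p := hpq.pos
  have hq0 : 0 < q := hpq.symm.pos
  set u : α → ℂ := fun x => T f x with hu
  have hum : Measurable u := (Lp.stronglyMeasurable (T f)).measurable
  -- The lower bound on `‖u‖` gives finite measure since `u` is in `L²`, and keeps `‖u‖ ^ (p - 2)`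
  -- under control for `p < 2`. The sets exhaust `{u ≠ 0}`.
  set E : ℕ → Set α := fun n => {x | 1 / ((n : ℝ) + 1) < ‖u x‖ ∧ ‖u x‖ ≤ n} with hE
  have hEm : ∀ n, MeasurableSet (E n) := fun n =>
    (measurableSet_lt measurable_const hum.norm).inter (measurableSet_le hum.norm measurable_const)
  have hEfin : ∀ n, μ (E n) < ∞ := by
    intro n
    refine lt_of_le_of_lt (measure_mono fun x hx => hx.1)
      (lt_of_le_of_lt (meas_lt_norm_le (Lp.aestronglyMeasurable (T f)) (q := 2)
        (by positivity : (0 : ℝ) < 1 / ((n : ℝ) + 1)) two_pos) ?_)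
    refine ENNReal.mul_lt_top ENNReal.ofReal_lt_top ?_
    have := lintegral_rpow_enorm_lt_top_of_eLpNorm_lt_top (p := 2) (by norm_num) (by norm_num)
      (Lp.memLp (T f)).2
    simpa using this
  have key : ∀ n, ∫⁻ x in E n, ‖u x‖ₑ ^ p ∂μ ≤ (B ^ (p / q) : ℝ≥0) * ∫⁻ x, ‖f x‖ₑ ^ p ∂μ := by
    intro n
    set g : α → ℂ := (E n).indicator fun x => ((‖u x‖ ^ (p - 2) : ℝ) : ℂ) * u x with hg
    have hgm : Measurable g := by
      refine Measurable.indicator ?_ (hEm n)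
      exact (Complex.measurable_ofReal.comp (hum.norm.pow_const _)).mul hum
    have hnorm : ∀ x ∈ E n, ‖g x‖ = ‖u x‖ ^ (p - 1) := by
      intro x hx
      have hx0 : 0 < ‖u x‖ := lt_trans (by positivity) hx.1
      rw [hg, Set.indicator_of_mem hx, norm_mul, Complex.norm_real, Real.norm_of_nonneg (by positivity)]
      conv_lhs => rw [← Real.rpow_one ‖u x‖, ← Real.rpow_mul hx0.le, one_mul]
      rw [← Real.rpow_add hx0]
      congr 1; ring
    have hgL : MemLp g 2 μ := by
      have : g = (E n).indicator g := by rw [hg, Set.indicator_indicator, Set.inter_self]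
      rw [this, memLp_indicator_iff_restrict (hEm n)]
      have : IsFiniteMeasure (μ.restrict (E n)) := ⟨by simpa using hEfin n⟩
      refine MemLp.of_bound hgm.aestronglyMeasurable ((n : ℝ) ^ (p - 1))
        ((ae_restrict_iff' (hEm n)).2 (Filter.Eventually.of_forall fun x hx => ?_))
      rw [hnorm x hx]
      exact Real.rpow_le_rpow (norm_nonneg _) hx.2 (by linarith [hpq.lt])
    have hgq : ∫⁻ x, ‖hgL.toLp g x‖ₑ ^ q ∂μ = ∫⁻ x in E n, ‖u x‖ₑ ^ p ∂μ := by
      rw [← lintegral_indicator (hEm n)]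
      refine lintegral_congr_ae ?_
      filter_upwards [hgL.coeFn_toLp] with x hx
      rw [hx]
      by_cases hxE : x ∈ E n
      · rw [Set.indicator_of_mem hxE, ← ofReal_rpow_eq_enorm_rpow _ hq0.le, hnorm x hxE,
          ← Real.rpow_mul (norm_nonneg _), hpq.sub_one_mul_conj, ofReal_rpow_eq_enorm_rpow _ hp0.le]
      · rw [Set.indicator_of_notMem hxE, hg, Set.indicator_of_notMem hxE]
        simp [hq0]
    have hae : (fun x => inner ℂ (hgL.toLp g x) (u x)) =ᵐ[μ]
        fun x => (((E n).indicator (fun x => ‖u x‖ ^ p) x : ℝ) : ℂ) := by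
      filter_upwards [hgL.coeFn_toLp] with x hx
      rw [hx]
      by_cases hxE : x ∈ E n
      · have hx0 : 0 < ‖u x‖ := lt_trans (by positivity) hxE.1
        rw [Set.indicator_of_mem hxE, hg, Set.indicator_of_mem hxE, RCLike.inner_apply, map_mul,
          Complex.conj_ofReal, mul_left_comm, Complex.mul_conj', ← Complex.ofReal_pow,
          ← Complex.ofReal_mul]
        congr 1
        rw [← Real.rpow_natCast, ← Real.rpow_add hx0]
        congr 1; push_cast; ring
      · rw [Set.indicator_of_notMem hxE, hg, Set.indicator_of_notMem hxE]
        simp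
    have hint : Integrable ((E n).indicator fun x => ‖u x‖ ^ p) μ := by
      have h1 := (L2.integrable_inner (𝕜 := ℂ) (hgL.toLp g) (T f)).congr hae
      have h2 := h1.re
      simpa using h2
    have hX : ∫⁻ x in E n, ‖u x‖ₑ ^ p ∂μ = ‖inner ℂ (hgL.toLp g) (T f)‖ₑ := by
      rw [L2.inner_def, integral_congr_ae hae, integral_complex_ofReal, ← ofReal_norm,
        Complex.norm_real, Real.norm_of_nonneg, ofReal_integral_eq_lintegral_ofReal hint,
        ← lintegral_indicator (hEm n)]
      · refine lintegral_congr fun x => ?_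
        by_cases hxE : x ∈ E n
        · rw [Set.indicator_of_mem hxE, Set.indicator_of_mem hxE, ofReal_rpow_eq_enorm_rpow _ hp0.le]
        · rw [Set.indicator_of_notMem hxE, Set.indicator_of_notMem hxE, ENNReal.ofReal_zero]
      · exact Filter.Eventually.of_forall fun x =>
          Set.indicator_nonneg (fun x _ => Real.rpow_nonneg (norm_nonneg _) _) x
      · exact integral_nonneg fun x =>
          Set.indicator_nonneg (fun x _ => Real.rpow_nonneg (norm_nonneg _) _) x
    set X := ∫⁻ x in E n, ‖u x‖ₑ ^ p ∂μ with hXdef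
    have hXtop : X ≠ ∞ := by rw [hX]; exact enorm_ne_top
    set J := ∫⁻ x, ‖f x‖ₑ ^ p ∂μ with hJ
    have hle : X ≤ (B * X) ^ (1 / q) * J ^ (1 / p) := by
      calc X = ‖inner ℂ (T (hgL.toLp g)) f‖ₑ := by rw [hX, hT]
        _ ≤ ∫⁻ x, ‖inner ℂ (T (hgL.toLp g) x) (f x)‖ₑ ∂μ := by
          rw [L2.inner_def]; exact enorm_integral_le_lintegral_enorm _
        _ = ∫⁻ x, ((fun x => ‖T (hgL.toLp g) x‖ₑ) * fun x => ‖f x‖ₑ) x ∂μ := by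
          refine lintegral_congr fun x => ?_
          rw [RCLike.inner_apply, Pi.mul_apply, enorm_mul, mul_comm, RCLike.enorm_conj]
        _ ≤ (∫⁻ x, ‖T (hgL.toLp g) x‖ₑ ^ q ∂μ) ^ (1 / q) * J ^ (1 / p) :=
          ENNReal.lintegral_mul_le_Lp_mul_Lq μ hpq.symm
            (Lp.aestronglyMeasurable _).enorm (Lp.aestronglyMeasurable _).enorm
        _ ≤ (B * X) ^ (1 / q) * J ^ (1 / p) := by
          gcongr
          rw [← hgq]; exact hB _
    rcases eq_or_ne X 0 with h0 | h0
    · rw [h0]; exact zero_le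
    have h1 : X ^ (1 / p) ≤ (B : ℝ≥0∞) ^ (1 / q) * J ^ (1 / p) := by
      have hXq0 : X ^ (1 / q) ≠ 0 := by simp [h0, hXtop]
      have hXqt : X ^ (1 / q) ≠ ∞ := by simp [h0, hXtop]
      have hsplit : X = X ^ (1 / q) * X ^ (1 / p) := by
        rw [← ENNReal.rpow_add _ _ h0 hXtop]
        have : 1 / q + 1 / p = 1 := by simpa using hpq.symm.inv_add_inv_eq_one
        rw [this, ENNReal.rpow_one]
      rw [ENNReal.mul_rpow_of_nonneg _ _ (by positivity)] at hle
      refine (ENNReal.mul_le_mul_iff_right hXq0 hXqt).1 ?_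
      calc X ^ (1 / q) * X ^ (1 / p) = X := hsplit.symm
        _ ≤ _ := hle
        _ = _ := by ring
    calc X = (X ^ (1 / p)) ^ p := by
          rw [← ENNReal.rpow_mul, one_div_mul_cancel hp0.ne', ENNReal.rpow_one]
      _ ≤ ((B : ℝ≥0∞) ^ (1 / q) * J ^ (1 / p)) ^ p := by gcongr
      _ = _ := by
          rw [ENNReal.mul_rpow_of_nonneg _ _ hp0.le, ← ENNReal.rpow_mul, ← ENNReal.rpow_mul,
            one_div_mul_cancel hp0.ne', ENNReal.rpow_one, one_div_mul_eq_div,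
            ENNReal.coe_rpow_of_nonneg _ (by positivity)]
  have hmono : Monotone E := by
    intro a b hab x hx
    have hab' : (a : ℝ) ≤ b := by exact_mod_cast hab
    exact ⟨lt_of_le_of_lt (one_div_le_one_div_of_le (by positivity) (by linarith)) hx.1,
      hx.2.trans hab'⟩
  have hsup : ∫⁻ x, ‖u x‖ₑ ^ p ∂μ = ⨆ n, ∫⁻ x in E n, ‖u x‖ₑ ^ p ∂μ := by
    rw [← setLIntegral_iUnion_of_directed _ hmono.directed_le, ← lintegral_indicator
      (MeasurableSet.iUnion hEm)]
    refine lintegral_congr fun x => ?_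
    by_cases hx : x ∈ ⋃ n, E n
    · rw [Set.indicator_of_mem hx]
    · rw [Set.indicator_of_notMem hx]
      have : u x = 0 := by
        by_contra hne
        have hpos : 0 < ‖u x‖ := norm_pos_iff.2 hne
        obtain ⟨a, ha⟩ := exists_nat_one_div_lt hpos
        obtain ⟨b, hb⟩ := exists_nat_ge ‖u x‖
        refine hx (Set.mem_iUnion.2 ⟨max a b, ?_, hb.trans (by exact_mod_cast le_max_right a b)⟩)
        refine lt_of_le_of_lt (one_div_le_one_div_of_le (by positivity) ?_) ha
        have : (a : ℝ) ≤ (max a b : ℕ) := by exact_mod_cast le_max_left a b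
        linarith
      rw [this]
      simp [hp0]
  rw [hsup]
  exact iSup_le key

end Duality

/-! ### Dilated cutoffs. -/

section Dilation

variable {d : ℕ}

/-- The Schwartz function `t ↦ χ (t / (n + 1))`. -/
noncomputable def dilate (χ : 𝓢(Eucl d, ℂ)) (n : ℕ) : 𝓢(Eucl d, ℂ) :=
  compCLMOfContinuousLinearEquiv ℂ (ContinuousLinearEquiv.smulLeft
    (Units.mk0 (((n : ℝ) + 1)⁻¹) (by positivity))) χ

theorem dilate_apply (χ : 𝓢(Eucl d, ℂ)) (n : ℕ) (t : Eucl d) :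
    dilate χ n t = χ (((n : ℝ) + 1)⁻¹ • t) := rfl

theorem tendsto_dilate (χ : 𝓢(Eucl d, ℂ)) (t : Eucl d) :
    Filter.Tendsto (fun n => dilate χ n t) Filter.atTop (nhds (χ 0)) := by
  have h1 : Filter.Tendsto (fun n : ℕ => ((n : ℝ) + 1)⁻¹ • t) Filter.atTop (nhds ((0 : ℝ) • t)) := by
    refine Filter.Tendsto.smul_const ?_ t
    simpa using tendsto_one_div_add_atTop_nhds_zero_nat (𝕜 := ℝ)
  rw [zero_smul] at h1
  exact (χ.continuous.tendsto 0).comp h1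

theorem norm_dilate_le (χ : 𝓢(Eucl d, ℂ)) (n : ℕ) (t : Eucl d) :
    ‖dilate χ n t‖ ≤ SchwartzMap.seminorm ℝ 0 0 χ := by
  rw [dilate_apply]; exact χ.norm_le_seminorm ℝ _

theorem fourier_dilate_apply (χ : 𝓢(Eucl d, ℂ)) (n : ℕ) (ξ : Eucl d) :
    𝓕 (dilate χ n) ξ = (((n : ℝ) + 1) ^ d : ℝ) • 𝓕 χ (((n : ℝ) + 1) • ξ) := by
  rw [SchwartzMap.fourier_coe, SchwartzMap.fourier_coe, Real.fourier_eq', Real.fourier_eq']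
  have hn : ((n : ℝ) + 1) ≠ 0 := by positivity
  have := Measure.integral_comp_smul (volume : Measure (Eucl d)) (fun s : Eucl d =>
    Complex.exp ((↑(-2 * Real.pi * inner ℝ s (((n : ℝ) + 1) • ξ)) * Complex.I)) • χ s)
    (((n : ℝ) + 1)⁻¹)
  simp only [finrank_euclideanSpace, Fintype.card_fin] at this
  rw [inv_pow, inv_inv, abs_of_nonneg (by positivity)] at this
  rw [← this]
  refine integral_congr_ae (Filter.Eventually.of_forall fun t => ?_)
  simp only [dilate_apply]
  rw [inner_smul_left, inner_smul_right]
  congr 4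
  simp only [conj_trivial]
  field_simp

/-- The transform of the dilate is an `L¹`-normalised rescaling of `𝓕 χ`. This makes Young's
inequality uniform in `n` when the cutoffs are removed. -/
theorem lintegral_fourier_dilate (χ : 𝓢(Eucl d, ℂ)) (n : ℕ) :
    ∫⁻ ξ, ‖𝓕 (dilate χ n) ξ‖ₑ = ∫⁻ ξ, ‖𝓕 χ ξ‖ₑ := by
  rw [← ofReal_integral_norm_eq_lintegral_enorm (𝓕 (dilate χ n)).integrable,
    ← ofReal_integral_norm_eq_lintegral_enorm (𝓕 χ).integrable]
  congr 1
  have hn : ((n : ℝ) + 1) ≠ 0 := by positivity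
  have := Measure.integral_comp_smul (volume : Measure (Eucl d)) (fun s => ‖𝓕 χ s‖) ((n : ℝ) + 1)
  simp only [finrank_euclideanSpace, Fintype.card_fin] at this
  rw [abs_of_nonneg (by positivity)] at this
  calc ∫ ξ, ‖𝓕 (dilate χ n) ξ‖ = ∫ ξ, ((n : ℝ) + 1) ^ d * ‖𝓕 χ (((n : ℝ) + 1) • ξ)‖ := by
        refine integral_congr_ae (Filter.Eventually.of_forall fun t => ?_)
        simp only [fourier_dilate_apply, norm_smul]
        rw [Real.norm_of_nonneg (by positivity)]
    _ = _ := by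
        rw [integral_const_mul, this, smul_eq_mul, ← mul_assoc, mul_inv_cancel₀ (by positivity),
          one_mul]

end Dilation

/-! ### Half-space multipliers on `L^p`. -/

section HalfSpaceMultiplier

variable {d : ℕ}

/-- Multiplication by the indicator function of a measurable set, as an operator on `L²`. -/
noncomputable def indicatorL2 {H : Set (Eucl d)} (hH : MeasurableSet H)
    (f : Lp ℂ 2 (volume : Measure (Eucl d))) : Lp ℂ 2 (volume : Measure (Eucl d)) :=
  ((Lp.memLp f).indicator hH).toLp (H.indicator f)

theorem indicatorL2_ae_eq {H : Set (Eucl d)} (hH : MeasurableSet H)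
    (f : Lp ℂ 2 (volume : Measure (Eucl d))) : indicatorL2 hH f =ᵐ[volume] H.indicator f :=
  MemLp.coeFn_toLp _

theorem indicatorL2_add {H : Set (Eucl d)} (hH : MeasurableSet H)
    (f g : Lp ℂ 2 (volume : Measure (Eucl d))) :
    indicatorL2 hH (f + g) = indicatorL2 hH f + indicatorL2 hH g := by
  refine Lp.ext ?_
  filter_upwards [indicatorL2_ae_eq hH (f + g), indicatorL2_ae_eq hH f, indicatorL2_ae_eq hH g,
    Lp.coeFn_add f g, Lp.coeFn_add (indicatorL2 hH f) (indicatorL2 hH g)] with x h1 h2 h3 h4 h5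
  rw [h1, h5, Pi.add_apply, h2, h3]
  by_cases hx : x ∈ H
  · simp only [Set.indicator_of_mem hx]
    exact h4
  · simp [hx]

theorem inner_indicatorL2 {H : Set (Eucl d)} (hH : MeasurableSet H)
    (f g : Lp ℂ 2 (volume : Measure (Eucl d))) :
    inner ℂ (indicatorL2 hH f) g = inner ℂ f (indicatorL2 hH g) := by
  rw [L2.inner_def, L2.inner_def]
  refine integral_congr_ae ?_
  filter_upwards [indicatorL2_ae_eq hH f, indicatorL2_ae_eq hH g] with x h1 h2
  rw [h1, h2]
  by_cases hx : x ∈ H <;> simp [hx]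

theorem norm_indicatorL2_le {H : Set (Eucl d)} (hH : MeasurableSet H)
    (f : Lp ℂ 2 (volume : Measure (Eucl d))) : ‖indicatorL2 hH f‖ ≤ ‖f‖ := by
  refine Lp.norm_le_norm_of_ae_le ?_
  filter_upwards [indicatorL2_ae_eq hH f] with x h1
  rw [h1]
  exact norm_indicator_le_norm_self _ _

/-- The Fourier multiplier with symbol the indicator function of `H`, as an operator on `L²`. -/
noncomputable def fourierTruncation {H : Set (Eucl d)} (hH : MeasurableSet H)
    (f : Lp ℂ 2 (volume : Measure (Eucl d))) : Lp ℂ 2 (volume : Measure (Eucl d)) :=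
  𝓕 (indicatorL2 hH (𝓕⁻ f))

theorem fourierTruncation_add {H : Set (Eucl d)} (hH : MeasurableSet H)
    (f g : Lp ℂ 2 (volume : Measure (Eucl d))) :
    fourierTruncation hH (f + g) = fourierTruncation hH f + fourierTruncation hH g := by
  rw [fourierTruncation, FourierTransform.fourierInv_add, indicatorL2_add,
    FourierTransform.fourier_add]
  rfl

theorem fourierTruncation_sub {H : Set (Eucl d)} (hH : MeasurableSet H)
    (f g : Lp ℂ 2 (volume : Measure (Eucl d))) :
    fourierTruncation hH (f - g) = fourierTruncation hH f - fourierTruncation hH g := by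
  rw [eq_sub_iff_add_eq, ← fourierTruncation_add, sub_add_cancel]

theorem norm_fourierInv_L2 (f : Lp ℂ 2 (volume : Measure (Eucl d))) : ‖𝓕⁻ f‖ = ‖f‖ := by
  rw [← Lp.norm_fourier_eq (𝓕⁻ f), FourierTransform.fourier_fourierInv_eq]

theorem norm_fourierTruncation_le {H : Set (Eucl d)} (hH : MeasurableSet H)
    (f : Lp ℂ 2 (volume : Measure (Eucl d))) : ‖fourierTruncation hH f‖ ≤ ‖f‖ := by
  rw [fourierTruncation, Lp.norm_fourier_eq]
  exact (norm_indicatorL2_le hH _).trans (norm_fourierInv_L2 f).le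

theorem inner_fourierTruncation {H : Set (Eucl d)} (hH : MeasurableSet H)
    (f g : Lp ℂ 2 (volume : Measure (Eucl d))) :
    inner ℂ (fourierTruncation hH f) g = inner ℂ f (fourierTruncation hH g) := by
  conv_lhs => rw [← FourierTransform.fourier_fourierInv_eq (F := Lp ℂ 2 (volume : Measure (Eucl d))) g]
  conv_rhs => rw [← FourierTransform.fourier_fourierInv_eq (F := Lp ℂ 2 (volume : Measure (Eucl d))) f]
  rw [fourierTruncation, fourierTruncation, Lp.inner_fourier_eq, Lp.inner_fourier_eq,
    inner_indicatorL2]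

/-- Translates between the abstract operator on `L²`, suited to interpolation and duality, and the
Fourier integral of a truncated function. -/
theorem fourierTruncation_fourier {H : Set (Eucl d)} (hH : MeasurableSet H) {h : Eucl d → ℂ}
    (h1 : Integrable h) (h2 : MemLp h 2) :
    fourierTruncation hH (𝓕 (h2.toLp h)) =ᵐ[volume] 𝓕 (H.indicator h) := by
  have h3 : indicatorL2 hH (h2.toLp h) = (h2.indicator hH).toLp (H.indicator h) := by
    refine Lp.ext ?_
    filter_upwards [indicatorL2_ae_eq hH (h2.toLp h), h2.coeFn_toLp,
      (h2.indicator hH).coeFn_toLp] with x e1 e2 e3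
    rw [e1, e3]
    by_cases hx : x ∈ H <;> simp [hx, e2]
  rw [fourierTruncation, FourierTransform.fourierInv_fourier_eq, h3]
  exact fourier_toLp_ae_eq (h1.indicator hH) (h2.indicator hH)

theorem lintegral_enorm_sq_eq (f : Lp ℂ 2 (volume : Measure (Eucl d))) :
    ∫⁻ x, ‖f x‖ₑ ^ (2 : ℝ) = ENNReal.ofReal (‖f‖ ^ 2) := by
  rw [Lp.norm_def, ← ENNReal.toReal_pow, ENNReal.ofReal_toReal (by simp [(Lp.memLp f).2.ne]),
    eLpNorm_eq_lintegral_rpow_enorm_toReal (by norm_num) (by norm_num), ← ENNReal.rpow_natCast,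
    ← ENNReal.rpow_mul]
  simp

theorem lintegral_fourierTruncation_sq_le {H : Set (Eucl d)} (hH : MeasurableSet H)
    (f : Lp ℂ 2 (volume : Measure (Eucl d))) :
    ∫⁻ x, ‖fourierTruncation hH f x‖ₑ ^ (2 : ℝ) ≤ ((1 : ℝ≥0) : ℝ≥0∞) * ∫⁻ x, ‖f x‖ₑ ^ (2 : ℝ) := by
  rw [lintegral_enorm_sq_eq, lintegral_enorm_sq_eq, ENNReal.coe_one, one_mul]
  have := norm_fourierTruncation_le hH f
  gcongr

/-- The Fourier transform turns the product of the Schwartz function `χ` and an `L²` function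
into a convolution. -/
theorem fourier_mul_fourierInv_eq (χ : 𝓢(Eucl d, ℂ)) (f : Lp ℂ 2 (volume : Measure (Eucl d)))
    (y : Eucl d) :
    𝓕 (fun t => χ t * (𝓕⁻ f : Lp ℂ 2 (volume : Measure (Eucl d))) t) y =
      ∫ ξ, f ξ * 𝓕 χ (y - ξ) := by
  -- Absorbing the character into the cutoff turns the Fourier integral at `y` into a pairing with a
  -- Schwartz function, to which the distributional form of the `L²` transform applies.
  set ψ : 𝓢(Eucl d, ℂ) := smulLeftCLM ℂ (character y) χ with hψ
  have hψa : ∀ t, ψ t = character y t * χ t := fun t =>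
    smulLeftCLM_apply_apply (hasTemperateGrowth_character y) _ _
  have e1 := congrArg (fun T : 𝓢'(Eucl d, ℂ) => T ψ) (Lp.fourierInv_toTemperedDistribution_eq f)
  simp only [TemperedDistribution.fourierInv_apply, Lp.toTemperedDistribution_apply] at e1
  have e2 : ∀ ξ, 𝓕⁻ ψ ξ = 𝓕 χ (y - ξ) := by
    intro ξ
    rw [SchwartzMap.fourierInv_coe, SchwartzMap.fourier_coe, Real.fourierInv_eq', Real.fourier_eq']
    refine integral_congr_ae (Filter.Eventually.of_forall fun t => ?_)
    simp only [hψa, character, smul_eq_mul]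
    rw [← mul_assoc, ← Complex.exp_add, inner_sub_right, real_inner_comm t y]
    congr 2
    push_cast
    ring
  rw [Real.fourier_eq']
  calc _ = ∫ x, ψ x • (𝓕⁻ f : Lp ℂ 2 (volume : Measure (Eucl d))) x := by
        refine integral_congr_ae (Filter.Eventually.of_forall fun t => ?_)
        simp only [hψa, character, smul_eq_mul]
        rw [← mul_assoc, real_inner_comm t y]
        congr 3
        push_cast
        ring
    _ = ∫ x, 𝓕⁻ ψ x • f x := e1.symm
    _ = _ := by
        refine integral_congr_ae (Filter.Eventually.of_forall fun t => ?_)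
        simp only [e2, smul_eq_mul]
        ring

/-- Fatou's lemma for `p`-th powers; it passes uniform bounds to almost everywhere limits. -/
theorem lintegral_rpow_le_of_tendsto_ae {α : Type*} [MeasurableSpace α] {μ : Measure α}
    {F : ℕ → α → ℂ} {f : α → ℂ} {p : ℝ} (hF : ∀ n, AEStronglyMeasurable (F n) μ)
    (hlim : ∀ᵐ x ∂μ, Filter.Tendsto (fun n => F n x) Filter.atTop (nhds (f x))) {K : ℝ≥0∞}
    (hK : ∀ n, ∫⁻ x, ‖F n x‖ₑ ^ p ∂μ ≤ K) : ∫⁻ x, ‖f x‖ₑ ^ p ∂μ ≤ K := by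
  calc ∫⁻ x, ‖f x‖ₑ ^ p ∂μ = ∫⁻ x, Filter.liminf (fun n => ‖F n x‖ₑ ^ p) Filter.atTop ∂μ := by
        refine lintegral_congr_ae ?_
        filter_upwards [hlim] with x hx
        exact ((ENNReal.continuous_rpow_const.tendsto _).comp hx.enorm).liminf_eq.symm
    _ ≤ Filter.liminf (fun n => ∫⁻ x, ‖F n x‖ₑ ^ p ∂μ) Filter.atTop :=
        lintegral_liminf_le' fun n => (hF n).enorm.pow_const _
    _ ≤ K := Filter.liminf_le_of_frequently_le' (Filter.Frequently.of_forall hK)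

theorem exists_schwartz_eq_one : ∃ χ : 𝓢(Eucl d, ℂ), χ 0 = 1 ∧ HasCompactSupport χ := by
  let β : ContDiffBump (0 : Eucl d) := default
  have h1 : HasCompactSupport (Complex.ofRealCLM ∘ β) := β.hasCompactSupport.comp_left rfl
  have h2 : ContDiff ℝ (⊤ : ℕ∞) (Complex.ofRealCLM ∘ β) := Complex.ofRealCLM.contDiff.comp β.contDiff
  refine ⟨h1.toSchwartzMap h2, ?_, h1⟩
  change ((β 0 : ℝ) : ℂ) = 1
  rw [β.one_of_mem_closedBall (Metric.mem_closedBall_self β.rIn_pos.le), Complex.ofReal_one]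

/-- The bound is known for `L¹ ∩ L²` only. For general `f` the inverse transform `k` is multiplied
by dilated cutoffs: Young's inequality bounds the transforms of the products by `f`, uniformly in
`n`. The truncations converge in `L²`, and Fatou along an almost everywhere convergent subsequence
concludes. -/
theorem exists_lintegral_fourierTruncation_even_le {v : Eucl d} {H : Set (Eucl d)}
    (hH : IsHalfSpace v H) (m : ℕ) (hm : m ≠ 0) :
    ∃ C : ℝ≥0, ∀ f : Lp ℂ 2 (volume : Measure (Eucl d)),
      ∫⁻ x, ‖fourierTruncation hH.measurableSet f x‖ₑ ^ ((2 * m : ℕ) : ℝ) ≤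
        C * ∫⁻ x, ‖f x‖ₑ ^ ((2 * m : ℕ) : ℝ) := by
  obtain ⟨C, hC0, hC⟩ := exists_integral_fourier_indicator_le (V := Eucl d) m hm
  obtain ⟨χ, hχ0, -⟩ := exists_schwartz_eq_one (d := d)
  set L : ℝ≥0∞ := ∫⁻ ξ, ‖𝓕 χ ξ‖ₑ with hL
  have hLtop : L ≠ ∞ := (𝓕 χ).integrable.2.ne
  have hp1 : (1 : ℝ) < ((2 * m : ℕ) : ℝ) := by
    exact_mod_cast (by omega : 1 < 2 * m)
  refine ⟨C.toNNReal * (L ^ ((2 * m : ℕ) : ℝ)).toNNReal, fun f => ?_⟩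
  set k : Lp ℂ 2 (volume : Measure (Eucl d)) := 𝓕⁻ f with hk
  have hkm : MemLp k 2 := Lp.memLp k
  set kn : ℕ → Eucl d → ℂ := fun n t => dilate χ n t * k t with hkn
  have hk1 : ∀ n, Integrable (kn n) := fun n => ((dilate χ n).memLp 2).integrable_mul hkm
  have hk2 : ∀ n, MemLp (kn n) 2 := by
    intro n
    refine MemLp.of_le_mul (c := SchwartzMap.seminorm ℝ 0 0 χ) hkm (hk1 n).1
      (Filter.Eventually.of_forall fun t => ?_)
    rw [hkn, norm_mul]
    have := norm_dilate_le χ n t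
    gcongr
  -- uniform bound for the approximations
  have hbound : ∀ n, ∫⁻ x, ‖𝓕 (H.indicator (kn n)) x‖ₑ ^ ((2 * m : ℕ) : ℝ) ≤
      ENNReal.ofReal C * (L ^ ((2 * m : ℕ) : ℝ) * ∫⁻ x, ‖f x‖ₑ ^ ((2 * m : ℕ) : ℝ)) := by
    intro n
    have hconv : ∀ (g : Eucl d → ℂ), Integrable g → MemLp g 2 →
        ∫⁻ x, ‖𝓕 g x‖ₑ ^ ((2 * m : ℕ) : ℝ) = ENNReal.ofReal (∫ x, ‖𝓕 g x‖ ^ (2 * m)) := by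
      intro g hg1 hg2
      rw [ofReal_integral_eq_lintegral_ofReal]
      · refine lintegral_congr fun x => ?_
        rw [← Real.rpow_natCast, ofReal_rpow_eq_enorm_rpow _ (by positivity)]
      · exact integrable_norm_pow_of_bounded (memLp_two_fourier hg1 hg2)
          (norm_fourier_le_integral g) (by omega)
      · exact Filter.Eventually.of_forall fun x => by positivity
    calc _ = ENNReal.ofReal (∫ x, ‖𝓕 (H.indicator (kn n)) x‖ ^ (2 * m)) :=
          hconv _ ((hk1 n).indicator hH.measurableSet) ((hk2 n).indicator hH.measurableSet)
      _ ≤ ENNReal.ofReal (C * ∫ x, ‖𝓕 (kn n) x‖ ^ (2 * m)) :=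
          ENNReal.ofReal_le_ofReal (hC v H hH _ (hk1 n) (hk2 n))
      _ = ENNReal.ofReal C * ∫⁻ x, ‖𝓕 (kn n) x‖ₑ ^ ((2 * m : ℕ) : ℝ) := by
          rw [ENNReal.ofReal_mul hC0, hconv _ (hk1 n) (hk2 n)]
      _ ≤ ENNReal.ofReal C * (L ^ ((2 * m : ℕ) : ℝ) * ∫⁻ x, ‖f x‖ₑ ^ ((2 * m : ℕ) : ℝ)) := by
          gcongr
          rw [hL, ← lintegral_fourier_dilate χ n]
          refine le_trans (lintegral_mono fun y => ?_) (lintegral_conv_rpow_le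
            (f := fun x => ‖f x‖ₑ) (κ := fun x => ‖𝓕 (dilate χ n) x‖ₑ)
            (Lp.stronglyMeasurable f).measurable.enorm
            (𝓕 (dilate χ n)).continuous.measurable.enorm hp1)
          rw [hkn, fourier_mul_fourierInv_eq]
          gcongr
          refine (enorm_integral_le_lintegral_enorm _).trans (lintegral_mono fun z => ?_)
          rw [enorm_mul]
  -- convergence in `L²`
  have htend : Filter.Tendsto (fun n => (hk2 n).toLp (kn n)) Filter.atTop (nhds k) := by
    rw [Lp.tendsto_Lp_iff_tendsto_eLpNorm' ]
    have h2 : ∀ n, eLpNorm (⇑((hk2 n).toLp (kn n)) - ⇑k) 2 volume =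
        (∫⁻ x, ‖dilate χ n x - 1‖ₑ ^ (2 : ℝ) * ‖k x‖ₑ ^ (2 : ℝ)) ^ (1 / (2 : ℝ)) := by
      intro n
      rw [eLpNorm_eq_lintegral_rpow_enorm_toReal (by norm_num) (by norm_num)]
      simp only [ENNReal.toReal_ofNat]
      congr 1
      refine lintegral_congr_ae ?_
      filter_upwards [(hk2 n).coeFn_toLp] with x hx
      rw [Pi.sub_apply, hx, ← ENNReal.mul_rpow_of_nonneg _ _ two_pos.le, ← enorm_mul, sub_mul, one_mul]
    simp_rw [h2]
    have h3 : Filter.Tendsto (fun n => ∫⁻ x, ‖dilate χ n x - 1‖ₑ ^ (2 : ℝ) * ‖k x‖ₑ ^ (2 : ℝ))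
        Filter.atTop (nhds (∫⁻ x : Eucl d, 0)) := by
      refine tendsto_lintegral_of_dominated_convergence
        (fun x => (ENNReal.ofReal (SchwartzMap.seminorm ℝ 0 0 χ + 1)) ^ (2 : ℝ) * ‖k x‖ₑ ^ (2 : ℝ))
        (fun n => ?_) (fun n => Filter.Eventually.of_forall fun x => ?_) ?_
        (Filter.Eventually.of_forall fun x => ?_)
      · exact (((dilate χ n).continuous.measurable.sub_const 1).enorm.pow_const _).mul
          ((Lp.stronglyMeasurable k).measurable.enorm.pow_const _)
      · dsimp only
        gcongr
        rw [← ofReal_norm]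
        refine ENNReal.ofReal_le_ofReal ((norm_sub_le _ _).trans ?_)
        rw [norm_one]
        linarith [norm_dilate_le χ n x]
      · rw [lintegral_const_mul' _ _ (by simp), lintegral_enorm_sq_eq]
        exact ENNReal.mul_ne_top (by simp) ENNReal.ofReal_ne_top
      · have h4 : Filter.Tendsto (fun n => ‖dilate χ n x - 1‖ₑ ^ (2 : ℝ)) Filter.atTop (nhds 0) := by
          have := ((tendsto_dilate χ x).sub_const 1).enorm
          rw [hχ0, sub_self, enorm_zero] at this
          simpa [Function.comp_def] using (ENNReal.continuous_rpow_const (y := 2)).tendsto _ |>.comp this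
        have := ENNReal.Tendsto.mul_const (b := ‖k x‖ₑ ^ (2 : ℝ)) h4
          (Or.inr (by simp))
        simpa using this
    have := (ENNReal.continuous_rpow_const (y := 1 / 2)).tendsto _ |>.comp h3
    simpa [Function.comp_def] using this
  have htend2 : Filter.Tendsto (fun n => fourierTruncation hH.measurableSet
      (𝓕 ((hk2 n).toLp (kn n)))) Filter.atTop (nhds (fourierTruncation hH.measurableSet f)) := by
    rw [tendsto_iff_norm_sub_tendsto_zero] at htend ⊢
    refine squeeze_zero (fun n => norm_nonneg _) (fun n => ?_) htend
    rw [← fourierTruncation_sub]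
    refine (norm_fourierTruncation_le _ _).trans ?_
    have : f = 𝓕 k := (FourierTransform.fourier_fourierInv_eq f).symm
    rw [this]
    exact ((congrArg norm ((Lp.fourierTransformₗᵢ (Eucl d) ℂ).map_sub _ _)).symm.trans
      (Lp.norm_fourier_eq _)).le
  have hmeas := tendstoInMeasure_of_tendsto_Lp htend2
  obtain ⟨ns, -, hns⟩ := hmeas.exists_seq_tendsto_ae
  refine (lintegral_rpow_le_of_tendsto_ae (fun n => Lp.aestronglyMeasurable _) hns
    (K := ENNReal.ofReal C * (L ^ ((2 * m : ℕ) : ℝ) * ∫⁻ x, ‖f x‖ₑ ^ ((2 * m : ℕ) : ℝ)))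
    fun n => ?_).trans ?_
  · refine le_trans (le_of_eq (lintegral_congr_ae ?_)) (hbound (ns n))
    filter_upwards [fourierTruncation_fourier hH.measurableSet (hk1 (ns n)) (hk2 (ns n))] with x hx
    rw [hx]
  · rw [← mul_assoc, ENNReal.coe_mul, ENNReal.coe_toNNReal (ENNReal.rpow_ne_top_of_nonneg (by positivity) hLtop)]
    rfl

/-- The indicator function of a half-space is an `L^p` Fourier multiplier for `1 < p < ∞`. -/
theorem exists_lintegral_fourier_indicator_le {v : Eucl d} {H : Set (Eucl d)}
    (hH : IsHalfSpace v H) {p : ℝ} (hp : 1 < p) :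
    ∃ C : ℝ≥0, ∀ h : Eucl d → ℂ, Integrable h → MemLp h 2 →
      ∫⁻ y, ‖𝓕 (H.indicator h) y‖ₑ ^ p ≤ C * ∫⁻ y, ‖𝓕 h y‖ₑ ^ p := by
  suffices h : ∃ C : ℝ≥0, ∀ f : Lp ℂ 2 (volume : Measure (Eucl d)),
      ∫⁻ x, ‖fourierTruncation hH.measurableSet f x‖ₑ ^ p ≤ C * ∫⁻ x, ‖f x‖ₑ ^ p by
    obtain ⟨C, hC⟩ := h
    refine ⟨C, fun h h1 h2 => ?_⟩
    have := hC (𝓕 (h2.toLp h))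
    rw [lintegral_congr_ae (g := fun y => ‖𝓕 (H.indicator h) y‖ₑ ^ p),
      lintegral_congr_ae (f := fun y => ‖(𝓕 (h2.toLp h) : Lp ℂ 2 (volume : Measure (Eucl d))) y‖ₑ ^ p)
        (g := fun y => ‖𝓕 h y‖ₑ ^ p)] at this
    · exact this
    · filter_upwards [fourier_toLp_ae_eq h1 h2] with x hx
      rw [hx]
    · filter_upwards [fourierTruncation_fourier hH.measurableSet h1 h2] with x hx
      rw [hx]
  -- Any `m > q` gives an even exponent `2 * m` beyond `q`, the upper end point of the
  -- interpolation.
  have hgt : ∀ q : ℝ, 2 < q → ∃ C : ℝ≥0, ∀ f : Lp ℂ 2 (volume : Measure (Eucl d)),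
      ∫⁻ x, ‖fourierTruncation hH.measurableSet f x‖ₑ ^ q ≤ C * ∫⁻ x, ‖f x‖ₑ ^ q := by
    intro q hq
    obtain ⟨m, hmq⟩ := exists_nat_gt q
    have hm : m ≠ 0 := by
      rintro rfl
      rw [Nat.cast_zero] at hmq
      linarith
    have hm2 : q < ((2 * m : ℕ) : ℝ) := by
      push_cast
      linarith
    obtain ⟨B, hB⟩ := exists_lintegral_fourierTruncation_even_le hH m hm
    exact lintegral_rpow_le_of_interpolation _ (fourierTruncation_add hH.measurableSet) hq hm2
      (lintegral_fourierTruncation_sq_le hH.measurableSet) hB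
  rcases lt_trichotomy p 2 with h | rfl | h
  · have hpq := Real.HolderConjugate.conjExponent hp
    have hq : 2 < p.conjExponent := by
      rw [Real.conjExponent, lt_div_iff₀ (by linarith)]; linarith
    obtain ⟨B, hB⟩ := hgt _ hq
    exact ⟨_, lintegral_rpow_le_of_selfAdjoint _ (inner_fourierTruncation hH.measurableSet) hpq hB⟩
  · exact ⟨1, lintegral_fourierTruncation_sq_le hH.measurableSet⟩
  · exact hgt p h

end HalfSpaceMultiplier

/-! ### Integrals of Schwartz functions. -/

section SchwartzIntegral

open scoped BoundedContinuousFunction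

variable {d : ℕ} {Z : Type*} [MeasurableSpace Z] {μ : Measure Z}

/-- The Banach space of bounded continuous functions with values in `n`-linear maps. -/
def DerivSpace (d n : ℕ) : Type := Eucl d →ᵇ (Eucl d [×n]→L[ℝ] ℂ)

noncomputable instance (d n : ℕ) : NormedAddCommGroup (DerivSpace d n) :=
  inferInstanceAs (NormedAddCommGroup (Eucl d →ᵇ (Eucl d [×n]→L[ℝ] ℂ)))

noncomputable instance (d n : ℕ) : NormedSpace ℂ (DerivSpace d n) :=
  inferInstanceAs (NormedSpace ℂ (Eucl d →ᵇ (Eucl d [×n]→L[ℝ] ℂ)))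

instance (d n : ℕ) : CompleteSpace (DerivSpace d n) :=
  inferInstanceAs (CompleteSpace (Eucl d →ᵇ (Eucl d [×n]→L[ℝ] ℂ)))

/-- Evaluation at a point. -/
noncomputable def DerivSpace.eval {d n : ℕ} (t : Eucl d) :
    DerivSpace d n →L[ℂ] (Eucl d [×n]→L[ℝ] ℂ) :=
  BoundedContinuousFunction.evalCLM (α := Eucl d) (β := Eucl d [×n]→L[ℝ] ℂ) ℂ t

theorem DerivSpace.ext {d n : ℕ} {F G : DerivSpace d n} (h : ∀ t, F.eval t = G.eval t) : F = G :=
  BoundedContinuousFunction.ext h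

theorem DerivSpace.norm_eval_le {d n : ℕ} (F : DerivSpace d n) (t : Eucl d) : ‖F.eval t‖ ≤ ‖F‖ :=
  BoundedContinuousFunction.norm_coe_le_norm (β := Eucl d [×n]→L[ℝ] ℂ) F t

theorem DerivSpace.continuous_eval {d n : ℕ} (F : DerivSpace d n) : Continuous fun t => F.eval t :=
  BoundedContinuousFunction.continuous (β := Eucl d [×n]→L[ℝ] ℂ) F

/-- The weighted derivative `x ↦ ‖x‖ ^ k D^n φ(x)` of a Schwartz function. -/
noncomputable def weightedDeriv (k n : ℕ) (φ : 𝓢(Eucl d, ℂ)) : DerivSpace d n :=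
  BoundedContinuousFunction.ofNormedAddCommGroup (β := Eucl d [×n]→L[ℝ] ℂ)
    (fun x => ‖x‖ ^ k • iteratedFDeriv ℝ n φ x)
    ((continuous_norm.pow k).smul ((φ.smooth ⊤).continuous_iteratedFDeriv (by exact_mod_cast le_top)))
    (SchwartzMap.seminorm ℝ k n φ) (fun x => by
      rw [norm_smul, norm_pow, norm_norm]; exact φ.le_seminorm ℝ k n x)

theorem weightedDeriv_eval (k n : ℕ) (φ : 𝓢(Eucl d, ℂ)) (x : Eucl d) :
    (weightedDeriv k n φ).eval x = ‖x‖ ^ k • iteratedFDeriv ℝ n φ x := rfl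

theorem norm_weightedDeriv_le (k n : ℕ) (φ : 𝓢(Eucl d, ℂ)) :
    ‖weightedDeriv k n φ‖ ≤ SchwartzMap.seminorm ℝ k n φ :=
  BoundedContinuousFunction.norm_ofNormedAddCommGroup_le (β := Eucl d [×n]→L[ℝ] ℂ) _
    (apply_nonneg _ _) _

/-- `weightedDeriv` as a continuous linear map. -/
noncomputable def weightedDerivCLM (d k n : ℕ) : 𝓢(Eucl d, ℂ) →L[ℂ] DerivSpace d n :=
  mkCLMtoNormedSpace (𝕜 := ℂ) (𝕜' := ℂ) (σ := RingHom.id ℂ) (weightedDeriv k n)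
    (fun φ ψ => by
      refine DerivSpace.ext fun x => ?_
      rw [map_add, weightedDeriv_eval, weightedDeriv_eval, weightedDeriv_eval,
        show ⇑(φ + ψ) = ⇑φ + ⇑ψ from rfl,
        iteratedFDeriv_add_apply (φ.smooth n).contDiffAt (ψ.smooth n).contDiffAt]
      exact smul_add _ _ _)
    (fun a φ => by
      refine DerivSpace.ext fun x => ?_
      rw [RingHom.id_apply, map_smul, weightedDeriv_eval, weightedDeriv_eval, smul_comm,
        ← iteratedFDeriv_const_smul_apply (φ.smooth n).contDiffAt]
      rfl)
    ⟨{(k, n)}, 1, zero_le_one, fun φ => by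
      rw [one_mul, Finset.sup_singleton]
      exact norm_weightedDeriv_le k n φ⟩

theorem weightedDerivCLM_eval (k n : ℕ) (φ : 𝓢(Eucl d, ℂ)) (x : Eucl d) :
    (weightedDerivCLM d k n φ).eval x = ‖x‖ ^ k • iteratedFDeriv ℝ n φ x := rfl

theorem norm_weightedDerivCLM_le (k n : ℕ) (φ : 𝓢(Eucl d, ℂ)) :
    ‖weightedDerivCLM d k n φ‖ ≤ SchwartzMap.seminorm ℝ k n φ := norm_weightedDeriv_le k n φ

theorem seminorm_le_norm_weightedDerivCLM (k n : ℕ) (φ : 𝓢(Eucl d, ℂ)) :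
    SchwartzMap.seminorm ℂ k n φ ≤ ‖weightedDerivCLM d k n φ‖ := by
  refine SchwartzMap.seminorm_le_bound ℂ k n φ (norm_nonneg _) fun x => ?_
  have := (weightedDerivCLM d k n φ).norm_eval_le x
  rwa [weightedDerivCLM_eval, norm_smul, norm_pow, norm_norm] at this

/-- A tempered distribution extends to a continuous functional on a Banach space of weighted
derivatives. -/
theorem exists_functional_weightedDeriv (u : 𝓢'(Eucl d, ℂ)) :
    ∃ (s : Finset (ℕ × ℕ)) (U : (∀ i : s, DerivSpace d i.1.2) →L[ℂ] ℂ),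
      ∀ φ, U (fun i => weightedDerivCLM d i.1.1 i.1.2 φ) = u φ := by
  classical
  obtain ⟨s₀, C, hC0, hs₀⟩ := Seminorm.bound_of_continuous (schwartz_withSeminorms ℂ (Eucl d) ℂ)
    ((normSeminorm ℂ ℂ).comp (u : 𝓢(Eucl d, ℂ) →L[ℂ] ℂ).toLinearMap)
    (continuous_norm.comp u.continuous)
  -- Including the sup norm makes `J` injective, so that `u` descends to a functional on the range
  -- of `J`.
  set s := insert (0, 0) s₀ with hs
  set B := ∀ i : s, DerivSpace d i.1.2 with hB
  let J : 𝓢(Eucl d, ℂ) →ₗ[ℂ] B := LinearMap.pi fun i => (weightedDerivCLM d i.1.1 i.1.2).toLinearMap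
  have hJ : ∀ φ i, J φ i = weightedDerivCLM d i.1.1 i.1.2 φ := fun φ i => rfl
  have hinj : Function.Injective J := by
    intro φ ψ h
    ext x
    have h0 := congrFun h ⟨(0, 0), by simp [hs]⟩
    have h1 := congrArg (fun F : DerivSpace d 0 => F.eval x 0) h0
    simpa [hJ, weightedDerivCLM_eval] using h1
  have hbound : ∀ φ, ‖u φ‖ ≤ C * ‖J φ‖ := by
    intro φ
    refine (hs₀ φ).trans ?_
    rw [smul_apply, NNReal.smul_def, smul_eq_mul]
    gcongr
    refine Seminorm.finset_sup_apply_le (norm_nonneg _) fun i hi => ?_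
    exact (seminorm_le_norm_weightedDerivCLM i.1 i.2 φ).trans
      (norm_le_pi_norm (J φ) ⟨i, Finset.mem_insert_of_mem hi⟩)
  let e := LinearEquiv.ofInjective J hinj
  let f₀ : LinearMap.range J →ₗ[ℂ] ℂ :=
    ((u : 𝓢(Eucl d, ℂ) →L[ℂ] ℂ).toLinearMap).comp e.symm.toLinearMap
  have hf₀ : ∀ y, ‖f₀ y‖ ≤ C * ‖y‖ := by
    intro y
    obtain ⟨φ, rfl⟩ := e.surjective y
    have : f₀ (e φ) = u φ := by
      change u (e.symm (e φ)) = u φ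
      rw [e.symm_apply_apply]
    rw [this]
    exact hbound φ
  -- Hahn–Banach extends the functional to the whole Banach space, where it commutes with Bochner
  -- integrals.
  obtain ⟨U, hU, -⟩ := exists_extension_norm_eq (𝕜 := ℂ) (LinearMap.range J) (f₀.mkContinuous C hf₀)
  refine ⟨s, U, fun φ => ?_⟩
  have h1 := hU (e φ)
  have h2 : (f₀.mkContinuous C hf₀) (e φ) = u φ := by
    change u (e.symm (e φ)) = u φ
    rw [e.symm_apply_apply]
  rw [h2] at h1
  exact h1

theorem integral_clm_apply_of_norm_le {E H : Type*} [NormedAddCommGroup E] [NormedSpace ℝ E]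
    [NormedAddCommGroup H] [NormedSpace ℝ H] [CompleteSpace H] {f : Z → E →L[ℝ] H}
    (hm : AEStronglyMeasurable f μ) {b : Z → ℝ} (hb : Integrable b μ) (hfb : ∀ z, ‖f z‖ ≤ b z)
    (v : E) : Integrable (fun z => f z v) μ ∧ (∫ z, f z ∂μ) v = ∫ z, f z v ∂μ := by
  have hf : Integrable f μ := hb.mono' hm (Filter.Eventually.of_forall hfb)
  exact ⟨(ContinuousLinearMap.apply ℝ H v).integrable_comp hf,
    ContinuousLinearMap.integral_apply hf v⟩

/-- An absolutely convergent integral of Schwartz functions is a Schwartz function, and tempered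
distributions commute with the integral. -/
theorem exists_schwartz_integral {F : Z → 𝓢(Eucl d, ℂ)} (hF : StronglyMeasurable F)
    (hint : ∀ k n : ℕ, ∃ b : Z → ℝ, Integrable b μ ∧ ∀ z, SchwartzMap.seminorm ℝ k n (F z) ≤ b z) :
    ∃ G : 𝓢(Eucl d, ℂ), (∀ t, G t = ∫ z, F z t ∂μ) ∧
      ∀ u : 𝓢'(Eucl d, ℂ), Integrable (fun z => u (F z)) μ ∧ u G = ∫ z, u (F z) ∂μ := by
  have hW : ∀ k n, Integrable (fun z => weightedDerivCLM d k n (F z)) μ := by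
    intro k n
    obtain ⟨b, hb, hbF⟩ := hint k n
    refine hb.mono' ((weightedDerivCLM d k n).continuous.comp_stronglyMeasurable hF).aestronglyMeasurable
      (Filter.Eventually.of_forall fun z => ?_)
    exact (norm_weightedDerivCLM_le k n _).trans (hbF z)
  have hcompC : ∀ (k n : ℕ) (t : Eucl d), ∫ z, ‖t‖ ^ k • iteratedFDeriv ℝ n (F z) t ∂μ =
      (∫ z, weightedDerivCLM d k n (F z) ∂μ).eval t := fun k n t =>
    (DerivSpace.eval t).integral_comp_comm (hW k n)
  have hI : ∀ (n : ℕ) (t : Eucl d), Integrable (fun z => iteratedFDeriv ℝ n (F z) t) μ := by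
    intro n t
    have := (DerivSpace.eval t).integrable_comp (hW 0 n)
    refine this.congr (Filter.Eventually.of_forall fun z => ?_)
    simp [weightedDerivCLM_eval]
  have hD : ∀ (n : ℕ) (t : Eucl d), ∫ z, iteratedFDeriv ℝ n (F z) t ∂μ =
      (∫ z, weightedDerivCLM d 0 n (F z) ∂μ).eval t := by
    intro n t
    rw [← hcompC]
    simp
  have hmeas : ∀ (n : ℕ) (t : Eucl d),
      AEStronglyMeasurable (fun z => fderiv ℝ (iteratedFDeriv ℝ n (F z)) t) μ := by
    intro n t
    have e1 : (fun z => fderiv ℝ (iteratedFDeriv ℝ n (F z)) t) = fun z =>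
        (continuousMultilinearCurryLeftEquiv ℝ (fun _ : Fin (n + 1) => Eucl d) ℂ)
          (iteratedFDeriv ℝ (n + 1) (F z) t) := by
      funext z
      rw [fderiv_iteratedFDeriv]
      rfl
    rw [e1]
    exact (LinearIsometryEquiv.continuous _).comp_aestronglyMeasurable (hI (n + 1) t).1
  set G₀ : Eucl d → ℂ := fun t => ∫ z, F z t ∂μ with hG₀
  -- Smoothness is shown by exhibiting the integrated derivatives as a Taylor series, each
  -- differentiated under the integral sign with the bound for the next order.
  have hT : HasFTaylorSeriesUpTo (⊤ : ℕ∞) G₀ fun t n => ∫ z, iteratedFDeriv ℝ n (F z) t ∂μ := by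
    refine ⟨fun t => ?_, fun n _ t => ?_, fun n _ => ?_⟩
    · change (∫ z, iteratedFDeriv ℝ 0 (F z) t ∂μ) 0 = G₀ t
      rw [ContinuousMultilinearMap.integral_apply (hI 0 t)]
      simp [hG₀]
    · obtain ⟨b, hb, hbF⟩ := hint 0 (n + 1)
      have hbound : ∀ z x, ‖fderiv ℝ (iteratedFDeriv ℝ n (F z)) x‖ ≤ b z := fun z x => by
        rw [norm_fderiv_iteratedFDeriv]
        have := (F z).le_seminorm ℝ 0 (n + 1) x
        rw [pow_zero, one_mul] at this
        exact this.trans (hbF z)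
      have h1 := hasFDerivAt_integral_of_dominated_of_fderiv_le (𝕜 := ℝ) (μ := μ)
        (F := fun x z => iteratedFDeriv ℝ n (F z) x) (x₀ := t) (s := Set.univ) (bound := b)
        (F' := fun x z => fderiv ℝ (iteratedFDeriv ℝ n (F z)) x) Filter.univ_mem
        (Filter.Eventually.of_forall fun x => (hI n x).1) (hI n t) ?_ ?_ hb ?_
      · refine h1.congr_fderiv ?_
        ext v m
        obtain ⟨hb2, hb3⟩ := integral_clm_apply_of_norm_le (hmeas n t) hb (fun z => hbound z t) v
        rw [hb3, ContinuousMultilinearMap.integral_apply hb2,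
          ContinuousMultilinearMap.curryLeft_apply,
          ContinuousMultilinearMap.integral_apply (hI (n + 1) t)]
        rfl
      · exact hmeas n t
      · exact Filter.Eventually.of_forall fun z x _ => hbound z x
      · refine Filter.Eventually.of_forall fun z x _ => ?_
        exact (((F z).smooth (n + 1)).differentiable_iteratedFDeriv (by norm_cast; omega) x).hasFDerivAt
    · simp_rw [hD]
      exact DerivSpace.continuous_eval _
  have hGD : ∀ (n : ℕ) t, iteratedFDeriv ℝ n G₀ t = ∫ z, iteratedFDeriv ℝ n (F z) t ∂μ :=
    fun n t => (hT.eq_iteratedFDeriv (by exact_mod_cast le_top) t).symm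
  have hGW : ∀ (k n : ℕ) t, ‖t‖ ^ k • iteratedFDeriv ℝ n G₀ t =
      (∫ z, weightedDerivCLM d k n (F z) ∂μ).eval t := by
    intro k n t
    rw [← hcompC, integral_smul, hGD]
  let G : 𝓢(Eucl d, ℂ) := ⟨G₀, hT.contDiff, fun k n => ⟨‖∫ z, weightedDerivCLM d k n (F z) ∂μ‖, fun t => by
    have := (∫ z, weightedDerivCLM d k n (F z) ∂μ).norm_eval_le t
    rwa [← hGW, norm_smul, norm_pow, norm_norm] at this⟩⟩
  refine ⟨G, fun t => rfl, fun u => ?_⟩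
  obtain ⟨s, U, hU⟩ := exists_functional_weightedDeriv u
  have hJ : (fun i : s => weightedDerivCLM d i.1.1 i.1.2 G) =
      ∫ z, (fun i : s => weightedDerivCLM d i.1.1 i.1.2 (F z)) ∂μ := by
    funext i
    have hint' : Integrable (fun z (i : s) => weightedDerivCLM d i.1.1 i.1.2 (F z)) μ :=
      Integrable.of_eval fun i => hW _ _
    rw [eval_integral fun i => hint'.eval i]
    refine DerivSpace.ext fun t => ?_
    rw [weightedDerivCLM_eval]
    exact hGW _ _ t
  refine ⟨(U.integrable_comp (Integrable.of_eval fun i : s => hW i.1.1 i.1.2)).congr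
    (Filter.Eventually.of_forall fun z => hU (F z)), ?_⟩
  rw [← hU G, hJ, ← U.integral_comp_comm (Integrable.of_eval fun i => hW _ _)]
  simp_rw [hU]

end SchwartzIntegral

/-! ### Polynomial growth of the atoms. -/

section Growth

variable {d : ℕ}

/-- A finite supremum of the Schwartz seminorms. -/
noncomputable def supSeminorm (s : Finset (ℕ × ℕ)) : Seminorm ℝ 𝓢(Eucl d, ℂ) :=
  s.sup (schwartzSeminormFamily ℝ (Eucl d) ℂ)

theorem supSeminorm_mono {s t : Finset (ℕ × ℕ)} (h : s ⊆ t) (f : 𝓢(Eucl d, ℂ)) :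
    supSeminorm s f ≤ supSeminorm t f :=
  (Finset.sup_mono h : supSeminorm (d := d) s ≤ supSeminorm t) f

theorem supSeminorm_singleton (k n : ℕ) (f : 𝓢(Eucl d, ℂ)) :
    supSeminorm {(k, n)} f = SchwartzMap.seminorm ℝ k n f := by
  rw [supSeminorm, Finset.sup_singleton]; rfl

theorem exists_supSeminorm_comp_le (L : 𝓢(Eucl d, ℂ) →L[ℝ] 𝓢(Eucl d, ℂ)) (s : Finset (ℕ × ℕ)) :
    ∃ (s' : Finset (ℕ × ℕ)) (C : ℝ), 0 ≤ C ∧ ∀ f, supSeminorm s (L f) ≤ C * supSeminorm s' f := by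
  have hc : Continuous (supSeminorm s : Seminorm ℝ 𝓢(Eucl d, ℂ)) := by
    have h2 := Seminorm.continuous_finsetSup (p := schwartzSeminormFamily ℝ (Eucl d) ℂ) (s := s)
      (fun i _ => (schwartz_withSeminorms ℝ (Eucl d) ℂ).continuous_seminorm i)
    exact h2
  obtain ⟨s', C, -, h⟩ := Seminorm.bound_of_continuous (schwartz_withSeminorms ℝ (Eucl d) ℂ)
    ((supSeminorm s).comp (L : 𝓢(Eucl d, ℂ) →ₗ[ℝ] 𝓢(Eucl d, ℂ))) (hc.comp L.continuous)
  exact ⟨s', C, C.2, fun f => h f⟩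

theorem seminorm_translate_le (k n : ℕ) (a : Eucl d) (f : 𝓢(Eucl d, ℂ)) :
    SchwartzMap.seminorm ℝ k n (compSubConstCLM ℂ a f) ≤
      2 ^ k * (1 + ‖a‖) ^ k * supSeminorm (Finset.Iic (k, n)) f := by
  refine SchwartzMap.seminorm_le_bound ℝ k n _ (by positivity) fun x => ?_
  have e : (⇑(compSubConstCLM ℂ a f)) = fun z => f (z - a) := rfl
  rw [e, iteratedFDeriv_comp_sub]
  have h1 := one_add_le_sup_seminorm_apply (𝕜 := ℝ) (m := (k, n)) le_rfl le_rfl f (x - a)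
  have h2 : ‖x‖ ≤ (1 + ‖a‖) * (1 + ‖x - a‖) := by
    have := norm_sub_norm_le x a
    nlinarith [norm_nonneg a, norm_nonneg (x - a), norm_nonneg x,
      mul_nonneg (norm_nonneg a) (norm_nonneg (x - a))]
  calc ‖x‖ ^ k * ‖iteratedFDeriv ℝ n f (x - a)‖
      ≤ ((1 + ‖a‖) * (1 + ‖x - a‖)) ^ k * ‖iteratedFDeriv ℝ n f (x - a)‖ := by gcongr
    _ = (1 + ‖a‖) ^ k * ((1 + ‖x - a‖) ^ k * ‖iteratedFDeriv ℝ n f (x - a)‖) := by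
      rw [mul_pow]; ring
    _ ≤ (1 + ‖a‖) ^ k * (2 ^ k * supSeminorm (Finset.Iic (k, n)) f) :=
      mul_le_mul_of_nonneg_left h1 (by positivity)
    _ = _ := by ring

theorem exists_supSeminorm_translate_le (s : Finset (ℕ × ℕ)) :
    ∃ (s' : Finset (ℕ × ℕ)) (K : ℕ), ∀ (a : Eucl d) (f : 𝓢(Eucl d, ℂ)),
      supSeminorm s (compSubConstCLM ℂ a f) ≤ 2 ^ K * (1 + ‖a‖) ^ K * supSeminorm s' f := by
  refine ⟨s.biUnion fun i => Finset.Iic i, s.sup Prod.fst, fun a f => ?_⟩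
  refine Seminorm.finset_sup_apply_le (by positivity) fun i hi => ?_
  have h1 : i.1 ≤ s.sup Prod.fst := Finset.le_sup (f := Prod.fst) hi
  calc SchwartzMap.seminorm ℝ i.1 i.2 (compSubConstCLM ℂ a f)
      ≤ 2 ^ i.1 * (1 + ‖a‖) ^ i.1 * supSeminorm (Finset.Iic (i.1, i.2)) f :=
        seminorm_translate_le _ _ _ _
    _ ≤ _ := by
      have h2 : (1 : ℝ) ≤ 1 + ‖a‖ := by linarith [norm_nonneg a]
      have h3 : supSeminorm (Finset.Iic (i.1, i.2)) f ≤
          supSeminorm (s.biUnion fun i => Finset.Iic i) f :=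
        supSeminorm_mono (Finset.subset_biUnion_of_mem (fun i => Finset.Iic i) hi) f
      gcongr
      norm_num

/-- Modulations are translations on the Fourier side, so the growth estimate for translations also
covers modulations. -/
theorem modulate_eq_fourierInv (h : 𝓢(Eucl d, ℂ)) (y : Eucl d) :
    smulLeftCLM ℂ (character y) h = 𝓕⁻ (compSubConstCLM ℂ (-y) (𝓕 h)) := by
  have hinv : 𝓕⁻ (𝓕 (smulLeftCLM ℂ (character y) h)) = smulLeftCLM ℂ (character y) h :=
    FourierTransform.fourierInv_fourier_eq _
  rw [← hinv]
  congr 1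
  ext ξ
  rw [compSubConstCLM_apply, SchwartzMap.fourier_coe, SchwartzMap.fourier_coe, Real.fourier_eq',
    Real.fourier_eq']
  congr 1
  funext t
  rw [smulLeftCLM_apply_apply (hasTemperateGrowth_character y), smul_eq_mul, smul_eq_mul,
    smul_eq_mul, ← mul_assoc, character, ← Complex.exp_add]
  congr 2
  rw [sub_neg_eq_add, inner_add_right, real_inner_comm y t]
  push_cast
  ring

theorem exists_supSeminorm_fourier_le (s : Finset (ℕ × ℕ)) :
    ∃ (s' : Finset (ℕ × ℕ)) (C : ℝ), 0 ≤ C ∧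
      ∀ f : 𝓢(Eucl d, ℂ), supSeminorm s (𝓕 f) ≤ C * supSeminorm s' f :=
  exists_supSeminorm_comp_le (SchwartzMap.fourierTransformCLM ℝ) s

theorem exists_supSeminorm_fourierInv_le (s : Finset (ℕ × ℕ)) :
    ∃ (s' : Finset (ℕ × ℕ)) (C : ℝ), 0 ≤ C ∧
      ∀ f : 𝓢(Eucl d, ℂ), supSeminorm s (𝓕⁻ f) ≤ C * supSeminorm s' f :=
  exists_supSeminorm_comp_le
    ((FourierTransform.fourierCLE ℝ 𝓢(Eucl d, ℂ)).symm : 𝓢(Eucl d, ℂ) →L[ℝ] 𝓢(Eucl d, ℂ)) s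

/-- The complex conjugate of a Schwartz function. -/
noncomputable def conjS (g : 𝓢(Eucl d, ℂ)) : 𝓢(Eucl d, ℂ) :=
  postcompCLM (𝕜 := ℝ) (Complex.conjCLE : ℂ →L[ℝ] ℂ) g

theorem conjS_apply (g : 𝓢(Eucl d, ℂ)) (t : Eucl d) : conjS g t = (starRingEnd ℂ) (g t) := rfl

theorem stftAtom_eq (g : 𝓢(Eucl d, ℂ)) (x y : Eucl d) :
    stftAtom g x y = smulLeftCLM ℂ (character y) (compSubConstCLM ℂ x (conjS g)) := rfl

theorem conj_stftAtom (g : 𝓢(Eucl d, ℂ)) (x y t : Eucl d) :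
    (starRingEnd ℂ) (stftAtom g x y t) = stftAtom (conjS g) x (-y) t := by
  rw [stftAtom_apply, stftAtom_apply, conjS_apply, map_mul, ← Complex.exp_conj]
  congr 2
  simp only [map_mul, map_neg, Complex.conj_ofReal, Complex.conj_I, inner_neg_left,
    Complex.ofReal_neg, show (starRingEnd ℂ) 2 = 2 from Complex.conj_ofReal 2]
  ring

/-- The weight `(1 + |x|) (1 + |y|)` on phase space. -/
noncomputable def phaseWeight (z : Eucl d × Eucl d) : ℝ := (1 + ‖z.1‖) * (1 + ‖z.2‖)

theorem one_le_phaseWeight (z : Eucl d × Eucl d) : 1 ≤ phaseWeight z := by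
  unfold phaseWeight
  nlinarith [norm_nonneg z.1, norm_nonneg z.2, mul_nonneg (norm_nonneg z.1) (norm_nonneg z.2)]

theorem phaseWeight_pos (z : Eucl d × Eucl d) : 0 < phaseWeight z :=
  one_pos.trans_le (one_le_phaseWeight z)

theorem continuous_phaseWeight : Continuous (phaseWeight (d := d)) := by
  unfold phaseWeight; fun_prop

/-- The seminorms of the atoms grow at most polynomially in phase space. -/
theorem exists_supSeminorm_stftAtom_le (g : 𝓢(Eucl d, ℂ)) (s : Finset (ℕ × ℕ)) :
    ∃ (C : ℝ) (K : ℕ), 0 ≤ C ∧ ∀ z : Eucl d × Eucl d,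
      supSeminorm s (stftAtom g z.1 z.2) ≤ C * phaseWeight z ^ K := by
  obtain ⟨s₁, C₁, hC₁, h₁⟩ := exists_supSeminorm_fourierInv_le (d := d) s
  obtain ⟨s₂, K₂, h₂⟩ := exists_supSeminorm_translate_le (d := d) s₁
  obtain ⟨s₃, C₃, hC₃, h₃⟩ := exists_supSeminorm_fourier_le (d := d) s₂
  obtain ⟨s₄, K₄, h₄⟩ := exists_supSeminorm_translate_le (d := d) s₃
  set S := supSeminorm s₄ (conjS g)
  have hS : 0 ≤ S := apply_nonneg _ _
  refine ⟨C₁ * (2 ^ K₂ * (C₃ * (2 ^ K₄ * S))), K₂ + K₄, by positivity, fun z => ?_⟩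
  rw [stftAtom_eq, modulate_eq_fourierInv]
  have hx : (1 : ℝ) ≤ 1 + ‖z.1‖ := by linarith [norm_nonneg z.1]
  have hy : (1 : ℝ) ≤ 1 + ‖z.2‖ := by linarith [norm_nonneg z.2]
  calc _ ≤ C₁ * (2 ^ K₂ * (1 + ‖-z.2‖) ^ K₂ * (C₃ * (2 ^ K₄ * (1 + ‖z.1‖) ^ K₄ * S))) := by
        refine (h₁ _).trans ?_
        gcongr
        refine (h₂ _ _).trans ?_
        gcongr
        refine (h₃ _).trans ?_
        gcongr
        exact h₄ _ _
    _ = C₁ * (2 ^ K₂ * (C₃ * (2 ^ K₄ * S))) * ((1 + ‖z.1‖) ^ K₄ * (1 + ‖z.2‖) ^ K₂) := by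
        rw [norm_neg]; ring
    _ ≤ C₁ * (2 ^ K₂ * (C₃ * (2 ^ K₄ * S))) * ((1 + ‖z.1‖) ^ (K₂ + K₄) * (1 + ‖z.2‖) ^ (K₂ + K₄)) := by
        gcongr <;> omega
    _ = _ := by rw [phaseWeight, mul_pow]

theorem stronglyMeasurable_stftAtom (g : 𝓢(Eucl d, ℂ)) :
    StronglyMeasurable fun z : Eucl d × Eucl d => stftAtom g z.1 z.2 := by
  have : (uniformity 𝓢(Eucl d, ℂ)).IsCountablyGenerated :=
    IsUniformAddGroup.uniformity_countably_generated
  refine stronglyMeasurable_uncurry_of_continuous_of_stronglyMeasurable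
    (u := fun x y => stftAtom g x y) (fun y => ?_) (fun x => ?_)
  · exact (smulLeftCLM ℂ (character y) : 𝓢(Eucl d, ℂ) →L[ℂ] 𝓢(Eucl d, ℂ)).continuous.comp
      (continuous_translate (conjS g))
  · exact (continuous_modulate (compSubConstCLM ℂ x (conjS g))).stronglyMeasurable

theorem continuous_stftAtom_apply (g : 𝓢(Eucl d, ℂ)) :
    Continuous fun q : (Eucl d × Eucl d) × Eucl d => stftAtom g q.1.1 q.1.2 q.2 := by
  simp_rw [stftAtom_apply]
  have := g.continuous
  fun_prop

end Growth

/-! ### Rapid decay of coefficients. -/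

section Decay

variable {d : ℕ}

/-- The coefficients `∫ w(t) g (t - x) e^{2 π i y · t} dt` of the function `w`. -/
noncomputable def dualStft (g : 𝓢(Eucl d, ℂ)) (w : Eucl d → ℂ) (z : Eucl d × Eucl d) : ℂ :=
  ∫ t, w t * (starRingEnd ℂ) (stftAtom g z.1 z.2 t)

theorem measurable_dualStft (g : 𝓢(Eucl d, ℂ)) {w : Eucl d → ℂ} (hw : Measurable w) :
    Measurable (dualStft g w) := by
  have h : StronglyMeasurable (fun q : (Eucl d × Eucl d) × Eucl d =>
      w q.2 * (starRingEnd ℂ) (stftAtom g q.1.1 q.1.2 q.2)) :=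
    (hw.comp measurable_snd).stronglyMeasurable.mul
      (Complex.continuous_conj.comp (continuous_stftAtom_apply g)).stronglyMeasurable
  exact (h.integral_prod_right (ν := volume)).measurable

theorem integrable_one_add_norm_pow_mul (h : 𝓢(Eucl d, ℂ)) (N : ℕ) :
    Integrable fun s : Eucl d => (1 + ‖s‖) ^ N * ‖h s‖ := by
  have h0 : Integrable (fun s : Eucl d => 2 ^ (N - 1) * (‖h s‖ + ‖s‖ ^ N * ‖h s‖)) :=
    ((h.integrable.norm).add (h.integrable_pow_mul volume N)).const_mul _
  refine h0.mono' (by have := h.continuous; fun_prop) (Filter.Eventually.of_forall fun s => ?_)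
  rw [Real.norm_of_nonneg (by positivity)]
  have := add_pow_le zero_le_one (norm_nonneg s) N
  calc (1 + ‖s‖) ^ N * ‖h s‖ ≤ (2 ^ (N - 1) * (1 ^ N + ‖s‖ ^ N)) * ‖h s‖ := by gcongr
    _ = _ := by rw [one_pow]; ring

/-- By `1 + ‖a‖ ≤ (1 + ‖t‖) (1 + ‖t - a‖)` the weight in `a` is shared between `f` and the translate
of `h`. -/
theorem exists_integral_norm_mul_translate_le (h : 𝓢(Eucl d, ℂ)) (N : ℕ) :
    ∃ C : ℝ, 0 ≤ C ∧ ∀ (f : 𝓢(Eucl d, ℂ)) (a : Eucl d),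
      ∫ t, ‖f t‖ * ‖h (t - a)‖ ≤ C * supSeminorm (Finset.Iic (N, 0)) f * ((1 + ‖a‖) ^ N)⁻¹ := by
  set I := ∫ s, (1 + ‖s‖) ^ N * ‖h s‖ with hI
  have hI0 : 0 ≤ I := integral_nonneg fun s => by positivity
  refine ⟨2 ^ N * I, by positivity, fun f a => ?_⟩
  have ha : 0 < (1 + ‖a‖) ^ N := by positivity
  rw [← div_eq_mul_inv, le_div_iff₀ ha, ← integral_mul_const]
  have hint := (integrable_one_add_norm_pow_mul h N).comp_sub_right a
  have hshift : ∫ t, (1 + ‖t - a‖) ^ N * ‖h (t - a)‖ = I :=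
    integral_sub_right_eq_self (fun s => (1 + ‖s‖) ^ N * ‖h s‖) a
  calc ∫ t, ‖f t‖ * ‖h (t - a)‖ * (1 + ‖a‖) ^ N
      ≤ ∫ t, (2 ^ N * supSeminorm (Finset.Iic (N, 0)) f) * ((1 + ‖t - a‖) ^ N * ‖h (t - a)‖) := by
        refine integral_mono_of_nonneg (Filter.Eventually.of_forall fun t => by positivity)
          (hint.const_mul _) (Filter.Eventually.of_forall fun t => ?_)
        have h1 := one_add_le_sup_seminorm_apply (𝕜 := ℝ) (m := (N, 0)) le_rfl le_rfl f t
        rw [norm_iteratedFDeriv_zero] at h1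
        have h2 : 1 + ‖a‖ ≤ (1 + ‖t‖) * (1 + ‖t - a‖) := by
          have := norm_le_norm_add_norm_sub' a t
          rw [norm_sub_rev] at this
          nlinarith [norm_nonneg t, norm_nonneg (t - a),
            mul_nonneg (norm_nonneg t) (norm_nonneg (t - a))]
        calc ‖f t‖ * ‖h (t - a)‖ * (1 + ‖a‖) ^ N
            ≤ ‖f t‖ * ‖h (t - a)‖ * ((1 + ‖t‖) * (1 + ‖t - a‖)) ^ N := by gcongr
          _ = ((1 + ‖t‖) ^ N * ‖f t‖) * ((1 + ‖t - a‖) ^ N * ‖h (t - a)‖) := by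
            rw [mul_pow]; ring
          _ ≤ _ := mul_le_mul_of_nonneg_right h1 (by positivity)
    _ = _ := by rw [integral_const_mul, hshift]; ring

/-- The Fourier transform exchanges translation and modulation, so the modulus sees only a translate
by `-y`; this yields decay in `y` by the same argument as decay in `x`. -/
theorem fourier_stftAtom_apply (g : 𝓢(Eucl d, ℂ)) (x y ξ : Eucl d) :
    ‖𝓕 (stftAtom g x y) ξ‖ = ‖𝓕 (conjS g) (ξ + y)‖ := by
  have e : 𝓕 (stftAtom g x y) = compSubConstCLM ℂ (-y) (𝓕 (compSubConstCLM ℂ x (conjS g))) := by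
    rw [stftAtom_eq, modulate_eq_fourierInv]
    exact FourierTransform.fourier_fourierInv_eq _
  rw [e, compSubConstCLM_apply, sub_neg_eq_add, SchwartzMap.fourier_coe, SchwartzMap.fourier_coe,
    Real.fourier_eq', Real.fourier_eq']
  set η := ξ + y
  have h1 : ∫ t, Complex.exp (↑(-2 * Real.pi * inner ℝ t η) * Complex.I) •
        (compSubConstCLM ℂ x (conjS g)) t =
      Complex.exp (↑(-2 * Real.pi * inner ℝ x η) * Complex.I) •
        ∫ t, Complex.exp (↑(-2 * Real.pi * inner ℝ t η) * Complex.I) • conjS g t := by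
    rw [← integral_smul, ← integral_add_right_eq_self _ x]
    congr 1
    funext t
    rw [compSubConstCLM_apply, add_sub_cancel_right, smul_smul, ← Complex.exp_add, inner_add_left]
    congr 2
    push_cast
    ring
  rw [h1, norm_smul, Complex.norm_exp_ofReal_mul_I, one_mul]

/-- A seminorm controlling the decay of the coefficients. -/
noncomputable def decaySeminorm (N : ℕ) (f : 𝓢(Eucl d, ℂ)) : ℝ :=
  supSeminorm (Finset.Iic (N, 0)) f + supSeminorm (Finset.Iic (N, 0)) (𝓕⁻ f)

theorem decaySeminorm_nonneg (N : ℕ) (f : 𝓢(Eucl d, ℂ)) : 0 ≤ decaySeminorm N f :=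
  add_nonneg (apply_nonneg _ _) (apply_nonneg _ _)

/-- The coefficients of a Schwartz function decay rapidly in phase space. -/
theorem exists_norm_dualStft_le (g : 𝓢(Eucl d, ℂ)) (N : ℕ) :
    ∃ C : ℝ, 0 ≤ C ∧ ∀ (f : 𝓢(Eucl d, ℂ)) (z : Eucl d × Eucl d),
      ‖dualStft g f z‖ ≤ C * decaySeminorm (2 * N) f * (phaseWeight z ^ N)⁻¹ := by
  obtain ⟨C₁, hC₁, h₁⟩ := exists_integral_norm_mul_translate_le g (2 * N)
  obtain ⟨C₂, hC₂, h₂⟩ := exists_integral_norm_mul_translate_le (𝓕 g) (2 * N)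
  refine ⟨C₁ + C₂, by positivity, fun f z => ?_⟩
  set S := decaySeminorm (2 * N) f with hS
  have hS1 : supSeminorm (Finset.Iic (2 * N, 0)) f ≤ S := le_add_of_nonneg_right (apply_nonneg _ _)
  have hS2 : supSeminorm (Finset.Iic (2 * N, 0)) (𝓕⁻ f) ≤ S :=
    le_add_of_nonneg_left (apply_nonneg _ _)
  have hS0 : 0 ≤ S := decaySeminorm_nonneg _ _
  have hx : ‖dualStft g f z‖ ≤ (C₁ + C₂) * S * ((1 + ‖z.1‖) ^ (2 * N))⁻¹ := by
    refine (norm_integral_le_integral_norm _).trans ?_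
    have e : ∀ t, ‖f t * (starRingEnd ℂ) (stftAtom g z.1 z.2 t)‖ = ‖f t‖ * ‖g (t - z.1)‖ := by
      intro t
      rw [norm_mul, RCLike.norm_conj, stftAtom_apply, norm_mul, RCLike.norm_conj, Complex.norm_exp]
      simp
    simp_rw [e]
    refine (h₁ f z.1).trans ?_
    gcongr
    exact le_add_of_nonneg_right hC₂
  have hy : ‖dualStft g f z‖ ≤ (C₁ + C₂) * S * ((1 + ‖z.2‖) ^ (2 * N))⁻¹ := by
    -- Parseval moves the pairing to the frequency side, where `y` becomes a translation parameter.
    have hpars : dualStft g f z = ∫ ξ, 𝓕⁻ f ξ * 𝓕 (stftAtom (conjS g) z.1 (-z.2)) ξ := by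
      have h3 := integral_fourier_mul_eq_of_integrable (f := ⇑(𝓕⁻ f : 𝓢(Eucl d, ℂ)))
        (g := ⇑(stftAtom (conjS g) z.1 (-z.2))) (SchwartzMap.integrable _) (SchwartzMap.integrable _)
      rw [← SchwartzMap.fourier_coe, ← SchwartzMap.fourier_coe,
        FourierTransform.fourier_fourierInv_eq] at h3
      rw [← h3]
      simp_rw [dualStft, conj_stftAtom]
    rw [hpars]
    refine (norm_integral_le_integral_norm _).trans ?_
    have e : ∀ ξ, ‖𝓕⁻ f ξ * 𝓕 (stftAtom (conjS g) z.1 (-z.2)) ξ‖ =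
        ‖𝓕⁻ f ξ‖ * ‖𝓕 g (ξ - z.2)‖ := by
      intro ξ
      rw [norm_mul, fourier_stftAtom_apply, ← sub_eq_add_neg]
      congr 4
      ext t
      simp [conjS_apply]
    simp_rw [e]
    refine (h₂ _ z.2).trans ?_
    gcongr
    exact le_add_of_nonneg_left hC₁
  have hx0 : 0 < (1 + ‖z.1‖) ^ N := by positivity
  have hy0 : 0 < (1 + ‖z.2‖) ^ N := by positivity
  have hA0 : 0 ≤ (C₁ + C₂) * S := by positivity
  -- The geometric mean of the bounds in `x` and in `y` decays in both variables; this is why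
  -- exponents `2 * N` were used.
  refine abs_le_of_sq_le_sq' ?_ (by have := phaseWeight_pos z; positivity) |>.2
  calc ‖dualStft g f z‖ ^ 2 = ‖dualStft g f z‖ * ‖dualStft g f z‖ := sq _
    _ ≤ ((C₁ + C₂) * S * ((1 + ‖z.1‖) ^ (2 * N))⁻¹) * ((C₁ + C₂) * S * ((1 + ‖z.2‖) ^ (2 * N))⁻¹) := by
      gcongr
    _ = _ := by
      rw [phaseWeight, mul_pow (1 + ‖z.1‖), mul_inv, pow_mul', pow_mul']
      ring

theorem integrable_phaseWeight_inv : ∃ N : ℕ, Integrable fun z : Eucl d × Eucl d =>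
    (phaseWeight z ^ N)⁻¹ := by
  refine ⟨d + 1, ?_⟩
  have h : Integrable fun x : Eucl d => ((1 + ‖x‖) ^ (d + 1))⁻¹ := by
    have := integrable_one_add_norm (E := Eucl d) (μ := volume) (r := d + 1) (by simp)
    refine this.congr (Filter.Eventually.of_forall fun x => ?_)
    have h0 : 0 < 1 + ‖x‖ := by positivity
    simp only
    rw [Real.rpow_neg h0.le, ← Real.rpow_natCast]
    push_cast
    rfl
  refine (h.mul_prod h).congr (Filter.Eventually.of_forall fun z => ?_)
  simp only [phaseWeight]
  rw [mul_pow, mul_inv]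

end Decay

/-! ### The inversion formula. -/

section Inversion

variable {d : ℕ}

theorem norm_stftAtom_apply (g : 𝓢(Eucl d, ℂ)) (x y t : Eucl d) :
    ‖stftAtom g x y t‖ = ‖g (t - x)‖ := by
  rw [stftAtom_apply, norm_mul, RCLike.norm_conj, Complex.norm_exp]
  simp

/-- Superpositions of time-frequency shifts with rapidly decaying coefficients. -/
theorem exists_schwartz_superposition (g : 𝓢(Eucl d, ℂ)) {a : Eucl d × Eucl d → ℂ}
    (ha : Measurable a) (hint : ∀ K : ℕ, Integrable fun z => ‖a z‖ * phaseWeight z ^ K) :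
    ∃ G : 𝓢(Eucl d, ℂ), (∀ t, G t = ∫ z, a z * stftAtom g z.1 z.2 t) ∧
      ∀ u : 𝓢'(Eucl d, ℂ), Integrable (fun z => a z * stft g u z.1 z.2) ∧
        u G = ∫ z, a z * stft g u z.1 z.2 := by
  have hF : StronglyMeasurable fun z : Eucl d × Eucl d => a z • stftAtom g z.1 z.2 :=
    ha.stronglyMeasurable.smul (stronglyMeasurable_stftAtom g)
  obtain ⟨G, hG, hu⟩ := exists_schwartz_integral (μ := volume) hF fun k n => by
    obtain ⟨C, K, hC, h⟩ := exists_supSeminorm_stftAtom_le g {(k, n)}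
    refine ⟨fun z => C * (‖a z‖ * phaseWeight z ^ K), (hint K).const_mul C, fun z => ?_⟩
    have h1 := h z
    rw [supSeminorm_singleton] at h1
    have h2 : SchwartzMap.seminorm ℝ k n (a z • stftAtom g z.1 z.2) =
        ‖a z‖ * SchwartzMap.seminorm ℝ k n (stftAtom g z.1 z.2) :=
      map_smul_eq_mul (SchwartzMap.seminorm ℂ k n) (a z) _
    rw [h2]
    calc _ ≤ ‖a z‖ * (C * phaseWeight z ^ K) := by gcongr
      _ = _ := by ring
  refine ⟨G, fun t => hG t, fun u => ?_⟩
  have e : ∀ z : Eucl d × Eucl d, u (a z • stftAtom g z.1 z.2) = a z * stft g u z.1 z.2 := fun z => by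
    rw [map_smul, smul_eq_mul]; rfl
  simpa only [e] using hu u

theorem integrable_norm_dualStft_mul (g f : 𝓢(Eucl d, ℂ)) (K : ℕ) :
    Integrable fun z => ‖dualStft g f z‖ * phaseWeight z ^ K := by
  obtain ⟨N, hN⟩ := integrable_phaseWeight_inv (d := d)
  obtain ⟨C, hC, h⟩ := exists_norm_dualStft_le g (N + K)
  refine (hN.const_mul (C * decaySeminorm (2 * (N + K)) f)).mono'
    (((measurable_dualStft g f.continuous.measurable).norm).mul
      ((continuous_phaseWeight.pow K).measurable)).aestronglyMeasurable
    (Filter.Eventually.of_forall fun z => ?_)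
  have hz := phaseWeight_pos z
  rw [Real.norm_of_nonneg (by positivity)]
  calc _ ≤ (C * decaySeminorm (2 * (N + K)) f * (phaseWeight z ^ (N + K))⁻¹) * phaseWeight z ^ K := by
        gcongr; exact h f z
    _ = _ := by rw [pow_add]; field_simp

theorem integrable_dualStft (g f : 𝓢(Eucl d, ℂ)) : Integrable (dualStft g f) := by
  have := integrable_norm_dualStft_mul g f 0
  simp only [pow_zero, mul_one] at this
  exact (integrable_norm_iff
    (measurable_dualStft g f.continuous.measurable).aestronglyMeasurable).1 this

/-- At fixed `x` the coefficients are an inverse Fourier transform in `y`; through this, Fourier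
inversion and Fourier multipliers act slice by slice. -/
theorem dualStft_eq_fourierInv (g : 𝓢(Eucl d, ℂ)) (w : Eucl d → ℂ) (x y : Eucl d) :
    dualStft g w (x, y) = 𝓕⁻ (fun t => w t * g (t - x)) y := by
  rw [dualStft, Real.fourierInv_eq']
  congr 1
  funext t
  rw [conj_stftAtom, stftAtom_apply, conjS_apply, Complex.conj_conj, smul_eq_mul, ← mul_assoc,
    mul_comm (Complex.exp _)]
  congr 2
  rw [inner_neg_left, real_inner_comm]
  push_cast
  ring

/-- The squared `L²` norm of the window. -/
noncomputable def windowSq (g : 𝓢(Eucl d, ℂ)) : ℝ := ∫ t, ‖g t‖ ^ 2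

theorem integrable_windowSq (g : 𝓢(Eucl d, ℂ)) : Integrable fun t => ‖g t‖ ^ 2 := by
  have := (g.memLp 2 volume).integrable_norm_pow (by norm_num)
  simpa using this

theorem windowSq_pos {g : 𝓢(Eucl d, ℂ)} (hg : g ≠ 0) : 0 < windowSq g := by
  obtain ⟨t, ht⟩ : ∃ t, g t ≠ 0 := by
    by_contra! h
    exact hg (SchwartzMap.ext h)
  refine integral_pos_of_integrable_nonneg_nonzero (x := t) ?_ (integrable_windowSq g)
    (fun s => by positivity) (by simpa using ht)
  have := g.continuous
  fun_prop

/-- Fourier inversion in `y` for `ψ g(· - x)` leaves `|g(t - x)|² ψ(t)`; integrating over `x`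
produces the window constant. -/
theorem integral_dualStft_mul_stftAtom (g ψ : 𝓢(Eucl d, ℂ)) (t : Eucl d) :
    ∫ z : Eucl d × Eucl d, dualStft g ψ z * stftAtom g z.1 z.2 t = (windowSq g : ℂ) * ψ t := by
  have hint : Integrable fun z : Eucl d × Eucl d => dualStft g ψ z * stftAtom g z.1 z.2 t := by
    refine (integrable_dualStft g ψ).mul_bdd (c := SchwartzMap.seminorm ℝ 0 0 g)
      (by have := continuous_stftAtom_apply g; exact (this.comp (by fun_prop :
        Continuous fun z : Eucl d × Eucl d => (z, t))).aestronglyMeasurable)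
      (Filter.Eventually.of_forall fun z => ?_)
    rw [norm_stftAtom_apply]
    exact g.norm_le_seminorm ℝ _
  rw [Measure.volume_eq_prod, integral_prod _ hint]
  have inner_eq : ∀ x : Eucl d, ∫ y, dualStft g ψ (x, y) * stftAtom g x y t =
      ((‖g (t - x)‖ ^ 2 : ℝ) : ℂ) * ψ t := by
    intro x
    set h : 𝓢(Eucl d, ℂ) := smulLeftCLM ℂ ψ (compSubConstCLM ℂ x g) with hh
    have happ : ∀ s, h s = ψ s * g (s - x) := fun s => by
      rw [hh, smulLeftCLM_apply_apply ψ.hasTemperateGrowth]; rfl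
    have h1 : ∀ y, dualStft g ψ (x, y) = 𝓕⁻ h y := fun y => by
      rw [dualStft_eq_fourierInv, SchwartzMap.fourierInv_coe,
        show (⇑h : Eucl d → ℂ) = fun t => ψ t * g (t - x) from funext happ]
    have h2 : 𝓕 (𝓕⁻ h) t = h t := by rw [FourierTransform.fourier_fourierInv_eq]
    rw [SchwartzMap.fourier_coe, Real.fourier_eq'] at h2
    calc ∫ y, dualStft g ψ (x, y) * stftAtom g x y t
        = ∫ y, (starRingEnd ℂ) (g (t - x)) *
            (Complex.exp (↑(-2 * Real.pi * inner ℝ y t) * Complex.I) • 𝓕⁻ h y) := by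
          congr 1
          funext y
          rw [h1, stftAtom_apply, smul_eq_mul, mul_comm, mul_assoc]
          congr 3
          push_cast
          ring
      _ = (starRingEnd ℂ) (g (t - x)) * h t := by rw [integral_const_mul, h2]
      _ = _ := by
          rw [happ, mul_left_comm, mul_comm, mul_comm _ (g (t - x)), Complex.mul_conj', Complex.ofReal_pow]
  simp_rw [inner_eq]
  rw [integral_mul_const, integral_complex_ofReal]
  congr 2
  exact integral_sub_left_eq_self (fun s => ‖g s‖ ^ 2) volume t

/-- The inversion formula of the short-time Fourier transform. -/
theorem stft_inversion (g ψ : 𝓢(Eucl d, ℂ)) (u : 𝓢'(Eucl d, ℂ)) :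
    Integrable (fun z => dualStft g ψ z * stft g u z.1 z.2) ∧
      ∫ z : Eucl d × Eucl d, dualStft g ψ z * stft g u z.1 z.2 = (windowSq g : ℂ) * u ψ := by
  obtain ⟨G, hG, hu⟩ := exists_schwartz_superposition g
    (measurable_dualStft g ψ.continuous.measurable) (integrable_norm_dualStft_mul g ψ)
  have e : G = (windowSq g : ℂ) • ψ := by
    ext t
    rw [hG, integral_dualStft_mul_stftAtom]
    rfl
  refine ⟨(hu u).1, ?_⟩
  rw [← (hu u).2, e, map_smul, smul_eq_mul]

/-- Tempered distributions with the same short-time Fourier transform are equal. -/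
theorem eq_of_stft_eq {g : 𝓢(Eucl d, ℂ)} (hg : g ≠ 0) {u v : 𝓢'(Eucl d, ℂ)}
    (h : ∀ᵐ z : Eucl d × Eucl d, stft g u z.1 z.2 = stft g v z.1 z.2) : u = v := by
  ext ψ
  have hg' : (windowSq g : ℂ) ≠ 0 := by exact_mod_cast (windowSq_pos hg).ne'
  refine mul_left_cancel₀ hg' ?_
  rw [← (stft_inversion g ψ u).2, ← (stft_inversion g ψ v).2]
  refine integral_congr_ae ?_
  filter_upwards [h] with z hz
  rw [hz]

theorem hasCompactSupport_stftAtom {g : 𝓢(Eucl d, ℂ)} (hg : HasCompactSupport g) (x y : Eucl d) :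
    HasCompactSupport (stftAtom g x y) := by
  have h1 : HasCompactSupport fun t => g (t - x) :=
    hg.comp_homeomorph (Homeomorph.subRight x)
  refine h1.mono fun t ht => ?_
  rw [Function.mem_support, ← norm_pos_iff, norm_stftAtom_apply, norm_pos_iff] at ht
  exact ht

/-- Tempered distributions agreeing on test functions are equal. -/
theorem eq_of_eq_on_testFunctions {u v : 𝓢'(Eucl d, ℂ)}
    (h : ∀ ψ : 𝓢(Eucl d, ℂ), HasCompactSupport ψ → u ψ = v ψ) : u = v := by
  obtain ⟨χ, h1, hc⟩ := exists_schwartz_eq_one (d := d)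
  have hχ : χ ≠ 0 := by
    rintro rfl
    simp at h1
  exact eq_of_stft_eq hχ (Filter.Eventually.of_forall fun z =>
    h _ (hasCompactSupport_stftAtom hc z.1 z.2))

theorem IsGivenBy.unique {u v : 𝓢'(Eucl d, ℂ)} {f : Eucl d → ℂ} (hu : IsGivenBy u f)
    (hv : IsGivenBy v f) : u = v :=
  eq_of_eq_on_testFunctions fun ψ hψ => by rw [hu.2 ψ hψ, hv.2 ψ hψ]

end Inversion

/-! ### Change of window. -/

section WindowChange

variable {d : ℕ}

instance : (volume : Measure (Eucl d × Eucl d)).IsAddHaarMeasure :=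
  Measure.prod.instIsAddHaarMeasure volume volume

instance : (volume : Measure (Eucl d × Eucl d)).IsNegInvariant :=
  Measure.IsAddHaarMeasure.isNegInvariant_of_regular _

/-- Covariance of the short-time Fourier transform under time-frequency shifts. -/
theorem norm_dualStft_stftAtom (g g' : 𝓢(Eucl d, ℂ)) (z z' : Eucl d × Eucl d) :
    ‖dualStft g (stftAtom g' z'.1 z'.2) z‖ = ‖dualStft g (conjS g') (z - z')‖ := by
  have e : dualStft g (stftAtom g' z'.1 z'.2) z =
      Complex.exp (↑(2 * Real.pi * inner ℝ (z.2 - z'.2) z'.1) * Complex.I) *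
        dualStft g (conjS g') (z - z') := by
    rw [dualStft, dualStft, ← integral_const_mul, ← integral_add_right_eq_self _ z'.1]
    congr 1
    funext t
    rw [conj_stftAtom, conj_stftAtom, stftAtom_apply, stftAtom_apply, stftAtom_apply, conjS_apply,
      conjS_apply, conjS_apply, Complex.conj_conj, Complex.conj_conj, add_sub_cancel_right,
      show t + z'.1 - z.1 = t - (z - z').1 by rw [Prod.fst_sub]; abel]
    have : Complex.exp (-(2 * Real.pi * Complex.I) * (inner ℝ z'.2 (t + z'.1) : ℝ)) *
        Complex.exp (-(2 * Real.pi * Complex.I) * (inner ℝ (-z.2) (t + z'.1) : ℝ)) =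
        Complex.exp (↑(2 * Real.pi * inner ℝ (z.2 - z'.2) z'.1) * Complex.I) *
        Complex.exp (-(2 * Real.pi * Complex.I) * (inner ℝ (-(z - z').2) t : ℝ)) := by
      rw [← Complex.exp_add, ← Complex.exp_add, Prod.snd_sub]
      congr 1
      simp only [inner_add_right, inner_neg_left, inner_sub_left]
      push_cast
      ring
    linear_combination (starRingEnd ℂ) (g' t) * g (t - (z - z').1) * this
  rw [e, norm_mul, Complex.norm_exp_ofReal_mul_I, one_mul]

/-- The convolution kernel dominating a change of windows. -/
noncomputable def windowKernel (g g' : 𝓢(Eucl d, ℂ)) (z : Eucl d × Eucl d) : ℝ≥0∞ :=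
  ‖dualStft g (conjS g') (-z)‖ₑ

theorem measurable_windowKernel (g g' : 𝓢(Eucl d, ℂ)) : Measurable (windowKernel g g') :=
  ((measurable_dualStft g (conjS g').continuous.measurable).comp measurable_neg).enorm

theorem enorm_dualStft_stftAtom (g g' : 𝓢(Eucl d, ℂ)) (z z' : Eucl d × Eucl d) :
    ‖dualStft g (stftAtom g' z'.1 z'.2) z‖ₑ = windowKernel g g' (z' - z) := by
  rw [windowKernel, neg_sub, ← ofReal_norm, norm_dualStft_stftAtom, ofReal_norm]

theorem lintegral_windowKernel_lt_top (g g' : 𝓢(Eucl d, ℂ)) : ∫⁻ z, windowKernel g g' z < ∞ := by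
  exact (integrable_dualStft g (conjS g')).comp_neg.2

/-- The `p`-th power of the `L^p` norm of the short-time Fourier transform on phase space. -/
noncomputable def stftLpPow (g : 𝓢(Eucl d, ℂ)) (p : ℝ) (u : 𝓢'(Eucl d, ℂ)) : ℝ≥0∞ :=
  ∫⁻ z : Eucl d × Eucl d, ‖stft g u z.1 z.2‖ₑ ^ p

/-- With equal exponents the inner root cancels and Tonelli merges the mixed norm into one integral
over phase space. -/
theorem modulationNorm_eq (g : 𝓢(Eucl d, ℂ)) {p : ℝ≥0∞} (h0 : p ≠ 0) (ht : p ≠ ∞)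
    (u : 𝓢'(Eucl d, ℂ)) :
    modulationNorm g p p u = stftLpPow g p.toReal u ^ (1 / p.toReal) := by
  have hp : 0 < p.toReal := ENNReal.toReal_pos h0 ht
  rw [modulationNorm, eLpNorm_eq_lintegral_rpow_enorm_toReal h0 ht, stftLpPow, Measure.volume_eq_prod,
    lintegral_prod_symm' _ (((measurable_stft g u).enorm).pow_const _)]
  congr 1
  refine lintegral_congr fun y => ?_
  rw [eLpNorm_eq_lintegral_rpow_enorm_toReal h0 ht, enorm_eq_self, ← ENNReal.rpow_mul,
    one_div_mul_cancel hp.ne', ENNReal.rpow_one]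

/-- Changing the window is a bounded operation. -/
theorem exists_stftLpPow_le {g : 𝓢(Eucl d, ℂ)} (hg : g ≠ 0) (g' : 𝓢(Eucl d, ℂ)) {p : ℝ}
    (hp : 1 < p) : ∃ C : ℝ≥0, ∀ u, stftLpPow g' p u ≤ C * stftLpPow g p u := by
  set c := windowSq g with hc
  have hc0 : 0 < c := windowSq_pos hg
  have hp0 : 0 < p := by linarith
  set I := ∫⁻ z, windowKernel g g' z with hI
  have hIt : I ≠ ∞ := (lintegral_windowKernel_lt_top g g').ne
  have hct : ENNReal.ofReal c ≠ 0 := by simpa using hc0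
  refine ⟨(ENNReal.ofReal c ^ (-p) * I ^ p).toNNReal, fun u => ?_⟩
  have hfin : ENNReal.ofReal c ^ (-p) * I ^ p ≠ ∞ :=
    ENNReal.mul_ne_top (by rw [ENNReal.rpow_neg]; simp [hc0])
      (ENNReal.rpow_ne_top_of_nonneg hp0.le hIt)
  rw [ENNReal.coe_toNNReal hfin]
  -- Inversion applied to an atom with the new window dominates the new transform by a convolution
  -- of the old one with an integrable kernel; Young finishes.
  have hpt : ∀ z' : Eucl d × Eucl d, ENNReal.ofReal c * ‖stft g' u z'.1 z'.2‖ₑ ≤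
      ∫⁻ z, ‖stft g u z.1 z.2‖ₑ * windowKernel g g' (z' - z) := by
    intro z'
    have h1 := (stft_inversion g (stftAtom g' z'.1 z'.2) u).2
    have h2 : ENNReal.ofReal c * ‖stft g' u z'.1 z'.2‖ₑ =
        ‖(windowSq g : ℂ) * u (stftAtom g' z'.1 z'.2)‖ₑ := by
      rw [enorm_mul, ← hc]
      congr 1
      rw [← ofReal_norm, Complex.norm_real, Real.norm_of_nonneg hc0.le]
    rw [h2, ← h1]
    refine (enorm_integral_le_lintegral_enorm _).trans_eq (lintegral_congr fun z => ?_)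
    rw [enorm_mul, enorm_dualStft_stftAtom, mul_comm]
  have hY := lintegral_conv_rpow_le (μ := (volume : Measure (Eucl d × Eucl d)))
    (measurable_stft g u).enorm (measurable_windowKernel g g') hp
  calc stftLpPow g' p u
      = ENNReal.ofReal c ^ (-p) * ∫⁻ z' : Eucl d × Eucl d,
          (ENNReal.ofReal c * ‖stft g' u z'.1 z'.2‖ₑ) ^ p := by
        simp_rw [ENNReal.mul_rpow_of_nonneg _ _ hp0.le]
        rw [lintegral_const_mul _ (((measurable_stft g' u).enorm).pow_const _), ← mul_assoc,
          ← ENNReal.rpow_add _ _ hct ENNReal.ofReal_ne_top, neg_add_cancel, ENNReal.rpow_zero,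
          one_mul]
        rfl
    _ ≤ ENNReal.ofReal c ^ (-p) * (I ^ p * stftLpPow g p u) := by
        gcongr
        refine le_trans (lintegral_mono fun z' => ?_) hY
        exact ENNReal.rpow_le_rpow (hpt z') hp0.le
    _ = _ := by rw [mul_assoc]

end WindowChange

/-! ### Duality on phase space. -/

section Duality

variable {d : ℕ}

theorem measure_phaseWeight_le_lt_top (R : ℝ) :
    volume {z : Eucl d × Eucl d | phaseWeight z ≤ R} < ∞ := by
  refine lt_of_le_of_lt (measure_mono (t := Metric.closedBall 0 R) fun z hz => ?_)
    measure_closedBall_lt_top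
  have hz' : (1 + ‖z.1‖) * (1 + ‖z.2‖) ≤ R := hz
  rw [mem_closedBall_zero_iff, Prod.norm_def, max_le_iff]
  constructor <;> nlinarith [norm_nonneg z.1, norm_nonneg z.2,
    mul_nonneg (norm_nonneg z.1) (norm_nonneg z.2)]

theorem measurableSet_phaseWeight_le (R : ℝ) :
    MeasurableSet {z : Eucl d × Eucl d | phaseWeight z ≤ R} :=
  measurableSet_le continuous_phaseWeight.measurable measurable_const

theorem integrable_norm_mul_phaseWeight_pow {F : Eucl d × Eucl d → ℂ} (hF : Measurable F) {B R : ℝ}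
    (hB : ∀ z, ‖F z‖ ≤ B) (hR : ∀ z, R < phaseWeight z → F z = 0) (K : ℕ) :
    Integrable fun z => ‖F z‖ * phaseWeight z ^ K := by
  set S := {z : Eucl d × Eucl d | phaseWeight z ≤ R} with hS
  have hSm : MeasurableSet S := measurableSet_phaseWeight_le R
  have : Integrable (S.indicator fun _ => B * R ^ K) := by
    rw [integrable_indicator_iff hSm]
    exact integrableOn_const (measure_phaseWeight_le_lt_top R).ne
  refine this.mono' ((hF.norm.mul (continuous_phaseWeight.pow K).measurable).aestronglyMeasurable)
    (Filter.Eventually.of_forall fun z => ?_)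
  have hz := phaseWeight_pos z
  rw [Real.norm_of_nonneg (by positivity)]
  by_cases hzS : z ∈ S
  · rw [Set.indicator_of_mem hzS]
    have h1 : phaseWeight z ≤ R := hzS
    have h2 : 0 ≤ B := (norm_nonneg _).trans (hB z)
    gcongr
    exact hB z
  · rw [Set.indicator_of_notMem hzS, hR z (not_le.1 hzS)]
    simp

/-- `L^p` bounds by duality against bounded functions of bounded support. -/
theorem lintegral_rpow_le_of_pairing_le {G : Eucl d × Eucl d → ℂ} (hG : Measurable G) {p q : ℝ}
    (hpq : p.HolderConjugate q) {M : ℝ≥0∞}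
    (h : ∀ F : Eucl d × Eucl d → ℂ, Measurable F →
      (∀ K : ℕ, Integrable fun z => ‖F z‖ * phaseWeight z ^ K) →
      ‖∫ z, F z * G z‖ₑ ≤ M * (∫⁻ z, ‖F z‖ₑ ^ q) ^ (1 / q)) :
    ∫⁻ z, ‖G z‖ₑ ^ p ≤ M ^ p := by
  have hp0 : 0 < p := hpq.pos
  have hq0 : 0 < q := hpq.symm.pos
  -- The bound on `phaseWeight` makes the extremal test function supported in a set of finite
  -- measure and integrable against every polynomial weight, as the hypothesis `h` demands.
  set E : ℕ → Set (Eucl d × Eucl d) := fun n =>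
    {z | (1 / ((n : ℝ) + 1) < ‖G z‖ ∧ ‖G z‖ ≤ n) ∧ phaseWeight z ≤ n} with hE
  have hEm : ∀ n, MeasurableSet (E n) := fun n =>
    ((measurableSet_lt measurable_const hG.norm).inter
      (measurableSet_le hG.norm measurable_const)).inter (measurableSet_phaseWeight_le n)
  have key : ∀ n, ∫⁻ z in E n, ‖G z‖ₑ ^ p ≤ M ^ p := by
    intro n
    set F : Eucl d × Eucl d → ℂ :=
      (E n).indicator fun z => ((‖G z‖ ^ (p - 2) : ℝ) : ℂ) * (starRingEnd ℂ) (G z) with hF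
    have hFm : Measurable F := by
      refine Measurable.indicator ?_ (hEm n)
      exact (Complex.measurable_ofReal.comp (hG.norm.pow_const _)).mul
        (Complex.continuous_conj.measurable.comp hG)
    have hnorm : ∀ z ∈ E n, ‖F z‖ = ‖G z‖ ^ (p - 1) := by
      intro z hz
      have hz0 : 0 < ‖G z‖ := lt_trans (by positivity) hz.1.1
      rw [hF, Set.indicator_of_mem hz, norm_mul, Complex.norm_real,
        Real.norm_of_nonneg (by positivity), RCLike.norm_conj]
      conv_lhs => rw [← Real.rpow_one ‖G z‖, ← Real.rpow_mul hz0.le, one_mul]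
      rw [← Real.rpow_add hz0]
      congr 1; ring
    have hFi : ∀ K : ℕ, Integrable fun z => ‖F z‖ * phaseWeight z ^ K := by
      refine integrable_norm_mul_phaseWeight_pow hFm (B := (n : ℝ) ^ (p - 1)) (R := n)
        (fun z => ?_) (fun z hz => ?_)
      · by_cases hzE : z ∈ E n
        · rw [hnorm z hzE]
          exact Real.rpow_le_rpow (norm_nonneg _) hzE.1.2 (by linarith [hpq.lt])
        · rw [hF, Set.indicator_of_notMem hzE, norm_zero]
          positivity
      · exact Set.indicator_of_notMem (fun hzE => absurd hzE.2 (not_le.2 hz)) _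
    have hFq : ∫⁻ z, ‖F z‖ₑ ^ q = ∫⁻ z in E n, ‖G z‖ₑ ^ p := by
      rw [← lintegral_indicator (hEm n)]
      refine lintegral_congr fun z => ?_
      by_cases hzE : z ∈ E n
      · rw [Set.indicator_of_mem hzE, ← ofReal_rpow_eq_enorm_rpow _ hq0.le, hnorm z hzE,
          ← Real.rpow_mul (norm_nonneg _), hpq.sub_one_mul_conj, ofReal_rpow_eq_enorm_rpow _ hp0.le]
      · rw [Set.indicator_of_notMem hzE, hF, Set.indicator_of_notMem hzE]
        simp [hq0]
    have hFG : ∀ z, F z * G z = (((E n).indicator (fun z => ‖G z‖ ^ p) z : ℝ) : ℂ) := by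
      intro z
      by_cases hzE : z ∈ E n
      · have hz0 : 0 < ‖G z‖ := lt_trans (by positivity) hzE.1.1
        rw [Set.indicator_of_mem hzE, hF, Set.indicator_of_mem hzE, mul_assoc,
          mul_comm ((starRingEnd ℂ) _), Complex.mul_conj', ← Complex.ofReal_pow,
          ← Complex.ofReal_mul]
        congr 1
        rw [← Real.rpow_natCast, ← Real.rpow_add hz0]
        congr 1; push_cast; ring
      · rw [Set.indicator_of_notMem hzE, hF, Set.indicator_of_notMem hzE]
        simp
    have hEfin : volume (E n) < ∞ :=
      lt_of_le_of_lt (measure_mono fun z hz => hz.2) (measure_phaseWeight_le_lt_top (d := d) n)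
    have hint : Integrable ((E n).indicator fun z => ‖G z‖ ^ p) := by
      rw [integrable_indicator_iff (hEm n)]
      refine Measure.integrableOn_of_bounded (M := (n : ℝ) ^ p) hEfin.ne
        (hG.norm.pow_const _).aestronglyMeasurable
        ((ae_restrict_iff' (hEm n)).2 (Filter.Eventually.of_forall fun z hz => ?_))
      rw [Real.norm_of_nonneg (by positivity)]
      exact Real.rpow_le_rpow (norm_nonneg _) hz.1.2 hp0.le
    set X := ∫⁻ z in E n, ‖G z‖ₑ ^ p with hX
    have hXeq : X = ‖∫ z, F z * G z‖ₑ := by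
      simp_rw [hFG]
      rw [integral_complex_ofReal, ← ofReal_norm,
        Complex.norm_real, Real.norm_of_nonneg, ofReal_integral_eq_lintegral_ofReal hint, hX,
        ← lintegral_indicator (hEm n)]
      · refine lintegral_congr fun x => ?_
        by_cases hxE : x ∈ E n
        · rw [Set.indicator_of_mem hxE, Set.indicator_of_mem hxE, ofReal_rpow_eq_enorm_rpow _ hp0.le]
        · rw [Set.indicator_of_notMem hxE, Set.indicator_of_notMem hxE, ENNReal.ofReal_zero]
      · exact Filter.Eventually.of_forall fun x =>
          Set.indicator_nonneg (fun x _ => Real.rpow_nonneg (norm_nonneg _) _) x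
      · exact integral_nonneg fun x =>
          Set.indicator_nonneg (fun x _ => Real.rpow_nonneg (norm_nonneg _) _) x
    have hXtop : X ≠ ∞ := by rw [hXeq]; exact enorm_ne_top
    have hle : X ≤ M * X ^ (1 / q) := by
      conv_lhs => rw [hXeq]
      rw [← hFq]
      exact h F hFm hFi
    rcases eq_or_ne X 0 with h0 | h0
    · rw [h0]; exact zero_le
    have h1 : X ^ (1 / p) ≤ M := by
      have hXq0 : X ^ (1 / q) ≠ 0 := by simp [h0, hXtop]
      have hXqt : X ^ (1 / q) ≠ ∞ := by simp [h0, hXtop]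
      have hsplit : X = X ^ (1 / q) * X ^ (1 / p) := by
        rw [← ENNReal.rpow_add _ _ h0 hXtop]
        have : 1 / q + 1 / p = 1 := by simpa using hpq.symm.inv_add_inv_eq_one
        rw [this, ENNReal.rpow_one]
      refine (ENNReal.mul_le_mul_iff_right hXq0 hXqt).1 ?_
      calc X ^ (1 / q) * X ^ (1 / p) = X := hsplit.symm
        _ ≤ _ := hle
        _ = _ := mul_comm _ _
    calc X = (X ^ (1 / p)) ^ p := by
          rw [← ENNReal.rpow_mul, one_div_mul_cancel hp0.ne', ENNReal.rpow_one]
      _ ≤ M ^ p := by gcongr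
  have hmono : Monotone E := by
    intro a b hab x hx
    have hab' : (a : ℝ) ≤ b := by exact_mod_cast hab
    exact ⟨⟨lt_of_le_of_lt (one_div_le_one_div_of_le (by positivity) (by linarith)) hx.1.1,
      hx.1.2.trans hab'⟩, le_trans hx.2 hab'⟩
  have hsup : ∫⁻ z, ‖G z‖ₑ ^ p = ⨆ n, ∫⁻ z in E n, ‖G z‖ₑ ^ p := by
    rw [← setLIntegral_iUnion_of_directed _ hmono.directed_le, ← lintegral_indicator
      (MeasurableSet.iUnion hEm)]
    refine lintegral_congr fun x => ?_
    by_cases hx : x ∈ ⋃ n, E n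
    · rw [Set.indicator_of_mem hx]
    · rw [Set.indicator_of_notMem hx]
      have : G x = 0 := by
        by_contra hne
        have hpos : 0 < ‖G x‖ := norm_pos_iff.2 hne
        obtain ⟨a, ha⟩ := exists_nat_one_div_lt hpos
        obtain ⟨b, hb⟩ := exists_nat_ge (max ‖G x‖ (phaseWeight x))
        have hb' : ((b : ℕ) : ℝ) ≤ (max a b : ℕ) := by exact_mod_cast le_max_right a b
        refine hx (Set.mem_iUnion.2 ⟨max a b, ⟨?_, ((le_max_left _ _).trans hb).trans hb'⟩,
          ((le_max_right _ _).trans hb).trans hb'⟩)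
        refine lt_of_le_of_lt (one_div_le_one_div_of_le (by positivity) ?_) ha
        have : (a : ℝ) ≤ (max a b : ℕ) := by exact_mod_cast le_max_left a b
        linarith
      rw [this]
      simp [hp0]
  rw [hsup]
  exact iSup_le key

end Duality

/-! ### Truncation of Schwartz functions. -/

section Restriction

variable {d : ℕ}

/-- The indicator function of `Q` multiplies, on the Fourier side, every `L^p` with
`1 < p < ∞`. -/
structure IsMultiplierSet (Q : Set (Eucl d)) : Prop where
  measurableSet : MeasurableSet Q
  exists_bound : ∀ p : ℝ, 1 < p → ∃ C : ℝ≥0, ∀ h : Eucl d → ℂ, Integrable h → MemLp h 2 →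
    ∫⁻ y, ‖𝓕 (Q.indicator h) y‖ₑ ^ p ≤ C * ∫⁻ y, ‖𝓕 h y‖ₑ ^ p

theorem IsHalfSpace.isMultiplierSet {v : Eucl d} {H : Set (Eucl d)} (hH : IsHalfSpace v H) :
    IsMultiplierSet H :=
  ⟨hH.measurableSet, fun _ hp => exists_lintegral_fourier_indicator_le hH hp⟩

theorem isMultiplierSet_univ : IsMultiplierSet (Set.univ : Set (Eucl d)) :=
  ⟨MeasurableSet.univ, fun p _ => ⟨1, fun h _ _ => by simp⟩⟩

/-- Two truncations in succession. The bounds compose because truncation preserves `L¹ ∩ L²`. -/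
theorem IsMultiplierSet.inter {Q R : Set (Eucl d)} (hQ : IsMultiplierSet Q)
    (hR : IsMultiplierSet R) : IsMultiplierSet (Q ∩ R) := by
  refine ⟨hQ.measurableSet.inter hR.measurableSet, fun p hp => ?_⟩
  obtain ⟨C, hC⟩ := hQ.exists_bound p hp
  obtain ⟨D, hD⟩ := hR.exists_bound p hp
  refine ⟨C * D, fun h h1 h2 => ?_⟩
  rw [← Set.indicator_indicator]
  refine (hC _ (h1.indicator hR.measurableSet) (h2.indicator hR.measurableSet)).trans ?_
  rw [ENNReal.coe_mul, mul_assoc]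
  gcongr
  exact hD h h1 h2

/-- For each `x` the slice in `y` is, up to reflection, the Fourier transform of `Q.indicator h`
with `h = f g(· - x)`. The multiplier bound holds with a constant independent of `x`, so it
integrates over `x`. -/
theorem IsMultiplierSet.exists_lintegral_dualStft_indicator_le {Q : Set (Eucl d)}
    (hQ : IsMultiplierSet Q) (g : 𝓢(Eucl d, ℂ)) {q : ℝ} (hq : 1 < q) :
    ∃ C : ℝ≥0, ∀ f : 𝓢(Eucl d, ℂ), ∫⁻ z, ‖dualStft g (Q.indicator f) z‖ₑ ^ q ≤
      C * ∫⁻ z, ‖dualStft g f z‖ₑ ^ q := by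
  obtain ⟨C, hC⟩ := hQ.exists_bound q hq
  refine ⟨C, fun f => ?_⟩
  have hm1 := (measurable_dualStft g (f.continuous.measurable.indicator hQ.measurableSet)).enorm.pow_const q
  have hm2 := (measurable_dualStft g f.continuous.measurable).enorm.pow_const q
  rw [Measure.volume_eq_prod, lintegral_prod _ hm1.aemeasurable, lintegral_prod _ hm2.aemeasurable,
    ← lintegral_const_mul _ hm2.lintegral_prod_right']
  refine lintegral_mono fun x => ?_
  set h : 𝓢(Eucl d, ℂ) := smulLeftCLM ℂ f (compSubConstCLM ℂ x g) with hh
  have happ : ∀ s, h s = f s * g (s - x) := fun s => by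
    rw [hh, smulLeftCLM_apply_apply f.hasTemperateGrowth]; rfl
  have h1 := hC h h.integrable (h.memLp 2 volume)
  have e1 : ∀ y, dualStft g (Q.indicator f) (x, y) = 𝓕 (Q.indicator h) (-y) := by
    intro y
    rw [dualStft_eq_fourierInv, Real.fourierInv_eq_fourier_neg]
    have : (fun t => Q.indicator (⇑f) t * g (t - x)) = Q.indicator ⇑h := by
      funext s
      by_cases hs : s ∈ Q
      · rw [Set.indicator_of_mem hs, Set.indicator_of_mem hs, happ]
      · rw [Set.indicator_of_notMem hs, Set.indicator_of_notMem hs, zero_mul]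
    rw [this]
  have e2 : ∀ y, dualStft g f (x, y) = 𝓕 (h : Eucl d → ℂ) (-y) := by
    intro y
    rw [dualStft_eq_fourierInv, Real.fourierInv_eq_fourier_neg,
      show (⇑h : Eucl d → ℂ) = fun t => f t * g (t - x) from funext happ]
  simp_rw [e1, e2]
  rw [lintegral_neg_eq_self (fun y => ‖𝓕 (Q.indicator h) y‖ₑ ^ q),
    lintegral_neg_eq_self (fun y => ‖𝓕 (h : Eucl d → ℂ) y‖ₑ ^ q)]
  exact h1

theorem integrable_mul_conj_stftAtom (g : 𝓢(Eucl d, ℂ)) {w : Eucl d → ℂ} (hw : Integrable w)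
    (z : Eucl d × Eucl d) :
    Integrable fun t => w t * (starRingEnd ℂ) (stftAtom g z.1 z.2 t) := by
  simp_rw [conj_stftAtom]
  refine hw.mul_bdd (c := SchwartzMap.seminorm ℝ 0 0 (conjS g))
    (SchwartzMap.continuous _).aestronglyMeasurable (Filter.Eventually.of_forall fun t => ?_)
  rw [norm_stftAtom_apply]
  exact (conjS g).norm_le_seminorm ℝ _

theorem dualStft_indicator_add {Q : Set (Eucl d)} (hQ : MeasurableSet Q) (g f h : 𝓢(Eucl d, ℂ))
    (z : Eucl d × Eucl d) : dualStft g (Q.indicator ⇑(f + h)) z =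
      dualStft g (Q.indicator f) z + dualStft g (Q.indicator h) z := by
  rw [dualStft, dualStft, dualStft, ← integral_add
    (integrable_mul_conj_stftAtom g (f.integrable.indicator hQ) z)
    (integrable_mul_conj_stftAtom g (h.integrable.indicator hQ) z)]
  congr 1
  funext t
  rw [show ⇑(f + h) = ⇑f + ⇑h from rfl, Set.indicator_add', Pi.add_apply, add_mul]

theorem dualStft_indicator_smul {Q : Set (Eucl d)} (g f : 𝓢(Eucl d, ℂ)) (c : ℂ)
    (z : Eucl d × Eucl d) : dualStft g (Q.indicator ⇑(c • f)) z =
      c * dualStft g (Q.indicator f) z := by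
  rw [dualStft, dualStft, ← integral_const_mul]
  congr 1
  funext t
  by_cases ht : t ∈ Q
  · rw [Set.indicator_of_mem ht, Set.indicator_of_mem ht, smul_apply, smul_eq_mul, mul_assoc]
  · rw [Set.indicator_of_notMem ht, Set.indicator_of_notMem ht, zero_mul, mul_zero]

/-- The `L^q` norm of the coefficients is a continuous seminorm on Schwartz functions. -/
theorem exists_lintegral_dualStft_le (g : 𝓢(Eucl d, ℂ)) {q : ℝ} (hq : 1 < q) :
    ∃ (s : Finset (ℕ × ℕ)) (C : ℝ), 0 ≤ C ∧ ∀ f : 𝓢(Eucl d, ℂ),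
      (∫⁻ z, ‖dualStft g f z‖ₑ ^ q) ^ (1 / q) ≤
        ENNReal.ofReal (C * s.sup (schwartzSeminormFamily ℂ (Eucl d) ℂ) f) := by
  have hq0 : 0 < q := by linarith
  obtain ⟨N, hN⟩ := integrable_phaseWeight_inv (d := d)
  obtain ⟨C, hC, h⟩ := exists_norm_dualStft_le g N
  obtain ⟨s₁, C₁, hC₁, h₁⟩ := exists_supSeminorm_fourierInv_le (d := d) (Finset.Iic (2 * N, 0))
  set s := Finset.Iic (2 * N, 0) ∪ s₁ with hs
  set J := ∫ z : Eucl d × Eucl d, (phaseWeight z ^ N)⁻¹ with hJ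
  have hJ0 : 0 ≤ J := integral_nonneg fun z => by have := phaseWeight_pos z; positivity
  refine ⟨s, C * (1 + C₁) * J ^ (1 / q), by positivity, fun f => ?_⟩
  set S := s.sup (schwartzSeminormFamily ℂ (Eucl d) ℂ) f with hS
  have hS0 : 0 ≤ S := apply_nonneg _ _
  have hsS : ∀ t ⊆ s, supSeminorm t f ≤ S := fun t ht =>
    Seminorm.finset_sup_apply_le hS0 fun i hi =>
      Seminorm.le_finset_sup_apply (p := schwartzSeminormFamily ℂ (Eucl d) ℂ) (x := f) (ht hi)
  have hdec : decaySeminorm (2 * N) f ≤ (1 + C₁) * S := by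
    rw [decaySeminorm, add_mul, one_mul]
    refine add_le_add (hsS _ Finset.subset_union_left) ((h₁ f).trans ?_)
    gcongr
    exact hsS _ Finset.subset_union_right
  have hpt : ∀ z : Eucl d × Eucl d, ‖dualStft g f z‖ₑ ^ q ≤
      ENNReal.ofReal ((C * ((1 + C₁) * S)) ^ q * (phaseWeight z ^ N)⁻¹) := by
    intro z
    have hz1 := one_le_phaseWeight z
    have hz0 := phaseWeight_pos z
    rw [← ofReal_rpow_eq_enorm_rpow _ hq0.le]
    refine ENNReal.ofReal_le_ofReal ?_
    calc ‖dualStft g f z‖ ^ q ≤ (C * ((1 + C₁) * S) * (phaseWeight z ^ N)⁻¹) ^ q := by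
          refine Real.rpow_le_rpow (norm_nonneg _) ((h f z).trans ?_) hq0.le
          gcongr
      _ = (C * ((1 + C₁) * S)) ^ q * ((phaseWeight z ^ N)⁻¹) ^ q :=
          Real.mul_rpow (by positivity) (by positivity)
      _ ≤ _ := by
          gcongr
          -- A number in `(0, 1]` only decreases when raised to a power `q ≥ 1`, so integrability of
          -- the weight itself is enough.
          calc ((phaseWeight z ^ N)⁻¹) ^ q ≤ ((phaseWeight z ^ N)⁻¹) ^ (1 : ℝ) :=
                Real.rpow_le_rpow_of_exponent_ge (by positivity)
                  (inv_le_one_of_one_le₀ (one_le_pow₀ hz1)) hq.le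
            _ = _ := Real.rpow_one _
  calc (∫⁻ z, ‖dualStft g f z‖ₑ ^ q) ^ (1 / q)
      ≤ (∫⁻ z : Eucl d × Eucl d,
          ENNReal.ofReal ((C * ((1 + C₁) * S)) ^ q * (phaseWeight z ^ N)⁻¹)) ^ (1 / q) := by
        gcongr with z
        exact hpt z
    _ = ENNReal.ofReal (((C * ((1 + C₁) * S)) ^ q * J) ^ (1 / q)) := by
        rw [← ofReal_integral_eq_lintegral_ofReal (hN.const_mul _)
          (Filter.Eventually.of_forall fun z => by have := phaseWeight_pos z; positivity),
          integral_const_mul, ENNReal.ofReal_rpow_of_nonneg (by positivity) (by positivity)]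
    _ = _ := by
        rw [Real.mul_rpow (by positivity) hJ0, ← Real.rpow_mul (by positivity),
          mul_one_div_cancel hq0.ne', Real.rpow_one]
        congr 1
        ring

end Restriction

/-! ### Truncation on modulation spaces. -/

section RestrictionOperator

variable {d : ℕ}

theorem mem_modulationSpace_iff {g : 𝓢(Eucl d, ℂ)} {p : ℝ≥0∞} (h0 : p ≠ 0) (ht : p ≠ ∞)
    {u : 𝓢'(Eucl d, ℂ)} : u ∈ modulationSpace g p p ↔ stftLpPow g p.toReal u < ∞ := by
  change modulationNorm g p p u < ∞ ↔ _
  have hp : 0 < p.toReal := ENNReal.toReal_pos h0 ht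
  rw [modulationNorm_eq g h0 ht, ENNReal.rpow_lt_top_iff_of_pos (by positivity)]

theorem modulationNorm_le_of_stftLpPow_le {g : 𝓢(Eucl d, ℂ)} {p : ℝ≥0∞} (h0 : p ≠ 0) (ht : p ≠ ∞)
    {C : ℝ≥0} {u v : 𝓢'(Eucl d, ℂ)} (h : stftLpPow g p.toReal v ≤ C * stftLpPow g p.toReal u) :
    modulationNorm g p p v ≤ (C ^ (1 / p.toReal) : ℝ≥0) * modulationNorm g p p u := by
  have hp : 0 < p.toReal := ENNReal.toReal_pos h0 ht
  rw [modulationNorm_eq g h0 ht, modulationNorm_eq g h0 ht, ENNReal.coe_rpow_of_nonneg _ (by positivity),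
    ← ENNReal.mul_rpow_of_nonneg _ _ (by positivity)]
  exact ENNReal.rpow_le_rpow h (by positivity)

/-- Hölder's inequality for the pairing of coefficients with a short-time Fourier transform. -/
theorem integrable_mul_stft_of_lt_top {g : 𝓢(Eucl d, ℂ)} {u : 𝓢'(Eucl d, ℂ)} {p q : ℝ}
    (hpq : p.HolderConjugate q) (hu : stftLpPow g p u < ∞) {F : Eucl d × Eucl d → ℂ}
    (hF : Measurable F) (hFq : ∫⁻ z, ‖F z‖ₑ ^ q < ∞) :
    Integrable (fun z => F z * stft g u z.1 z.2) ∧ ‖∫ z, F z * stft g u z.1 z.2‖ₑ ≤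
      (∫⁻ z, ‖F z‖ₑ ^ q) ^ (1 / q) * stftLpPow g p u ^ (1 / p) := by
  have h : ∫⁻ z : Eucl d × Eucl d, ‖F z * stft g u z.1 z.2‖ₑ ≤
      (∫⁻ z, ‖F z‖ₑ ^ q) ^ (1 / q) * stftLpPow g p u ^ (1 / p) := by
    simp_rw [enorm_mul]
    exact ENNReal.lintegral_mul_le_Lp_mul_Lq volume hpq.symm hF.enorm.aemeasurable
      (measurable_stft g u).enorm.aemeasurable
  refine ⟨⟨(hF.mul (measurable_stft g u)).aestronglyMeasurable, h.trans_lt ?_⟩,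
    (enorm_integral_le_lintegral_enorm _).trans h⟩
  exact ENNReal.mul_lt_top (ENNReal.rpow_lt_top_of_nonneg (by have := hpq.symm.pos; positivity) hFq.ne)
    (ENNReal.rpow_lt_top_of_nonneg (by have := hpq.pos; positivity) hu.ne)

/-- The pairing of `u` with the truncation of a Schwartz function to `Q`. -/
noncomputable def truncatedPairing (g : 𝓢(Eucl d, ℂ)) (Q : Set (Eucl d)) (u : 𝓢'(Eucl d, ℂ))
    (ψ : 𝓢(Eucl d, ℂ)) : ℂ :=
  (windowSq g : ℂ)⁻¹ * ∫ z, dualStft g (Q.indicator ψ) z * stft g u z.1 z.2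

variable {g : 𝓢(Eucl d, ℂ)} {Q : Set (Eucl d)} {p q : ℝ}

theorem integrable_dualStft_indicator_mul_stft (hQ : IsMultiplierSet Q) (hpq : p.HolderConjugate q)
    {u : 𝓢'(Eucl d, ℂ)} (hu : stftLpPow g p u < ∞) (ψ : 𝓢(Eucl d, ℂ)) :
    Integrable fun z => dualStft g (Q.indicator ψ) z * stft g u z.1 z.2 := by
  obtain ⟨C, hC⟩ := hQ.exists_lintegral_dualStft_indicator_le g hpq.symm.lt
  obtain ⟨s, D, hD, h⟩ := exists_lintegral_dualStft_le g hpq.symm.lt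
  refine (integrable_mul_stft_of_lt_top hpq hu
    (measurable_dualStft g (ψ.continuous.measurable.indicator hQ.measurableSet))
    ((hC ψ).trans_lt (ENNReal.mul_lt_top ENNReal.coe_lt_top ?_))).1
  have h1 := (h ψ).trans_lt ENNReal.ofReal_lt_top
  rwa [ENNReal.rpow_lt_top_iff_of_pos (by have := hpq.symm.pos; positivity)] at h1

/-- Hölder on phase space followed by the multiplier bound at the conjugate exponent `q`. It gives
both continuity of the truncated functional and, by duality, its modulation norm. -/
theorem exists_enorm_truncatedPairing_le (g : 𝓢(Eucl d, ℂ)) (hQ : IsMultiplierSet Q)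
    (hpq : p.HolderConjugate q) :
    ∃ C : ℝ≥0, ∀ u : 𝓢'(Eucl d, ℂ), stftLpPow g p u < ∞ → ∀ ψ,
      ‖truncatedPairing g Q u ψ‖ₑ ≤
        C * stftLpPow g p u ^ (1 / p) * (∫⁻ z, ‖dualStft g ψ z‖ₑ ^ q) ^ (1 / q) := by
  obtain ⟨C, hC⟩ := hQ.exists_lintegral_dualStft_indicator_le g hpq.symm.lt
  have hq0 := hpq.symm.pos
  refine ⟨‖(windowSq g : ℂ)⁻¹‖₊ * C ^ (1 / q), fun u hu ψ => ?_⟩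
  rw [truncatedPairing, enorm_mul]
  obtain ⟨s, D, hD, h⟩ := exists_lintegral_dualStft_le g hpq.symm.lt
  have h1 := (h ψ).trans_lt ENNReal.ofReal_lt_top
  rw [ENNReal.rpow_lt_top_iff_of_pos (by positivity)] at h1
  have h2 := (integrable_mul_stft_of_lt_top hpq hu
    (measurable_dualStft g (ψ.continuous.measurable.indicator hQ.measurableSet))
    ((hC ψ).trans_lt (ENNReal.mul_lt_top ENNReal.coe_lt_top h1))).2
  calc _ ≤ ‖(windowSq g : ℂ)⁻¹‖ₑ * ((C * ∫⁻ z, ‖dualStft g ψ z‖ₑ ^ q) ^ (1 / q) *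
        stftLpPow g p u ^ (1 / p)) := by
        gcongr
        refine h2.trans ?_
        gcongr
        exact hC ψ
    _ = _ := by
        rw [ENNReal.mul_rpow_of_nonneg _ _ (by positivity), ENNReal.coe_mul,
          ENNReal.coe_rpow_of_nonneg _ (by positivity), enorm_eq_nnnorm]
        ring

/-- Truncation to a multiplier set, as a tempered distribution. -/
theorem exists_truncation (g : 𝓢(Eucl d, ℂ)) (hQ : IsMultiplierSet Q) (hpq : p.HolderConjugate q)
    {u : 𝓢'(Eucl d, ℂ)} (hu : stftLpPow g p u < ∞) :
    ∃ v : 𝓢'(Eucl d, ℂ), ∀ ψ, v ψ = truncatedPairing g Q u ψ := by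
  obtain ⟨C, hC⟩ := exists_enorm_truncatedPairing_le g hQ hpq
  obtain ⟨s, D, hD, h⟩ := exists_lintegral_dualStft_le g hpq.symm.lt
  have hp0 := hpq.pos
  have hU : stftLpPow g p u ^ (1 / p) ≠ ∞ := (ENNReal.rpow_lt_top_of_nonneg (by positivity) hu.ne).ne
  refine ⟨ContinuousLinearMap.toPointwiseConvergenceCLM _ _ _ _ (mkCLMtoNormedSpace (𝕜 := ℂ) (𝕜' := ℂ)
    (σ := RingHom.id ℂ) (truncatedPairing g Q u) (fun f h => ?_) (fun c f => ?_)
    ⟨s, C * (stftLpPow g p u ^ (1 / p)).toReal * D, by positivity, fun f => ?_⟩), fun ψ => rfl⟩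
  · rw [truncatedPairing, truncatedPairing, truncatedPairing, ← mul_add, ← integral_add
      (integrable_dualStft_indicator_mul_stft hQ hpq hu f)
      (integrable_dualStft_indicator_mul_stft hQ hpq hu h)]
    simp_rw [dualStft_indicator_add hQ.measurableSet, add_mul]
  · rw [truncatedPairing, truncatedPairing]
    simp_rw [dualStft_indicator_smul, mul_assoc]
    rw [integral_const_mul, RingHom.id_apply, smul_eq_mul]
    ring
  · have h1 : ‖truncatedPairing g Q u f‖ₑ ≤
        ENNReal.ofReal (C * (stftLpPow g p u ^ (1 / p)).toReal *
          (D * s.sup (schwartzSeminormFamily ℂ (Eucl d) ℂ) f)) := by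
      rw [ENNReal.ofReal_mul (by positivity), ENNReal.ofReal_mul (by positivity),
        ENNReal.ofReal_toReal hU, ENNReal.ofReal_coe_nnreal]
      exact (hC u hu f).trans (by gcongr; exact h f)
    rw [← ofReal_norm, ENNReal.ofReal_le_ofReal_iff
      (by have := apply_nonneg (s.sup (schwartzSeminormFamily ℂ (Eucl d) ℂ)) f; positivity)] at h1
    rw [mul_assoc]
    exact h1

/-- A functional bounded by the coefficients is in the modulation space. -/
theorem exists_stftLpPow_le_of_bound (g g' : 𝓢(Eucl d, ℂ)) (hpq : p.HolderConjugate q) :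
    ∃ C : ℝ≥0, ∀ (v : 𝓢'(Eucl d, ℂ)) (M : ℝ≥0∞),
      (∀ ψ, ‖v ψ‖ₑ ≤ M * (∫⁻ z, ‖dualStft g ψ z‖ₑ ^ q) ^ (1 / q)) →
      stftLpPow g' p v ≤ (C * M) ^ p := by
  have hq0 := hpq.symm.pos
  -- Here the integration runs over the position of the atom instead of the evaluation point, which
  -- reflects the kernel.
  set κ : Eucl d × Eucl d → ℝ≥0∞ := fun z => windowKernel g g' (-z) with hκ
  have hκm : Measurable κ := (measurable_windowKernel g g').comp measurable_neg
  have hκI : ∫⁻ z, κ z < ∞ := by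
    rw [hκ, lintegral_neg_eq_self (fun z => windowKernel g g' z)]
    exact lintegral_windowKernel_lt_top g g'
  refine ⟨(∫⁻ z, κ z).toNNReal, fun v M hv => ?_⟩
  rw [ENNReal.coe_toNNReal hκI.ne]
  refine lintegral_rpow_le_of_pairing_le (measurable_stft g' v) hpq fun F hF hFi => ?_
  obtain ⟨G, hG, hu⟩ := exists_schwartz_superposition g' hF hFi
  rw [← (hu v).2]
  refine (hv G).trans ?_
  have hGz : ∀ z' : Eucl d × Eucl d, ‖dualStft g G z'‖ₑ ≤ ∫⁻ z, ‖F z‖ₑ * κ (z' - z) := by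
    intro z'
    -- A coefficient is itself a tempered distribution in `ψ`, given by an atom of the conjugate
    -- window, so the superposition formula for `G` also computes the coefficients of `G`.
    have hdual : ∀ ψ : 𝓢(Eucl d, ℂ),
        (stftAtom (conjS g) z'.1 (-z'.2) : 𝓢'(Eucl d, ℂ)) ψ = dualStft g ψ z' := by
      intro ψ
      rw [SchwartzMap.coe_apply, dualStft]
      simp_rw [conj_stftAtom, smul_eq_mul]
    have h1 := (hu (stftAtom (conjS g) z'.1 (-z'.2) : 𝓢'(Eucl d, ℂ))).2
    rw [hdual] at h1
    rw [h1]
    refine (enorm_integral_le_lintegral_enorm _).trans_eq (lintegral_congr fun z => ?_)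
    rw [enorm_mul, stft, hdual, enorm_dualStft_stftAtom, hκ]
    simp only [neg_sub]
  have hY := lintegral_conv_rpow_le (μ := (volume : Measure (Eucl d × Eucl d))) hF.enorm hκm
    hpq.symm.lt
  calc M * (∫⁻ z, ‖dualStft g G z‖ₑ ^ q) ^ (1 / q)
      ≤ M * ((∫⁻ z, κ z) ^ q * ∫⁻ z, ‖F z‖ₑ ^ q) ^ (1 / q) := by
        gcongr
        refine le_trans (lintegral_mono fun z => ?_) hY
        exact ENNReal.rpow_le_rpow (hGz z) hq0.le
    _ = _ := by
        rw [ENNReal.mul_rpow_of_nonneg _ _ (by positivity), ← ENNReal.rpow_mul,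
          mul_one_div_cancel hq0.ne', ENNReal.rpow_one]
        ring

/-- Truncation to a multiplier set is bounded on modulation spaces. -/
theorem exists_truncation_operator {p : ℝ≥0∞} (hp1 : 1 < p) (hp : p < ∞) (hg : g ≠ 0)
    (g₀ : 𝓢(Eucl d, ℂ)) (hQ : IsMultiplierSet Q) :
    ∃ T : modulationSpace g p p →ₗ[ℂ] modulationSpace g p p,
      (∃ C : ℝ≥0, ∀ u : modulationSpace g p p,
        modulationNorm g p p (T u : 𝓢'(Eucl d, ℂ)) ≤ C * modulationNorm g p p (u : 𝓢'(Eucl d, ℂ))) ∧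
      ∀ (u : modulationSpace g p p) ψ,
        (T u : 𝓢'(Eucl d, ℂ)) ψ = truncatedPairing g₀ Q (u : 𝓢'(Eucl d, ℂ)) ψ := by
  have h0 : p ≠ 0 := (zero_lt_one.trans hp1).ne'
  have hP1 : 1 < p.toReal := by
    rw [← ENNReal.toReal_one]
    exact (ENNReal.toReal_lt_toReal ENNReal.one_ne_top hp.ne).2 hp1
  set P := p.toReal with hP
  have hP0 : 0 < P := by linarith
  obtain ⟨r, hpq⟩ : ∃ r, P.HolderConjugate r := ⟨_, Real.HolderConjugate.conjExponent hP1⟩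
  -- The truncation is formed with the auxiliary window `g₀`: `A` pays for passing from `g` to `g₀`,
  -- and the duality constant `D` for returning to `g`.
  obtain ⟨A, hA⟩ := exists_stftLpPow_le hg g₀ hP1
  have hmem : ∀ u : modulationSpace g p p, stftLpPow g₀ P (u : 𝓢'(Eucl d, ℂ)) < ∞ := fun u =>
    (hA _).trans_lt (ENNReal.mul_lt_top ENNReal.coe_lt_top
      ((mem_modulationSpace_iff h0 hp.ne).1 u.2))
  choose T hT using fun u : modulationSpace g p p => exists_truncation g₀ hQ hpq (hmem u)
  obtain ⟨B, hB⟩ := exists_enorm_truncatedPairing_le g₀ hQ hpq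
  obtain ⟨D, hD⟩ := exists_stftLpPow_le_of_bound g₀ g hpq
  have hbound : ∀ u, stftLpPow g P (T u) ≤
      ((D * B) ^ P * A : ℝ≥0) * stftLpPow g P (u : 𝓢'(Eucl d, ℂ)) := by
    intro u
    refine (hD (T u) (B * stftLpPow g₀ P (u : 𝓢'(Eucl d, ℂ)) ^ (1 / P)) fun ψ => ?_).trans ?_
    · rw [hT]
      exact hB _ (hmem u) ψ
    · rw [← mul_assoc, ENNReal.mul_rpow_of_nonneg _ _ hP0.le, ← ENNReal.rpow_mul,
        one_div_mul_cancel hP0.ne', ENNReal.rpow_one, ENNReal.coe_mul,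
        ENNReal.coe_rpow_of_nonneg _ hP0.le, ENNReal.coe_mul, mul_assoc]
      gcongr
      exact hA _
  have hTmem : ∀ u, T u ∈ modulationSpace g p p := fun u =>
    (mem_modulationSpace_iff h0 hp.ne).2 ((hbound u).trans_lt (ENNReal.mul_lt_top ENNReal.coe_lt_top
      ((mem_modulationSpace_iff h0 hp.ne).1 u.2)))
  refine ⟨⟨⟨fun u => ⟨T u, hTmem u⟩, fun u v => ?_⟩, fun c u => ?_⟩, ⟨_, fun u =>
    modulationNorm_le_of_stftLpPow_le h0 hp.ne (hbound u)⟩, hT⟩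
  · refine Subtype.ext ?_
    ext ψ
    change T (u + v) ψ = T u ψ + T v ψ
    rw [hT, hT, hT, truncatedPairing, truncatedPairing, truncatedPairing, ← mul_add, ← integral_add
      (integrable_dualStft_indicator_mul_stft hQ hpq (hmem u) ψ)
      (integrable_dualStft_indicator_mul_stft hQ hpq (hmem v) ψ)]
    simp_rw [← mul_add]
    rfl
  · refine Subtype.ext ?_
    ext ψ
    change T (c • u) ψ = c • T u ψ
    have e : ∀ z : Eucl d × Eucl d, dualStft g₀ (Q.indicator ψ) z *
        stft g₀ ((c • u : modulationSpace g p p) : 𝓢'(Eucl d, ℂ)) z.1 z.2 =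
        c * (dualStft g₀ (Q.indicator ψ) z * stft g₀ (u : 𝓢'(Eucl d, ℂ)) z.1 z.2) := fun z =>
      mul_left_comm _ _ _
    rw [hT, hT, truncatedPairing, truncatedPairing, smul_eq_mul, mul_left_comm]
    simp_rw [e]
    rw [integral_const_mul]

end RestrictionOperator

/-! ### Truncation of functions. -/

section Truncation

variable {d : ℕ}

/-- The Fourier transform of a modulated function is a translate. -/
theorem fourier_exp_mul (m : Eucl d → ℂ) (s t : Eucl d) :
    𝓕 (fun y => Complex.exp (↑(-2 * Real.pi * inner ℝ y s) * Complex.I) * m y) (-t) =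
      𝓕 m (s - t) := by
  rw [Real.fourier_eq', Real.fourier_eq']
  congr 1
  funext y
  rw [smul_eq_mul, smul_eq_mul, ← mul_assoc, ← Complex.exp_add, inner_sub_right, inner_neg_right]
  congr 2
  push_cast
  ring

theorem fourier_mul_fourierInv_apply {m W : Eucl d → ℂ} (hm : Integrable m) (hW : Integrable W)
    (s : Eucl d) : 𝓕 (fun y => m y * 𝓕⁻ W y) s = ∫ t, W t * 𝓕 m (s - t) := by
  set ms : Eucl d → ℂ := fun y => Complex.exp (↑(-2 * Real.pi * inner ℝ y s) * Complex.I) * m y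
    with hms
  have hmsi : Integrable ms := by
    refine hm.bdd_mul (c := 1) (by fun_prop) (Filter.Eventually.of_forall fun y => ?_)
    rw [Complex.norm_exp_ofReal_mul_I]
  have h1 := integral_fourier_mul_eq_of_integrable hW.comp_neg hmsi
  rw [Real.fourier_eq', ← integral_neg_eq_self (fun t => W t * 𝓕 m (s - t))]
  have h2 : ∀ t, W (-t) * 𝓕 m (s - -t) = W (-t) * 𝓕 ms t := fun t => by
    rw [← fourier_exp_mul, neg_neg]
  simp_rw [h2]
  rw [← h1]
  congr 1
  funext y
  rw [Real.fourierInv_eq_fourier_comp_neg, smul_eq_mul, hms]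
  simp only
  ring

theorem fourier_dilate_mul_fourierInv (χ : 𝓢(Eucl d, ℂ)) {W : Eucl d → ℂ} (hW : Integrable W)
    (n : ℕ) (s : Eucl d) : 𝓕 (fun y => dilate χ n y * 𝓕⁻ W y) s =
      ∫ r, W (s - ((n : ℝ) + 1)⁻¹ • r) * 𝓕 χ r := by
  have hn : ((n : ℝ) + 1) ≠ 0 := by positivity
  rw [fourier_mul_fourierInv_apply (dilate χ n).integrable hW,
    ← integral_sub_left_eq_self (fun t => W t * 𝓕 (⇑(dilate χ n)) (s - t)) volume s]
  have h := Measure.integral_comp_smul (volume : Measure (Eucl d))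
    (fun r => W (s - ((n : ℝ) + 1)⁻¹ • r) * 𝓕 χ r) ((n : ℝ) + 1)
  have e : ∀ r : Eucl d, W (s - r) * 𝓕 (⇑(dilate χ n)) (s - (s - r)) = (((n : ℝ) + 1) ^ d : ℝ) •
      (W (s - ((n : ℝ) + 1)⁻¹ • ((n : ℝ) + 1) • r) * 𝓕 χ (((n : ℝ) + 1) • r)) := by
    intro r
    rw [sub_sub_cancel, inv_smul_smul₀ hn, ← SchwartzMap.fourier_coe, fourier_dilate_apply,
      mul_smul_comm]
  simp_rw [e]
  rw [integral_smul, h, smul_smul, finrank_euclideanSpace, Fintype.card_fin, abs_of_pos (by positivity),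
    mul_inv_cancel₀ (by positivity), one_smul]

theorem norm_fourier_dilate_mul_fourierInv_le (χ : 𝓢(Eucl d, ℂ)) {W : Eucl d → ℂ}
    (hW : Integrable W) {M : ℝ} (hM : ∀ t, ‖W t‖ ≤ M) (n : ℕ) (s : Eucl d) :
    ‖𝓕 (fun y => dilate χ n y * 𝓕⁻ W y) s‖ ≤ M * ∫ r, ‖𝓕 χ r‖ := by
  rw [fourier_dilate_mul_fourierInv χ hW, ← integral_const_mul]
  refine norm_integral_le_of_norm_le ((SchwartzMap.integrable _).norm.const_mul _)
    (Filter.Eventually.of_forall fun r => ?_)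
  rw [norm_mul]
  gcongr
  exact hM _

/-- The expression averages `W` near `s` against rescaled copies of `𝓕 χ`, whose integral is `χ 0 =
1`, so it converges at points of continuity. -/
theorem tendsto_fourier_dilate_mul_fourierInv {χ : 𝓢(Eucl d, ℂ)} (hχ : χ 0 = 1) {W : Eucl d → ℂ}
    (hW : Integrable W) (hWm : Measurable W) {M : ℝ} (hM : ∀ t, ‖W t‖ ≤ M) {s : Eucl d}
    (hs : ContinuousAt W s) :
    Filter.Tendsto (fun n => 𝓕 (fun y => dilate χ n y * 𝓕⁻ W y) s) Filter.atTop (nhds (W s)) := by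
  have hone : ∫ r, 𝓕 χ r = 1 := by
    have h : 𝓕⁻ (𝓕 χ) 0 = χ 0 := by rw [FourierTransform.fourierInv_fourier_eq]
    rw [SchwartzMap.fourierInv_coe, Real.fourierInv_eq'] at h
    simpa [hχ] using h
  have hlim : W s = ∫ r, W s * 𝓕 χ r := by rw [integral_const_mul, hone, mul_one]
  rw [hlim]
  simp_rw [fourier_dilate_mul_fourierInv χ hW]
  refine tendsto_integral_of_dominated_convergence (fun r => M * ‖𝓕 χ r‖) (fun n => ?_)
    ((SchwartzMap.integrable _).norm.const_mul _) (fun n => Filter.Eventually.of_forall fun r => ?_)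
    (Filter.Eventually.of_forall fun r => ?_)
  · exact ((hWm.comp (by fun_prop)).mul (SchwartzMap.continuous _).measurable).aestronglyMeasurable
  · rw [norm_mul]
    gcongr
    exact hM _
  · refine Filter.Tendsto.mul_const _ (hs.tendsto.comp ?_)
    have h1 : Filter.Tendsto (fun n : ℕ => s - ((n : ℝ) + 1)⁻¹ • r) Filter.atTop
        (nhds (s - (0 : ℝ) • r)) := by
      refine Filter.Tendsto.const_sub _ (Filter.Tendsto.smul_const ?_ r)
      simpa using tendsto_one_div_add_atTop_nhds_zero_nat (𝕜 := ℝ)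
    simpa using h1

theorem integrable_dilate_mul_fourierInv (χ : 𝓢(Eucl d, ℂ)) {W : Eucl d → ℂ} (hW : Integrable W)
    (n : ℕ) : Integrable fun y => dilate χ n y * 𝓕⁻ W y := by
  refine (dilate χ n).integrable.mul_bdd (c := ∫ t, ‖W t‖) ?_
    (Filter.Eventually.of_forall fun y => ?_)
  · have : (𝓕⁻ W) = fun y => 𝓕 W (-y) := funext fun y => Real.fourierInv_eq_fourier_neg W y
    rw [this]
    exact ((continuous_fourier_of_integrable hW).comp continuous_neg).aestronglyMeasurable
  · rw [Real.fourierInv_eq_fourier_neg]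
    exact norm_fourier_le_integral W _

theorem integral_dilate_mul_fourierInv_mul_fourier (χ : 𝓢(Eucl d, ℂ)) {F W : Eucl d → ℂ}
    (hF : Integrable F) (hW : Integrable W) (n : ℕ) :
    ∫ y, dilate χ n y * (𝓕⁻ W y * 𝓕 F y) = ∫ s, F s * 𝓕 (fun y => dilate χ n y * 𝓕⁻ W y) s := by
  rw [← integral_fourier_mul_eq_of_integrable hF
    (integrable_dilate_mul_fourierInv χ hW n)]
  congr 1
  funext y
  ring

theorem norm_integral_dilate_mul_le (χ : 𝓢(Eucl d, ℂ)) {F W : Eucl d → ℂ}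
    (hF : Integrable F) (hW : Integrable W) {M : ℝ} (hM : ∀ t, ‖W t‖ ≤ M) (n : ℕ) :
    ‖∫ y, dilate χ n y * (𝓕⁻ W y * 𝓕 F y)‖ ≤ (∫ s, ‖F s‖) * (M * ∫ r, ‖𝓕 χ r‖) := by
  rw [integral_dilate_mul_fourierInv_mul_fourier χ hF hW, ← integral_mul_const]
  refine norm_integral_le_of_norm_le (hF.norm.mul_const _) (Filter.Eventually.of_forall fun s => ?_)
  rw [norm_mul]
  gcongr
  exact norm_fourier_dilate_mul_fourierInv_le χ hW hM n s

/-- A regularised Parseval identity. For merely integrable `F` and bounded `W` with discontinuities,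
`𝓕⁻ W * 𝓕 F` need not be integrable, so a cutoff is inserted before the limit is taken. -/
theorem tendsto_integral_dilate_mul {χ : 𝓢(Eucl d, ℂ)} (hχ : χ 0 = 1) {F W : Eucl d → ℂ}
    (hF : Integrable F) (hW : Integrable W) (hWm : Measurable W) {M : ℝ} (hM : ∀ t, ‖W t‖ ≤ M)
    (hWc : ∀ᵐ s, ContinuousAt W s) :
    Filter.Tendsto (fun n => ∫ y, dilate χ n y * (𝓕⁻ W y * 𝓕 F y)) Filter.atTop
      (nhds (∫ s, F s * W s)) := by
  simp_rw [integral_dilate_mul_fourierInv_mul_fourier χ hF hW]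
  refine tendsto_integral_of_dominated_convergence (fun s => ‖F s‖ * (M * ∫ r, ‖𝓕 χ r‖))
    (fun n => ?_) (hF.norm.mul_const _) (fun n => Filter.Eventually.of_forall fun s => ?_) ?_
  · refine hF.1.mul ?_
    exact (continuous_fourier_of_integrable
      (integrable_dilate_mul_fourierInv χ hW n)).aestronglyMeasurable
  · rw [norm_mul]
    gcongr
    exact norm_fourier_dilate_mul_fourierInv_le χ hW hM n s
  · filter_upwards [hWc] with s hs
    exact (tendsto_fourier_dilate_mul_fourierInv hχ hW hWm hM hs).const_mul _

theorem exists_support_subset_closedBall {f : Eucl d → ℂ} (hf : HasCompactSupport f) :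
    ∃ R : ℝ, ∀ t, R < ‖t‖ → f t = 0 := by
  obtain ⟨R, hR⟩ := hf.isCompact.isBounded.subset_closedBall 0
  refine ⟨R, fun t ht => ?_⟩
  by_contra hne
  have := hR (subset_tsupport f hne)
  rw [mem_closedBall_zero_iff] at this
  linarith

/-- The truncation to `Q` of a locally integrable function acts on test functions in the expected
way. -/
theorem truncatedPairing_of_isGivenBy {g : 𝓢(Eucl d, ℂ)} (hg : HasCompactSupport g) (hg0 : g ≠ 0)
    {Q : Set (Eucl d)} (hQ : MeasurableSet Q) (hfr : volume (frontier Q) = 0) {u : 𝓢'(Eucl d, ℂ)}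
    {f : Eucl d → ℂ} (hu : IsGivenBy u f) {ψ : 𝓢(Eucl d, ℂ)} (hψ : HasCompactSupport ψ)
    (hint : Integrable fun z => dualStft g (Q.indicator ψ) z * stft g u z.1 z.2) :
    truncatedPairing g Q u ψ = ∫ t, Q.indicator f t * ψ t := by
  obtain ⟨χ, hχ, -⟩ := exists_schwartz_eq_one (d := d)
  obtain ⟨R₁, hR₁⟩ := exists_support_subset_closedBall hψ
  obtain ⟨R₂, hR₂⟩ := exists_support_subset_closedBall hg
  set w : Eucl d → ℂ := Q.indicator ψ with hw
  -- Only `‖x‖ ≤ R₁ + R₂` matters, since otherwise the supports of `ψ` and `g (· - x)` are disjoint.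
  -- For such `x` the ball contains the support of `g (· - x)`, so `f` may be replaced by its
  -- integrable restriction.
  set K := Metric.closedBall (0 : Eucl d) (R₁ + 2 * R₂) with hK
  set fK := K.indicator f with hfK
  have hfKi : Integrable fK :=
    (hu.1.integrableOn_isCompact (isCompact_closedBall _ _)).integrable_indicator measurableSet_closedBall
  set A := SchwartzMap.seminorm ℝ 0 0 g with hA
  set B := SchwartzMap.seminorm ℝ 0 0 ψ with hB
  have hA0 : 0 ≤ A := apply_nonneg _ _
  have hB0 : 0 ≤ B := apply_nonneg _ _
  have hgA : ∀ t, ‖g t‖ ≤ A := fun t => g.norm_le_seminorm ℝ t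
  have hwB : ∀ t, ‖w t‖ ≤ B := fun t => (norm_indicator_le_norm_self _ _).trans (ψ.norm_le_seminorm ℝ t)
  have hwR : ∀ t, R₁ < ‖t‖ → w t = 0 := fun t ht =>
    Set.indicator_apply_eq_zero.2 fun _ => hR₁ t ht
  have hwm : Measurable w := ψ.continuous.measurable.indicator hQ
  have hwi : Integrable w := ψ.integrable.indicator hQ
  have hwc : ∀ᵐ t, ContinuousAt w t := by
    have : ∀ᵐ t, t ∉ frontier Q := measure_eq_zero_iff_ae_notMem.1 hfr
    filter_upwards [this] with t ht
    exact ψ.continuous.continuousOn.continuousAt_indicator ht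
  -- `F x` and `W x` are the functions whose direct and inverse transforms are the slices of `stft g
  -- u` (for the relevant `x`) and of the coefficients of `w`. Their product contains `|g (s -
  -- x)|²`, which integrates in `x` to the window constant.
  set F : Eucl d → Eucl d → ℂ := fun x s => fK s * (starRingEnd ℂ) (g (s - x)) with hF
  set W : Eucl d → Eucl d → ℂ := fun x t => w t * g (t - x) with hW
  have hFi : ∀ x, Integrable (F x) := fun x => by
    refine hfKi.mul_bdd (c := A) ?_ (Filter.Eventually.of_forall fun s => ?_)
    · have := g.continuous
      exact (Complex.continuous_conj.comp (this.comp (by fun_prop))).aestronglyMeasurable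
    · rw [RCLike.norm_conj]; exact hgA _
  have hWi : ∀ x, Integrable (W x) := fun x => by
    refine hwi.mul_bdd (c := A) ?_ (Filter.Eventually.of_forall fun s => hgA _)
    exact (g.continuous.comp (by fun_prop)).aestronglyMeasurable
  have hWm : ∀ x, Measurable (W x) := fun x =>
    hwm.mul (g.continuous.comp (by fun_prop)).measurable
  have hWb : ∀ x t, ‖W x t‖ ≤ B * A := fun x t => by
    rw [hW, norm_mul]
    exact mul_le_mul (hwB t) (hgA _) (norm_nonneg _) hB0
  have hWc : ∀ x, ∀ᵐ t, ContinuousAt (W x) t := fun x => by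
    filter_upwards [hwc] with t ht
    exact ht.mul (g.continuous.comp (by fun_prop)).continuousAt
  have hW0 : ∀ x, R₁ + R₂ < ‖x‖ → W x = 0 := by
    intro x hx
    funext t
    by_cases ht : R₁ < ‖t‖
    · simp [hW, hwR t ht]
    · have h1 : R₂ < ‖t - x‖ := by
        have := norm_le_norm_add_norm_sub' x t
        rw [norm_sub_rev] at this
        linarith
      simp [hW, hR₂ _ h1]
  have hstft : ∀ x, ‖x‖ ≤ R₁ + R₂ → ∀ y, stft g u x y = 𝓕 (F x) y := by
    intro x hx y
    rw [stft, hu.2 _ (hasCompactSupport_stftAtom hg x y), Real.fourier_eq']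
    congr 1
    funext t
    rw [stftAtom_apply, hF, smul_eq_mul]
    by_cases ht : t ∈ K
    · simp only [hfK, Set.indicator_of_mem ht, real_inner_comm t y]
      push_cast
      ring_nf
    · have h1 : R₂ < ‖t - x‖ := by
        rw [hK, mem_closedBall_zero_iff, not_le] at ht
        have := norm_le_norm_add_norm_sub' t x
        linarith
      simp [hR₂ _ h1]
  have hslice : ∀ n x, ∫ y, dilate χ n y * (dualStft g w (x, y) * stft g u x y) =
      ∫ y, dilate χ n y * (𝓕⁻ (W x) y * 𝓕 (F x) y) := by
    intro n x
    congr 1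
    funext y
    rw [dualStft_eq_fourierInv]
    rcases le_or_gt ‖x‖ (R₁ + R₂) with hx | hx
    · rw [hstft x hx]
    · have h0 : 𝓕⁻ (W x) y = 0 := by
        rw [hW0 x hx, Real.fourierInv_eq']
        simp
      rw [h0, zero_mul, zero_mul]
  -- The cutoff depends on `y` alone. It is removed in two ways: here on phase space, using `hint`,
  -- and below after slicing in `x`, using Parseval. The pairing is found by comparing the limits.
  have hlim1 : Filter.Tendsto (fun n : ℕ => ∫ z : Eucl d × Eucl d,
      dilate χ n z.2 * (dualStft g w z * stft g u z.1 z.2)) Filter.atTop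
      (nhds (∫ z : Eucl d × Eucl d, dualStft g w z * stft g u z.1 z.2)) := by
    refine tendsto_integral_of_dominated_convergence
      (fun z => SchwartzMap.seminorm ℝ 0 0 χ * ‖dualStft g w z * stft g u z.1 z.2‖) (fun n => ?_)
      (hint.norm.const_mul _) (fun n => Filter.Eventually.of_forall fun z => ?_)
      (Filter.Eventually.of_forall fun z => ?_)
    · exact (((dilate χ n).continuous.comp continuous_snd).aestronglyMeasurable).mul hint.1
    · rw [norm_mul]
      gcongr
      exact norm_dilate_le χ n z.2
    · have := (tendsto_dilate χ z.2).mul_const (dualStft g w z * stft g u z.1 z.2)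
      rwa [hχ, one_mul] at this
  have hinti : ∀ n, Integrable fun z : Eucl d × Eucl d =>
      dilate χ n z.2 * (dualStft g w z * stft g u z.1 z.2) := fun n =>
    hint.bdd_mul (((dilate χ n).continuous.comp continuous_snd).aestronglyMeasurable)
      (Filter.Eventually.of_forall fun z => norm_dilate_le χ n z.2)
  have hfub : ∀ n, ∫ z : Eucl d × Eucl d, dilate χ n z.2 * (dualStft g w z * stft g u z.1 z.2) =
      ∫ x, ∫ y, dilate χ n y * (𝓕⁻ (W x) y * 𝓕 (F x) y) := by
    intro n
    rw [Measure.volume_eq_prod, integral_prod _ (hinti n)]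
    simp_rw [hslice]
  set D := (A * ∫ s, ‖fK s‖) * (B * A * ∫ r, ‖𝓕 χ r‖) with hD
  have hlim2 : Filter.Tendsto (fun n : ℕ => ∫ x, ∫ y, dilate χ n y * (𝓕⁻ (W x) y * 𝓕 (F x) y))
      Filter.atTop (nhds (∫ x, ∫ s, F x s * W x s)) := by
    refine tendsto_integral_of_dominated_convergence
      ((Metric.closedBall (0 : Eucl d) (R₁ + R₂)).indicator fun _ => D) (fun n => ?_) ?_
      (fun n => Filter.Eventually.of_forall fun x => ?_) (Filter.Eventually.of_forall fun x => ?_)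
    · simp_rw [← hslice]
      have h1 := hinti n
      rw [Measure.volume_eq_prod] at h1
      exact h1.integral_prod_left.1
    · rw [integrable_indicator_iff measurableSet_closedBall]
      exact integrableOn_const measure_closedBall_lt_top.ne
    · by_cases hx : x ∈ Metric.closedBall (0 : Eucl d) (R₁ + R₂)
      · rw [Set.indicator_of_mem hx]
        refine (norm_integral_dilate_mul_le χ (hFi x) (hWi x) (hWb x) n).trans ?_
        have h1 : ∫ s, ‖F x s‖ ≤ A * ∫ s, ‖fK s‖ := by
          rw [← integral_const_mul]
          refine integral_mono (hFi x).norm (hfKi.norm.const_mul _) fun s => ?_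
          simp only [hF]
          rw [norm_mul, RCLike.norm_conj, mul_comm]
          gcongr
          exact hgA _
        rw [hD]
        have h2 : 0 ≤ ∫ r, ‖𝓕 χ r‖ := integral_nonneg fun r => norm_nonneg _
        gcongr
      · rw [Set.indicator_of_notMem hx]
        rw [mem_closedBall_zero_iff, not_le] at hx
        have h0 : ∀ y, 𝓕⁻ (W x) y = 0 := fun y => by
          rw [hW0 x hx, Real.fourierInv_eq']
          simp
        simp [h0]
    · exact tendsto_integral_dilate_mul hχ (hFi x) (hWi x) (hWm x) (hWb x) (hWc x)
  simp_rw [hfub] at hlim1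
  have heq := tendsto_nhds_unique hlim1 hlim2
  have hfKw : ∀ s, fK s * w s = f s * w s := by
    intro s
    by_cases hs : s ∈ K
    · rw [hfK, Set.indicator_of_mem hs]
    · have h2 : R₂ < 0 ∨ R₁ < ‖s‖ := by
        rw [hK, mem_closedBall_zero_iff, not_le] at hs
        by_contra! h3
        linarith
      rcases h2 with h2 | h2
      · exact absurd (SchwartzMap.ext fun t => hR₂ t (h2.trans_le (norm_nonneg t))) hg0
      · rw [hwR s h2, mul_zero, mul_zero]
  have hFW : ∀ x s, F x s * W x s = (f s * w s) * ((‖g (s - x)‖ ^ 2 : ℝ) : ℂ) := by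
    intro x s
    simp only [hF, hW]
    rw [Complex.ofReal_pow, ← Complex.mul_conj', ← hfKw]
    ring
  have hfw : Integrable fun s => f s * w s := by
    simp_rw [← hfKw]
    exact hfKi.mul_bdd hwm.aestronglyMeasurable (Filter.Eventually.of_forall hwB)
  have hdouble : ∫ x, ∫ s, F x s * W x s = (windowSq g : ℂ) * ∫ s, f s * w s := by
    simp_rw [hFW]
    have hgi : Integrable fun t => ((‖g (-t)‖ ^ 2 : ℝ) : ℂ) :=
      (integrable_windowSq g).comp_neg.ofReal
    have hconv := hfw.convolution_integrand (ContinuousLinearMap.mul ℂ ℂ) hgi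
    simp only [neg_sub] at hconv
    rw [integral_integral_swap hconv]
    simp_rw [integral_const_mul, integral_complex_ofReal,
      integral_sub_left_eq_self (fun s => ‖g s‖ ^ 2) volume]
    rw [integral_mul_const, mul_comm]
    rfl
  have hc : (windowSq g : ℂ) ≠ 0 := by exact_mod_cast (windowSq_pos hg0).ne'
  rw [truncatedPairing, heq, hdouble, inv_mul_cancel_left₀ hc]
  congr 1
  funext t
  by_cases ht : t ∈ Q
  · rw [hw, Set.indicator_of_mem ht, Set.indicator_of_mem ht]
  · rw [hw, Set.indicator_of_notMem ht, Set.indicator_of_notMem ht, mul_zero, zero_mul]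

end Truncation

/-! ### Affine changes of variables. -/

section AffinePullback

variable {d : ℕ} (e : Eucl d ≃L[ℝ] Eucl d) (b : Eucl d)

/-- The affine map `x ↦ e x + b`. -/
noncomputable def affineHomeo : Eucl d ≃ₜ Eucl d := e.toHomeomorph.trans (Homeomorph.addRight b)

theorem affineHomeo_apply (x : Eucl d) : affineHomeo e b x = e x + b := rfl

theorem affineHomeo_symm_apply (x : Eucl d) : (affineHomeo e b).symm x = e.symm (x - b) := by
  rw [Homeomorph.symm_apply_eq, affineHomeo_apply, e.apply_symm_apply, sub_add_cancel]

/-- The inverse of the Jacobian of `x ↦ e x + b`. -/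
noncomputable def invJacobian : ℝ := |(LinearMap.det (e : Eucl d →ₗ[ℝ] Eucl d))⁻¹|

theorem invJacobian_pos : 0 < invJacobian e :=
  abs_pos.2 (inv_ne_zero (LinearEquiv.isUnit_det' e.toLinearEquiv).ne_zero)

theorem map_affineHomeo : Measure.map (affineHomeo e b) volume =
    ENNReal.ofReal (invJacobian e) • (volume : Measure (Eucl d)) := by
  have h1 : Measure.map e (volume : Measure (Eucl d)) =
      ENNReal.ofReal (invJacobian e) • (volume : Measure (Eucl d)) :=
    Measure.map_linearMap_addHaar_eq_smul_addHaar (f := (e : Eucl d →ₗ[ℝ] Eucl d)) volume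
      (LinearEquiv.isUnit_det' e.toLinearEquiv).ne_zero
  have h2 : (affineHomeo e b : Eucl d → Eucl d) = (fun x => x + b) ∘ e := rfl
  rw [h2, ← Measure.map_map (by fun_prop) e.continuous.measurable, h1, Measure.map_smul,
    map_add_right_eq_self]

theorem lintegral_comp_affineHomeo {f : Eucl d → ℝ≥0∞} (hf : Measurable f) :
    ∫⁻ x, f (affineHomeo e b x) = ENNReal.ofReal (invJacobian e) * ∫⁻ x, f x := by
  rw [← lintegral_map hf (affineHomeo e b).continuous.measurable, map_affineHomeo,
    lintegral_smul_measure, smul_eq_mul]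

theorem integral_comp_affineHomeo (f : Eucl d → ℂ) :
    ∫ x, f (affineHomeo e b x) = invJacobian e * ∫ x, f x := by
  rw [← (affineHomeo e b).measurableEmbedding.integral_map, map_affineHomeo,
    integral_smul_measure, ENNReal.toReal_ofReal (invJacobian_pos e).le, Complex.real_smul]

theorem locallyIntegrable_comp_affineHomeo {f : Eucl d → ℂ} (hf : LocallyIntegrable f) :
    LocallyIntegrable fun x => f (affineHomeo e b x) := by
  refine (locallyIntegrable_map_homeomorph (affineHomeo e b)).1 ?_
  rw [map_affineHomeo]
  intro x
  obtain ⟨U, hU, h⟩ := hf x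
  refine ⟨U, hU, ?_⟩
  rw [IntegrableOn, Measure.restrict_smul]
  exact h.smul_measure ENNReal.ofReal_ne_top

/-- Composition of a Schwartz function with the inverse of `x ↦ e x + b`. -/
noncomputable def affinePush : 𝓢(Eucl d, ℂ) →L[ℂ] 𝓢(Eucl d, ℂ) :=
  (compSubConstCLM ℂ b).comp (compCLMOfContinuousLinearEquiv ℂ e.symm)

theorem affinePush_apply (ψ : 𝓢(Eucl d, ℂ)) (t : Eucl d) :
    affinePush e b ψ t = ψ ((affineHomeo e b).symm t) := by
  rw [affineHomeo_symm_apply]; rfl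

/-- The pullback of a tempered distribution under `x ↦ e x + b`. -/
noncomputable def affinePullback : 𝓢'(Eucl d, ℂ) →ₗ[ℂ] 𝓢'(Eucl d, ℂ) :=
  (invJacobian e : ℂ) • (PointwiseConvergenceCLM.precomp ℂ (affinePush e b)).toLinearMap

theorem affinePullback_apply (u : 𝓢'(Eucl d, ℂ)) (ψ : 𝓢(Eucl d, ℂ)) :
    affinePullback e b u ψ = invJacobian e * u (affinePush e b ψ) := rfl

theorem IsGivenBy.affinePullback {u : 𝓢'(Eucl d, ℂ)} {f : Eucl d → ℂ} (hu : IsGivenBy u f) :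
    IsGivenBy (affinePullback e b u) fun x => f (e x + b) := by
  refine ⟨locallyIntegrable_comp_affineHomeo e b hu.1, fun ψ hψ => ?_⟩
  have hc : HasCompactSupport (affinePush e b ψ) := by
    have : (affinePush e b ψ : Eucl d → ℂ) = ψ ∘ (affineHomeo e b).symm :=
      funext fun t => affinePush_apply e b ψ t
    rw [this]
    exact hψ.comp_homeomorph _
  rw [affinePullback_apply, hu.2 _ hc, ← integral_comp_affineHomeo e b]
  simp_rw [affinePush_apply, Homeomorph.symm_apply_apply]
  rfl

/-- Pushing an atom forward under `x ↦ e x + b` gives an atom of the transported window, with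
frequency moved by the adjoint of the inverse, times a unimodular factor from the shift `b`. -/
theorem norm_stft_affinePullback (g : 𝓢(Eucl d, ℂ)) (u : 𝓢'(Eucl d, ℂ)) (x y : Eucl d) :
    ‖stft g (affinePullback e b u) x y‖ = invJacobian e *
      ‖stft (compCLMOfContinuousLinearEquiv ℂ e.symm g) u (e x + b)
        (ContinuousLinearMap.adjoint (e.symm : Eucl d →L[ℝ] Eucl d) y)‖ := by
  set c : ℂ := Complex.exp (↑(2 * Real.pi * inner ℝ y (e.symm b)) * Complex.I) with hc
  have hatom : affinePush e b (stftAtom g x y) = c •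
      stftAtom (compCLMOfContinuousLinearEquiv ℂ e.symm g) (e x + b)
        (ContinuousLinearMap.adjoint (e.symm : Eucl d →L[ℝ] Eucl d) y) := by
    ext t
    rw [affinePush_apply, affineHomeo_symm_apply, smul_apply, stftAtom_apply, stftAtom_apply,
      compCLMOfContinuousLinearEquiv_apply, Function.comp_apply, smul_eq_mul, mul_left_comm, hc,
      ← Complex.exp_add, ContinuousLinearMap.adjoint_inner_left]
    have h1 : e.symm (t - (e x + b)) = e.symm (t - b) - x := by
      rw [← sub_sub, sub_right_comm, map_sub, e.symm_apply_apply]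
    rw [h1]
    congr 2
    rw [map_sub, inner_sub_right]
    push_cast
    ring
  rw [stft, affinePullback_apply, hatom, map_smul, smul_eq_mul, norm_mul, norm_mul, hc,
    Complex.norm_exp_ofReal_mul_I, one_mul, Complex.norm_real,
    Real.norm_of_nonneg (invJacobian_pos e).le]
  rfl

/-- The inverse of the adjoint. -/
noncomputable def adjointInv : Eucl d ≃L[ℝ] Eucl d :=
  ContinuousLinearEquiv.equivOfInverse (ContinuousLinearMap.adjoint (e.symm : Eucl d →L[ℝ] Eucl d))
    (ContinuousLinearMap.adjoint (e : Eucl d →L[ℝ] Eucl d))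
    (fun y => by
      refine ext_inner_right ℝ fun z => ?_
      rw [ContinuousLinearMap.adjoint_inner_left, ContinuousLinearMap.adjoint_inner_left]
      simp)
    (fun y => by
      refine ext_inner_right ℝ fun z => ?_
      rw [ContinuousLinearMap.adjoint_inner_left, ContinuousLinearMap.adjoint_inner_left]
      simp)

theorem adjointInv_apply (y : Eucl d) :
    adjointInv e y = ContinuousLinearMap.adjoint (e.symm : Eucl d →L[ℝ] Eucl d) y := rfl

theorem measurable_affineHomeo_prod (e' : Eucl d ≃L[ℝ] Eucl d) (b' : Eucl d) :
    Measurable fun z : Eucl d × Eucl d => (affineHomeo e b z.1, affineHomeo e' b' z.2) :=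
  ((affineHomeo e b).continuous.measurable.comp measurable_fst).prodMk
    ((affineHomeo e' b').continuous.measurable.comp measurable_snd)

theorem lintegral_comp_affineHomeo_prod (e' : Eucl d ≃L[ℝ] Eucl d) (b' : Eucl d)
    {H : Eucl d × Eucl d → ℝ≥0∞} (hH : Measurable H) :
    ∫⁻ z : Eucl d × Eucl d, H (affineHomeo e b z.1, affineHomeo e' b' z.2) =
      ENNReal.ofReal (invJacobian e) * (ENNReal.ofReal (invJacobian e') * ∫⁻ z, H z) := by
  have hm2 := hH.comp (measurable_affineHomeo_prod e b e' b')
  have hy : ∀ x, ∫⁻ y, H (affineHomeo e b x, affineHomeo e' b' y) =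
      ENNReal.ofReal (invJacobian e') * ∫⁻ y, H (affineHomeo e b x, y) := fun x =>
    lintegral_comp_affineHomeo e' b' (hH.comp measurable_prodMk_left)
  have hx := lintegral_comp_affineHomeo e b
    (f := fun x => ENNReal.ofReal (invJacobian e') * ∫⁻ y, H (x, y))
    (hH.lintegral_prod_right'.const_mul _)
  rw [lintegral_const_mul _ hH.lintegral_prod_right'] at hx
  rw [Measure.volume_eq_prod, lintegral_prod _ hH.aemeasurable, ← hx, ← lintegral_congr hy]
  exact lintegral_prod _ hm2.aemeasurable

theorem stftLpPow_affinePullback (g : 𝓢(Eucl d, ℂ)) (u : 𝓢'(Eucl d, ℂ)) {p : ℝ} (hp : 0 ≤ p) :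
    stftLpPow g p (affinePullback e b u) = ENNReal.ofReal (invJacobian e) ^ p *
      (ENNReal.ofReal (invJacobian e) * (ENNReal.ofReal (invJacobian (adjointInv e)) *
        stftLpPow (compCLMOfContinuousLinearEquiv ℂ e.symm g) p u)) := by
  set g' := compCLMOfContinuousLinearEquiv ℂ e.symm g with hg'
  have hpt : ∀ z : Eucl d × Eucl d, ‖stft g (affinePullback e b u) z.1 z.2‖ₑ ^ p =
      ENNReal.ofReal (invJacobian e) ^ p *
        ‖stft g' u (affineHomeo e b z.1) (affineHomeo (adjointInv e) 0 z.2)‖ₑ ^ p := by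
    intro z
    rw [← ofReal_norm, norm_stft_affinePullback, ENNReal.ofReal_mul (invJacobian_pos e).le, ofReal_norm,
      ENNReal.mul_rpow_of_nonneg _ _ hp, affineHomeo_apply, affineHomeo_apply, add_zero,
      adjointInv_apply]
  have hm : Measurable fun z : Eucl d × Eucl d => ‖stft g' u z.1 z.2‖ₑ ^ p :=
    (measurable_stft g' u).enorm.pow_const _
  have hH := lintegral_comp_affineHomeo_prod e b (adjointInv e) 0 hm
  have hm2 := hm.comp (measurable_affineHomeo_prod e b (adjointInv e) 0)
  rw [stftLpPow, lintegral_congr hpt, stftLpPow, ← hH]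
  exact lintegral_const_mul _ hm2

/-- Affine changes of variables are bounded on modulation spaces. -/
theorem exists_affine_operator {p : ℝ≥0∞} (hp1 : 1 < p) (hp : p < ∞) {g : 𝓢(Eucl d, ℂ)}
    (hg : g ≠ 0) : ∃ T : modulationSpace g p p →ₗ[ℂ] modulationSpace g p p,
      (∃ C : ℝ≥0, ∀ u : modulationSpace g p p,
        modulationNorm g p p (T u : 𝓢'(Eucl d, ℂ)) ≤ C * modulationNorm g p p (u : 𝓢'(Eucl d, ℂ))) ∧
      ∀ (u : modulationSpace g p p) (f : Eucl d → ℂ), IsGivenBy (u : 𝓢'(Eucl d, ℂ)) f →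
        IsGivenBy (T u : 𝓢'(Eucl d, ℂ)) fun x => f (e x + b) := by
  have h0 : p ≠ 0 := (zero_lt_one.trans hp1).ne'
  have hP1 : 1 < p.toReal := by
    rw [← ENNReal.toReal_one]
    exact (ENNReal.toReal_lt_toReal ENNReal.one_ne_top hp.ne).2 hp1
  have hP0 : 0 ≤ p.toReal := by linarith
  obtain ⟨A, hA⟩ := exists_stftLpPow_le hg (compCLMOfContinuousLinearEquiv ℂ e.symm g) hP1
  have hbound : ∀ u, stftLpPow g p.toReal (affinePullback e b u) ≤
      ((invJacobian e).toNNReal ^ p.toReal * ((invJacobian e).toNNReal *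
        ((invJacobian (adjointInv e)).toNNReal * A)) : ℝ≥0) * stftLpPow g p.toReal u := by
    intro u
    rw [stftLpPow_affinePullback e b g u hP0, ENNReal.coe_mul, ENNReal.coe_mul, ENNReal.coe_mul,
      ENNReal.coe_rpow_of_nonneg _ hP0, mul_assoc, mul_assoc, mul_assoc]
    exact mul_le_mul_right (mul_le_mul_right (mul_le_mul_right (hA u) _) _) _
  have hmem : ∀ u ∈ modulationSpace g p p, affinePullback e b u ∈ modulationSpace g p p :=
    fun u hu => (mem_modulationSpace_iff h0 hp.ne).2 ((hbound u).trans_lt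
      (ENNReal.mul_lt_top ENNReal.coe_lt_top ((mem_modulationSpace_iff h0 hp.ne).1 hu)))
  exact ⟨(affinePullback e b).restrict hmem, ⟨_, fun u =>
    modulationNorm_le_of_stftLpPow_le h0 hp.ne (hbound u)⟩, fun u f hu => hu.affinePullback e b⟩

end AffinePullback

/-! ### Density of Schwartz functions. -/

section Density

variable {d : ℕ}

theorem isGivenBy_coe (G : 𝓢(Eucl d, ℂ)) : IsGivenBy (G : 𝓢'(Eucl d, ℂ)) G := by
  refine ⟨G.integrable.locallyIntegrable, fun ψ _ => ?_⟩
  rw [SchwartzMap.coe_apply]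
  simp_rw [smul_eq_mul, mul_comm]

theorem integral_neg_snd (h : Eucl d × Eucl d → ℂ) :
    ∫ z : Eucl d × Eucl d, h (z.1, -z.2) = ∫ z, h z := by
  have h1 : MeasurePreserving (Prod.map id Neg.neg : Eucl d × Eucl d → Eucl d × Eucl d)
      volume volume :=
    (MeasurePreserving.id volume).prod (Measure.measurePreserving_neg volume)
  exact h1.integral_comp
    ((Homeomorph.refl (Eucl d)).prodCongr (Homeomorph.neg (Eucl d))).measurableEmbedding h

theorem integrable_neg_snd {h : Eucl d × Eucl d → ℂ} :
    Integrable (fun z : Eucl d × Eucl d => h (z.1, -z.2)) ↔ Integrable h := by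
  have h1 : MeasurePreserving (Prod.map id Neg.neg : Eucl d × Eucl d → Eucl d × Eucl d)
      volume volume :=
    (MeasurePreserving.id volume).prod (Measure.measurePreserving_neg volume)
  exact h1.integrable_comp_emb
    ((Homeomorph.refl (Eucl d)).prodCongr (Homeomorph.neg (Eucl d))).measurableEmbedding

/-- Superpositions of the dual atoms, and their short-time Fourier transforms. -/
theorem exists_schwartz_dual_superposition (g : 𝓢(Eucl d, ℂ)) {a : Eucl d × Eucl d → ℂ}
    (ha : Measurable a) (hint : ∀ K : ℕ, Integrable fun z => ‖a z‖ * phaseWeight z ^ K) :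
    ∃ G : 𝓢(Eucl d, ℂ), ∀ ψ : 𝓢(Eucl d, ℂ), Integrable (fun z => a z * dualStft g ψ z) ∧
      (G : 𝓢'(Eucl d, ℂ)) ψ = ∫ z, a z * dualStft g ψ z := by
  -- Conjugating an atom conjugates the window and reverses the frequency, so the reflection `y ↦
  -- -y` reduces dual atoms to ordinary ones.
  have ha' : Measurable fun z : Eucl d × Eucl d => a (z.1, -z.2) := ha.comp (by fun_prop)
  have hint' : ∀ K : ℕ, Integrable fun z : Eucl d × Eucl d => ‖a (z.1, -z.2)‖ * phaseWeight z ^ K := by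
    intro K
    have h1 : Integrable fun z : Eucl d × Eucl d => ((‖a z‖ * phaseWeight z ^ K : ℝ) : ℂ) :=
      (hint K).ofReal
    have h2 := (integrable_neg_snd.2 h1).re
    refine h2.congr (Filter.Eventually.of_forall fun z => ?_)
    simp only [phaseWeight, norm_neg]
    exact Complex.ofReal_re _
  obtain ⟨G, -, hu⟩ := exists_schwartz_superposition (conjS g) ha' hint'
  refine ⟨G, fun ψ => ?_⟩
  have hst : ∀ z : Eucl d × Eucl d, stft (conjS g) (ψ : 𝓢'(Eucl d, ℂ)) z.1 z.2 =
      dualStft g ψ (z.1, -z.2) := by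
    intro z
    rw [stft, SchwartzMap.coe_apply, dualStft]
    simp_rw [conj_stftAtom, smul_eq_mul, neg_neg, mul_comm]
  have h1 := hu (ψ : 𝓢'(Eucl d, ℂ))
  simp_rw [hst] at h1
  refine ⟨integrable_neg_snd.1 h1.1, ?_⟩
  rw [← integral_neg_snd fun z => a z * dualStft g ψ z, ← h1.2, SchwartzMap.coe_apply,
    SchwartzMap.coe_apply]
  simp_rw [smul_eq_mul, mul_comm]

/-- Schwartz functions are dense in the modulation spaces with finite exponents. -/
theorem exists_schwartz_stftLpPow_sub_le {g : 𝓢(Eucl d, ℂ)} (hg : g ≠ 0) {p : ℝ} (hp : 1 < p)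
    {u : 𝓢'(Eucl d, ℂ)} (hu : stftLpPow g p u < ∞) {ε : ℝ≥0∞} (hε : 0 < ε) :
    ∃ G : 𝓢(Eucl d, ℂ), stftLpPow g p (u - (G : 𝓢'(Eucl d, ℂ))) < ε := by
  have hp0 : 0 < p := by linarith
  set c := windowSq g with hc
  have hc0 : (c : ℂ) ≠ 0 := by exact_mod_cast (windowSq_pos hg).ne'
  set V : Eucl d × Eucl d → ℂ := fun z => stft g u z.1 z.2 with hV
  have hVm : Measurable V := measurable_stft g u
  -- On `S n` both the transform of `u` and the phase-space weight are bounded, so the truncated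
  -- transform synthesises a Schwartz function. By the inversion formula the error has the tail of
  -- `V` as coefficients, and Young's inequality bounds it by the quantity in `hlim`.
  set S : ℕ → Set (Eucl d × Eucl d) := fun n => {z | ‖V z‖ ≤ n ∧ phaseWeight z ≤ n} with hS
  have hSm : ∀ n, MeasurableSet (S n) := fun n =>
    (measurableSet_le hVm.norm measurable_const).inter (measurableSet_phaseWeight_le n)
  set I := ∫⁻ z, windowKernel g g z with hI
  have hIt : I ≠ ∞ := (lintegral_windowKernel_lt_top g g).ne
  have hlim : Filter.Tendsto (fun n => (‖(c : ℂ)⁻¹‖ₑ * I) ^ p *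
      ∫⁻ z, ‖((S n)ᶜ).indicator V z‖ₑ ^ p) Filter.atTop (nhds 0) := by
    have h1 : Filter.Tendsto (fun n => ∫⁻ z, ‖((S n)ᶜ).indicator V z‖ₑ ^ p) Filter.atTop
        (nhds (∫⁻ _ : Eucl d × Eucl d, 0)) := by
      refine tendsto_lintegral_of_dominated_convergence (fun z => ‖V z‖ₑ ^ p)
        (fun n => (hVm.indicator (hSm n).compl).enorm.pow_const _)
        (fun n => Filter.Eventually.of_forall fun z => ?_) hu.ne
        (Filter.Eventually.of_forall fun z => ?_)
      · exact ENNReal.rpow_le_rpow (enorm_indicator_le_enorm_self _ _) hp0.le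
      · obtain ⟨N, hN⟩ := exists_nat_ge (max ‖V z‖ (phaseWeight z))
        refine tendsto_const_nhds.congr' ?_
        filter_upwards [Filter.eventually_ge_atTop N] with n hn
        have hn' : (N : ℝ) ≤ n := by exact_mod_cast hn
        have hz : z ∈ S n := ⟨((le_max_left _ _).trans hN).trans hn',
          ((le_max_right _ _).trans hN).trans hn'⟩
        rw [Set.indicator_of_notMem (s := (S n)ᶜ) (not_not_intro hz), enorm_zero, ENNReal.zero_rpow_of_pos hp0]
    rw [lintegral_zero] at h1
    have h2 := ENNReal.Tendsto.const_mul (a := (‖(c : ℂ)⁻¹‖ₑ * I) ^ p) h1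
      (Or.inr (ENNReal.rpow_ne_top_of_nonneg hp0.le (ENNReal.mul_ne_top enorm_ne_top hIt)))
    rwa [mul_zero] at h2
  obtain ⟨n, hn⟩ := (hlim.eventually (gt_mem_nhds hε)).exists
  set a : Eucl d × Eucl d → ℂ := fun z => (c : ℂ)⁻¹ * (S n).indicator V z with ha
  have ham : Measurable a := (hVm.indicator (hSm n)).const_mul _
  have hai : ∀ K : ℕ, Integrable fun z => ‖a z‖ * phaseWeight z ^ K := by
    refine fun K => integrable_norm_mul_phaseWeight_pow ham (B := ‖(c : ℂ)⁻¹‖ * n) (R := n)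
      (fun z => ?_) (fun z hz => ?_) K
    · rw [ha, norm_mul]
      gcongr
      by_cases hz : z ∈ S n
      · rw [Set.indicator_of_mem hz]; exact hz.1
      · rw [Set.indicator_of_notMem hz, norm_zero]; positivity
    · simp only [ha]
      rw [Set.indicator_of_notMem (fun h => absurd h.2 (not_le.2 hz)), mul_zero]
  obtain ⟨G, hG⟩ := exists_schwartz_dual_superposition g ham hai
  refine ⟨G, lt_of_le_of_lt ?_ hn⟩
  have hpt : ∀ z' : Eucl d × Eucl d, ‖stft g (u - (G : 𝓢'(Eucl d, ℂ))) z'.1 z'.2‖ₑ ≤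
      ‖(c : ℂ)⁻¹‖ₑ * ∫⁻ z, ‖((S n)ᶜ).indicator V z‖ₑ * windowKernel g g (z' - z) := by
    intro z'
    obtain ⟨hi1, he1⟩ := stft_inversion g (stftAtom g z'.1 z'.2) u
    obtain ⟨hi2, he2⟩ := hG (stftAtom g z'.1 z'.2)
    have e : stft g (u - (G : 𝓢'(Eucl d, ℂ))) z'.1 z'.2 =
        (c : ℂ)⁻¹ * ∫ z, ((S n)ᶜ).indicator V z * dualStft g (stftAtom g z'.1 z'.2) z := by
      have h1 : stft g (u - (G : 𝓢'(Eucl d, ℂ))) z'.1 z'.2 =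
          u (stftAtom g z'.1 z'.2) - (G : 𝓢'(Eucl d, ℂ)) (stftAtom g z'.1 z'.2) := rfl
      have h2 : u (stftAtom g z'.1 z'.2) = ∫ z : Eucl d × Eucl d, (c : ℂ)⁻¹ *
          (dualStft g (stftAtom g z'.1 z'.2) z * stft g u z.1 z.2) := by
        rw [integral_const_mul, he1, inv_mul_cancel_left₀ hc0]
      rw [h1, h2, he2, ← integral_sub (hi1.const_mul _) hi2, ← integral_const_mul]
      congr 1
      funext z
      simp only [ha, hV]
      by_cases hz : z ∈ S n
      · rw [Set.indicator_of_mem hz, Set.indicator_of_notMem (s := (S n)ᶜ) (not_not_intro hz)]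
        ring
      · rw [Set.indicator_of_notMem hz, Set.indicator_of_mem (Set.mem_compl hz)]
        ring
    rw [e, enorm_mul]
    gcongr
    refine (enorm_integral_le_lintegral_enorm _).trans_eq (lintegral_congr fun z => ?_)
    rw [enorm_mul, enorm_dualStft_stftAtom]
  have hY := lintegral_conv_rpow_le (μ := (volume : Measure (Eucl d × Eucl d)))
    (hVm.indicator (hSm n).compl).enorm (measurable_windowKernel g g) hp
  calc stftLpPow g p (u - (G : 𝓢'(Eucl d, ℂ)))
      ≤ ∫⁻ z' : Eucl d × Eucl d, ‖(c : ℂ)⁻¹‖ₑ ^ p *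
          (∫⁻ z, ‖((S n)ᶜ).indicator V z‖ₑ * windowKernel g g (z' - z)) ^ p := by
        refine lintegral_mono fun z' => ?_
        rw [← ENNReal.mul_rpow_of_nonneg _ _ hp0.le]
        exact ENNReal.rpow_le_rpow (hpt z') hp0.le
    _ = ‖(c : ℂ)⁻¹‖ₑ ^ p * ∫⁻ z' : Eucl d × Eucl d,
          (∫⁻ z, ‖((S n)ᶜ).indicator V z‖ₑ * windowKernel g g (z' - z)) ^ p :=
        lintegral_const_mul' _ _ (ENNReal.rpow_ne_top_of_nonneg hp0.le enorm_ne_top)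
    _ ≤ ‖(c : ℂ)⁻¹‖ₑ ^ p * (I ^ p * ∫⁻ z, ‖((S n)ᶜ).indicator V z‖ₑ ^ p) := by gcongr
    _ = _ := by rw [ENNReal.mul_rpow_of_nonneg _ _ hp0.le, mul_assoc]

end Density

/-! ### Triangle inequality and uniqueness. -/

section Norm

variable {d : ℕ}

theorem modulationNorm_add_le (g : 𝓢(Eucl d, ℂ)) {p : ℝ≥0∞} (hp : 1 ≤ p) (u v : 𝓢'(Eucl d, ℂ)) :
    modulationNorm g p p (u + v) ≤ modulationNorm g p p u + modulationNorm g p p v := by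
  refine le_trans (eLpNorm_mono_enorm (g := (fun y => eLpNorm (fun x : Eucl d => stft g u x y) p volume) +
    fun y => eLpNorm (fun x : Eucl d => stft g v x y) p volume) fun y => ?_)
    (eLpNorm_add_le (measurable_eLpNorm_stft g p u).aestronglyMeasurable
      (measurable_eLpNorm_stft g p v).aestronglyMeasurable hp)
  rw [enorm_eq_self, enorm_eq_self]
  exact eLpNorm_add_le (continuous_stft_left g u y).aestronglyMeasurable
      (continuous_stft_left g v y).aestronglyMeasurable hp

theorem modulationNorm_neg (g : 𝓢(Eucl d, ℂ)) (p q : ℝ≥0∞) (u : 𝓢'(Eucl d, ℂ)) :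
    modulationNorm g p q (-u) = modulationNorm g p q u := by
  have h : ∀ y, (fun x => stft g (-u) x y) = -fun x => stft g u x y := fun y => rfl
  simp_rw [modulationNorm, h, eLpNorm_neg]

/-- The two operators agree on Schwartz functions, both are bounded, and Schwartz functions are
dense; a distribution of modulation norm zero vanishes by inversion. -/
theorem IsChangeOfVariables.unique {g : 𝓢(Eucl d, ℂ)} (hg : g ≠ 0) {p : ℝ≥0∞} (hp1 : 1 < p)
    (hp : p < ∞) {φ : Eucl d → Eucl d} {T T' : modulationSpace g p p →ₗ[ℂ] modulationSpace g p p}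
    (hT : IsChangeOfVariables g p p φ T) (hT' : IsChangeOfVariables g p p φ T') : T' = T := by
  have h0 : p ≠ 0 := (zero_lt_one.trans hp1).ne'
  have hP1 : 1 < p.toReal := by
    rw [← ENNReal.toReal_one]
    exact (ENNReal.toReal_lt_toReal ENNReal.one_ne_top hp.ne).2 hp1
  have hP0 : 0 < p.toReal := by linarith
  obtain ⟨C, hC⟩ := hT.bounded
  obtain ⟨C', hC'⟩ := hT'.bounded
  refine LinearMap.ext fun u => Subtype.ext ?_
  set D : 𝓢'(Eucl d, ℂ) := (T' u : 𝓢'(Eucl d, ℂ)) - T u with hD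
  have hsmall : ∀ ε : ℝ≥0∞, 0 < ε → modulationNorm g p p D ≤ (C' + C) * ε := by
    intro ε hε
    -- Replacing `ε` by `min ε 1` keeps the distance finite, which puts `G` in the modulation space.
    obtain ⟨G, hG⟩ := exists_schwartz_stftLpPow_sub_le hg hP1
      ((mem_modulationSpace_iff h0 hp.ne).1 u.2) (ε := min ε 1 ^ p.toReal)
      (ENNReal.rpow_pos_of_nonneg (lt_min hε one_pos) hP0.le)
    have hmem1 : (u : 𝓢'(Eucl d, ℂ)) - (G : 𝓢'(Eucl d, ℂ)) ∈ modulationSpace g p p :=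
      (mem_modulationSpace_iff h0 hp.ne).2 (hG.trans_le
        (by exact (ENNReal.rpow_le_rpow (min_le_right _ _) hP0.le).trans (by simp)))
    have hmem2 : (G : 𝓢'(Eucl d, ℂ)) ∈ modulationSpace g p p := by
      have := (modulationSpace g p p).sub_mem u.2 hmem1
      rwa [sub_sub_cancel] at this
    set v : modulationSpace g p p := ⟨(G : 𝓢'(Eucl d, ℂ)), hmem2⟩ with hv
    have hsub : modulationNorm g p p ((u - v : modulationSpace g p p) : 𝓢'(Eucl d, ℂ)) ≤ ε := by
      rw [modulationNorm_eq g h0 hp.ne]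
      calc _ ≤ (min ε 1 ^ p.toReal) ^ (1 / p.toReal) :=
            ENNReal.rpow_le_rpow hG.le (by positivity)
        _ = min ε 1 := by
            rw [← ENNReal.rpow_mul, mul_one_div_cancel hP0.ne', ENNReal.rpow_one]
        _ ≤ ε := min_le_left _ _
    have hTv : (T' v : 𝓢'(Eucl d, ℂ)) = T v :=
      (hT'.comp_schwartz v G (isGivenBy_coe G)).unique (hT.comp_schwartz v G (isGivenBy_coe G))
    have hDeq : D = (T' (u - v) : 𝓢'(Eucl d, ℂ)) + -(T (u - v) : 𝓢'(Eucl d, ℂ)) := by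
      rw [map_sub, map_sub, hD, Submodule.coe_sub, Submodule.coe_sub, hTv]
      abel
    rw [hDeq, add_mul]
    refine (modulationNorm_add_le g hp1.le _ _).trans ?_
    rw [modulationNorm_neg]
    exact add_le_add ((hC' _).trans (by gcongr)) ((hC _).trans (by gcongr))
  have hzero : modulationNorm g p p D = 0 := by
    refine le_antisymm (ENNReal.le_of_forall_pos_le_add fun ε hε _ => ?_) zero_le
    rw [zero_add]
    refine (hsmall ((ε / (C' + C + 1) : ℝ≥0) : ℝ≥0∞) (by exact_mod_cast by positivity)).trans ?_
    rw [← ENNReal.coe_add, ← ENNReal.coe_mul, ENNReal.coe_le_coe, mul_div_assoc',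
      div_le_iff₀ (by positivity), mul_comm]
    exact mul_le_mul_right le_self_add _
  rw [modulationNorm_eq g h0 hp.ne, ENNReal.rpow_eq_zero_iff_of_pos (by positivity), stftLpPow,
    lintegral_eq_zero_iff ((measurable_stft g D).enorm.pow_const _)] at hzero
  refine eq_of_stft_eq hg ?_
  filter_upwards [hzero] with z hz
  rw [Pi.zero_apply, ENNReal.rpow_eq_zero_iff_of_pos hP0, enorm_eq_zero] at hz
  exact sub_eq_zero.1 hz

end Norm

/-! ### Boxes and finite sums. -/

section Boxes

variable {d : ℕ}

theorem isMultiplierSet_of_isUpperSet (i : Fin d) {U : Set ℝ} (hU : IsUpperSet U) :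
    IsMultiplierSet {x : Eucl d | x i ∈ U} := by
  refine IsHalfSpace.isMultiplierSet (v := EuclideanSpace.single i (1 : ℝ))
    ⟨?_, ?_, fun x hx y hy => ?_⟩
  · simp
  · exact hU.ordConnected.measurableSet.preimage (by fun_prop)
  · simp only [EuclideanSpace.inner_single_left, map_one, one_mul]
    by_contra! h
    exact hy (hU h.le hx)

theorem isMultiplierSet_of_isLowerSet (i : Fin d) {U : Set ℝ} (hU : IsLowerSet U) :
    IsMultiplierSet {x : Eucl d | x i ∈ U} := by
  refine IsHalfSpace.isMultiplierSet (v := EuclideanSpace.single i (-1 : ℝ))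
    ⟨?_, ?_, fun x hx y hy => ?_⟩
  · simp
  · exact hU.ordConnected.measurableSet.preimage (by fun_prop)
  · simp only [EuclideanSpace.inner_single_left, map_neg, map_one, neg_one_mul, neg_le_neg_iff]
    by_contra! h
    exact hy (hU h.le hx)

/-- An order-connected set of reals is the intersection of its upper and lower closures, so each
coordinate condition is an intersection of two half-spaces orthogonal to a coordinate axis, and the
box is a finite intersection of these. -/
theorem IsAxisParallelBox.isMultiplierSet {Q : Set (Eucl d)} (hQ : IsAxisParallelBox Q) :
    IsMultiplierSet Q := by
  obtain ⟨I, hI, rfl⟩ := hQ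
  have h1 : ∀ i, IsMultiplierSet {x : Eucl d | x i ∈ I i} := by
    intro i
    have h2 := (isMultiplierSet_of_isUpperSet i (upperClosure (I i)).upper).inter
      (isMultiplierSet_of_isLowerSet i (lowerClosure (I i)).lower)
    have h3 := ordConnected_iff_upperClosure_inter_lowerClosure.1 (hI i)
    have h4 : {x : Eucl d | x i ∈ I i} = {x : Eucl d | x i ∈ (upperClosure (I i) : Set ℝ)} ∩
        {x : Eucl d | x i ∈ (lowerClosure (I i) : Set ℝ)} := by
      ext x
      change x i ∈ I i ↔ x i ∈ (upperClosure (I i) : Set ℝ) ∩ (lowerClosure (I i) : Set ℝ)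
      rw [h3]
    rw [h4]
    exact h2
  have h5 : ∀ s : Finset (Fin d), IsMultiplierSet {x : Eucl d | ∀ i ∈ s, x i ∈ I i} := by
    intro s
    induction s using Finset.induction_on with
    | empty => simpa using isMultiplierSet_univ (d := d)
    | insert i s _ ih =>
      have h6 : {x : Eucl d | ∀ j ∈ insert i s, x j ∈ I j} =
          {x : Eucl d | x i ∈ I i} ∩ {x : Eucl d | ∀ j ∈ s, x j ∈ I j} := by
        ext x
        simp
      rw [h6]
      exact (h1 i).inter ih
  simpa using h5 Finset.univ

theorem IsAxisParallelBox.volume_frontier {Q : Set (Eucl d)} (hQ : IsAxisParallelBox Q) :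
    volume (frontier Q) = 0 := by
  obtain ⟨I, hI, rfl⟩ := hQ
  refine Convex.addHaar_frontier volume ?_
  have : {x : Eucl d | ∀ i, x i ∈ I i} =
      ⋂ i, (EuclideanSpace.proj i : Eucl d →L[ℝ] ℝ) ⁻¹' I i := by
    ext x
    simp
  rw [this]
  exact convex_iInter fun i => (hI i).convex.linear_preimage
    (EuclideanSpace.proj i : Eucl d →L[ℝ] ℝ).toLinearMap

/-- Multiplication by the indicator function of a box is bounded on modulation spaces. -/
theorem exists_box_operator {p : ℝ≥0∞} (hp1 : 1 < p) (hp : p < ∞) {g : 𝓢(Eucl d, ℂ)}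
    (hg : g ≠ 0) {Q : Set (Eucl d)} (hQ : IsAxisParallelBox Q) :
    ∃ T : modulationSpace g p p →ₗ[ℂ] modulationSpace g p p,
      (∃ C : ℝ≥0, ∀ u : modulationSpace g p p,
        modulationNorm g p p (T u : 𝓢'(Eucl d, ℂ)) ≤ C * modulationNorm g p p (u : 𝓢'(Eucl d, ℂ))) ∧
      ∀ (u : modulationSpace g p p) (f : Eucl d → ℂ), IsGivenBy (u : 𝓢'(Eucl d, ℂ)) f →
        IsGivenBy (T u : 𝓢'(Eucl d, ℂ)) (Q.indicator f) := by
  -- Being given by a function is tested on compactly supported functions only; a compactly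
  -- supported window makes the atoms admissible.
  obtain ⟨χ, hχ1, hχ⟩ := exists_schwartz_eq_one (d := d)
  have hχ0 : χ ≠ 0 := by
    rintro rfl
    simp at hχ1
  obtain ⟨T, hTb, hT⟩ := exists_truncation_operator hp1 hp hg χ hQ.isMultiplierSet
  refine ⟨T, hTb, fun u f hu => ⟨hu.1.indicator hQ.isMultiplierSet.measurableSet, fun ψ hψ => ?_⟩⟩
  have h0 : p ≠ 0 := (zero_lt_one.trans hp1).ne'
  have hP1 : 1 < p.toReal := by
    rw [← ENNReal.toReal_one]
    exact (ENNReal.toReal_lt_toReal ENNReal.one_ne_top hp.ne).2 hp1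
  obtain ⟨A, hA⟩ := exists_stftLpPow_le hg χ hP1
  have hmem : stftLpPow χ p.toReal (u : 𝓢'(Eucl d, ℂ)) < ∞ :=
    (hA _).trans_lt (ENNReal.mul_lt_top ENNReal.coe_lt_top
      ((mem_modulationSpace_iff h0 hp.ne).1 u.2))
  rw [hT]
  exact truncatedPairing_of_isGivenBy hχ hχ0 hQ.isMultiplierSet.measurableSet hQ.volume_frontier hu
    hψ (integrable_dualStft_indicator_mul_stft hQ.isMultiplierSet
      (Real.HolderConjugate.conjExponent hP1) hmem ψ)

theorem exists_continuousLinearEquiv_of_isUnit {A : Matrix (Fin d) (Fin d) ℝ} (hA : IsUnit A) :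
    ∃ e : Eucl d ≃L[ℝ] Eucl d, ∀ x, e x = Matrix.toEuclideanLin A x := by
  have hdet := (Matrix.isUnit_iff_isUnit_det A).1 hA
  have h1 : ∀ B C : Matrix (Fin d) (Fin d) ℝ, B * C = 1 → ∀ x,
      Matrix.toEuclideanLin B (Matrix.toEuclideanLin C x) = x := by
    intro B C hBC x
    simp [Matrix.toLpLin_apply, Matrix.mulVec_mulVec, hBC]
  exact ⟨(LinearEquiv.mk (Matrix.toEuclideanLin A) (Matrix.toEuclideanLin A⁻¹)
    (h1 _ _ (Matrix.nonsing_inv_mul A hdet))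
    (h1 _ _ (Matrix.mul_nonsing_inv A hdet))).toContinuousLinearEquiv, fun x => rfl⟩

theorem exists_bound_sum {ι : Type*} (s : Finset ι) {g : 𝓢(Eucl d, ℂ)} {p : ℝ≥0∞} (hp : 1 ≤ p)
    {T : ι → modulationSpace g p p →ₗ[ℂ] modulationSpace g p p}
    (hT : ∀ k, ∃ C : ℝ≥0, ∀ u : modulationSpace g p p,
      modulationNorm g p p (T k u : 𝓢'(Eucl d, ℂ)) ≤ C * modulationNorm g p p (u : 𝓢'(Eucl d, ℂ))) :
    ∃ C : ℝ≥0, ∀ u : modulationSpace g p p,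
      modulationNorm g p p ((∑ k ∈ s, T k) u : modulationSpace g p p) ≤
        C * modulationNorm g p p (u : 𝓢'(Eucl d, ℂ)) := by
  classical
  induction s using Finset.induction_on with
  | empty =>
    refine ⟨0, fun u => ?_⟩
    have : (((∑ k ∈ (∅ : Finset ι), T k) u : modulationSpace g p p) : 𝓢'(Eucl d, ℂ)) = 0 := by simp
    rw [this, modulationNorm_zero]
    exact zero_le
  | insert k s hk ih =>
    obtain ⟨C, hC⟩ := ih
    obtain ⟨D, hD⟩ := hT k
    refine ⟨D + C, fun u => ?_⟩
    have : (((∑ k ∈ insert k s, T k) u : modulationSpace g p p) : 𝓢'(Eucl d, ℂ)) =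
        (T k u : 𝓢'(Eucl d, ℂ)) + ((∑ k ∈ s, T k) u : modulationSpace g p p) := by
      rw [Finset.sum_insert hk]; rfl
    rw [this, ENNReal.coe_add, add_mul]
    exact (modulationNorm_add_le g hp _ _).trans (add_le_add (hD u) (hC u))

theorem IsGivenBy.finset_sum {ι : Type*} (s : Finset ι) {u : ι → 𝓢'(Eucl d, ℂ)}
    {f : ι → Eucl d → ℂ} (h : ∀ k, IsGivenBy (u k) (f k)) :
    IsGivenBy (∑ k ∈ s, u k) fun x => ∑ k ∈ s, f k x := by
  refine ⟨locallyIntegrable_finsetSum s fun k _ => (h k).1, fun ψ hψ => ?_⟩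
  have h1 : (∑ k ∈ s, u k) ψ = ∑ k ∈ s, u k ψ :=
    sum_apply _ _ _
  simp_rw [h1, Finset.sum_mul]
  rw [integral_finsetSum]
  · exact Finset.sum_congr rfl fun k _ => (h k).2 ψ hψ
  · intro k _
    have := (h k).1.integrable_smul_right_of_hasCompactSupport ψ.continuous hψ
    exact this

theorem IsGivenBy.congr_ae {u : 𝓢'(Eucl d, ℂ)} {f f' : Eucl d → ℂ} (h : IsGivenBy u f)
    (hf : f =ᵐ[volume] f') : IsGivenBy u f' := by
  refine ⟨h.1.congr hf, fun ψ hψ => ?_⟩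
  rw [h.2 ψ hψ]
  refine integral_congr_ae ?_
  filter_upwards [hf] with x hx
  rw [hx]

end Boxes

end ModulationSpaces

/-! ### Assembly of the change of variables. -/

theorem proposition3p1 (d : ℕ) (p : ℝ≥0∞) (hp1 : 1 < p) (hp : p < ∞)
    (g : 𝓢(ModulationSpaces.Eucl d, ℂ)) (hg : g ≠ 0)
    (N : ℕ) (Q : Fin N → Set (ModulationSpaces.Eucl d))
    (hQ : ∀ k, ModulationSpaces.IsAxisParallelBox (Q k))
    (hcover : ⋃ k, Q k = Set.univ)
    (hdisj : Pairwise fun j k => Disjoint (interior (Q j)) (interior (Q k)))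
    (φ : ModulationSpaces.Eucl d → ModulationSpaces.Eucl d) (hφ : Continuous φ)
    (A : Fin N → Matrix (Fin d) (Fin d) ℝ) (b : Fin N → ModulationSpaces.Eucl d)
    (hA : ∀ k, IsUnit (A k))
    (haff : ∀ k, ∀ x ∈ Q k, φ x = Matrix.toEuclideanLin (A k) x + b k) :
    ∃ T : ModulationSpaces.modulationSpace g p p →ₗ[ℂ] ModulationSpaces.modulationSpace g p p,
      ModulationSpaces.IsChangeOfVariables g p p φ T ∧
      (∀ T', ModulationSpaces.IsChangeOfVariables g p p φ T' → T' = T) ∧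
      (∀ (u : ModulationSpaces.modulationSpace g p p) (f : ModulationSpaces.Eucl d → ℂ),
        ModulationSpaces.IsGivenBy (u : 𝓢'(ModulationSpaces.Eucl d, ℂ)) f →
        ModulationSpaces.IsGivenBy (T u : 𝓢'(ModulationSpaces.Eucl d, ℂ)) (fun x => f (φ x))) := by
  choose e he using fun k => ModulationSpaces.exists_continuousLinearEquiv_of_isUnit (hA k)
  choose M hMb hM using fun k => ModulationSpaces.exists_box_operator hp1 hp hg (hQ k)
  choose R hRb hR using fun k => ModulationSpaces.exists_affine_operator (e k) (b k) hp1 hp hg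
  -- Pull back by the `k`-th affine map on the whole space, then cut to `Q k`.
  set T := ∑ k, (M k).comp (R k) with hT
  have hgiven : ∀ (u : ModulationSpaces.modulationSpace g p p) (f : ModulationSpaces.Eucl d → ℂ),
      ModulationSpaces.IsGivenBy (u : 𝓢'(ModulationSpaces.Eucl d, ℂ)) f →
      ModulationSpaces.IsGivenBy (T u : 𝓢'(ModulationSpaces.Eucl d, ℂ)) (fun x => f (φ x)) := by
    intro u f hu
    have h1 := ModulationSpaces.IsGivenBy.finset_sum Finset.univ fun k => hM k _ _ (hR k u f hu)
    have h2 : (T u : 𝓢'(ModulationSpaces.Eucl d, ℂ)) =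
        ∑ k, (M k (R k u) : 𝓢'(ModulationSpaces.Eucl d, ℂ)) := by
      rw [hT, LinearMap.sum_apply, Submodule.coe_sum]
      rfl
    rw [h2]
    refine h1.congr_ae ?_
    -- Off the boundaries, membership in a box means membership in its interior, so disjointness of
    -- interiors leaves exactly one nonzero summand.
    have hnull : ∀ᵐ x, ∀ k, x ∉ frontier (Q k) :=
      ae_all_iff.2 fun k => measure_eq_zero_iff_ae_notMem.1 (hQ k).volume_frontier
    filter_upwards [hnull] with x hx
    obtain ⟨k, hk⟩ := Set.mem_iUnion.1 (hcover.symm ▸ Set.mem_univ x : x ∈ ⋃ k, Q k)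
    have hint : ∀ j, x ∈ Q j → x ∈ interior (Q j) := fun j hj => by
      by_contra h
      exact hx j ⟨subset_closure hj, h⟩
    rw [Finset.sum_eq_single k]
    · rw [Set.indicator_of_mem hk, he, haff k x hk]
    · intro j _ hjk
      refine Set.indicator_of_notMem (fun hj => ?_) _
      exact Set.disjoint_left.1 (hdisj hjk) (hint j hj) (hint k hk)
    · intro h
      exact absurd (Finset.mem_univ k) h
  have hT' : ModulationSpaces.IsChangeOfVariables g p p φ T := by
    refine ⟨ModulationSpaces.exists_bound_sum _ hp1.le fun k => ?_, fun u f hu => hgiven u f hu⟩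
    obtain ⟨C, hC⟩ := hMb k
    obtain ⟨D, hD⟩ := hRb k
    refine ⟨C * D, fun u => (hC (R k u)).trans ?_⟩
    rw [ENNReal.coe_mul, mul_assoc]
    gcongr
    exact hD u
  exact ⟨T, hT', fun T' h => hT'.unique hg hp1 hp h, hgiven⟩
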